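/- Let $M$ be a $6$-manifold with smooth closed forms $\rho'\in\Omega^3(M)$, $\omega'\in\Omega^2(M)$, $\rho\in\Omega^3(M)$, $\tau\in\Omega^4(M)$ such that $(\rho',\omega')$ and $(\rho,\tau)$ are $G_2$-pairs, i.e. on $\mathbb R\times M$ the form $\varphi'=\rho'+dt\wedge\omega'$ is pointwise linearly equivalent to the standard $G_2$ $3$-form $\varphi_0$ on $\mathbb R^7$, and $\psi=\tau+dt\wedge\rho$ to $\psi_0=*\varphi_0$. Suppose that $(\rho',\omega')$ tames $(\rho,\tau)$: if $\varphi$ is the $3$-form of the $G_2$-structure with $*\varphi=\psi$, then for each $\psi$-associative $3$-plane $V$ (the associator vanishes on $V$, and $V$ is oriented by $\varphi|_V>0$) there is $K>0$ with $\mathrm{vol}_V\le K\varphi'|_V$. Let $g$ be the metric on $M\cong\{0\}\times M$ induced by $\varphi'$, and let $\hat\rho$ be the Hitchin dual of $\rho$ (so $\rho+i\hat\rho$ is a complex volume form for the almost complex structure determined by $\rho$). Let $P$ be a closed oriented $3$-manifold and $\mathcal F$ the space of smooth embeddings $\iota:P\to M$ with $\iota^*\hat\rho>0$ and $\iota^*\rho'>0$.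 For a $k$-form $\alpha$ on $M$ write $\alpha_N(v_1,\dots,v_{k-1})=\alpha(\iota_*v_1,\dots,\iota_*v_{k-1},\cdot)$, a form on $P$ with values in $\iota^*T^*M$. The perturbed SL section is $L(\lambda,\iota)=(\iota^*\rho,\ \tau_N+d\lambda\wedge\rho_N)\in\Omega^3(P)\times\Omega^3(P,\iota^*T^*M)$ for $(\lambda,\iota)\in C^\infty(P)\times\mathcal F$. The local slice around $(\lambda_0,\iota_0)$ consists of pairs $(\lambda,\exp_{\iota_0}(n))$, where $n$ is a $g$-normal vector field along $\iota_0$ and $\exp$ is the exponential map of $g$. Let $(\lambda,\iota)$ be a zero of $L$ that lies in a local slice $S$. Suppose that $S$ is transverse to the orbit of the diffeomorphism group at $(\lambda,\iota)$, in the sense that the velocities at $(\lambda,\iota)$ of smooth curves in $S$ lie in $C^\infty(P)\times\Gamma(W)$ for a smooth subbundle $W\subset\iota^*TM$ complementary to $\iota_*TP$; for the slice centred at $(\lambda,\iota)$ this holds with $W=N\iota$, the normal bundle with respect to $g$. Then the linearization at $(\lambda,\iota)$ of $L|_S$, i.e. the derivative of $L$ along curves with velocity in $C^\infty(P)\times\Gamma(W)$,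 with second component restricted to $W$, is a well-defined linear operator $$D:\ C^\infty(P)\times\Gamma(W)\longrightarrow\Omega^3(P)\times\Omega^3(P,W^*).$$ It is a differential operator of first order; it is elliptic, i.e. its principal symbol is an isomorphism at each non-zero covector; and it is (formally) self-adjoint with respect to the pairing $$\langle(l,n),(\mu,\eta)\rangle=\int_P l\,\mu+\int_P n\lrcorner\eta ,$$ i.e. $\langle x,Dy\rangle=\langle y,Dx\rangle$ for all $x,y\in C^\infty(P)\times\Gamma(W)$. -/

import Mathlib

open scoped Manifold ContDiff Topology
open Set Bundle

noncomputable section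

namespace PerturbedSL

/-! ### Differential forms on a manifold -/

/-- A (not necessarily smooth) differential `k`-form on an `n`-manifold `X`. -/
abbrev DForm (n k : ℕ) (X : Type*) [TopologicalSpace X]
    [ChartedSpace (EuclideanSpace ℝ (Fin n)) X] : Type _ :=
  ∀ x : X, TangentSpace (𝓡 n) x [⋀^Fin k]→L[ℝ] ℝ

section Forms

variable {n k : ℕ} {X : Type*} [TopologicalSpace X] [ChartedSpace (EuclideanSpace ℝ (Fin n)) X]

/-- The differential at `y` of the inverse of the chart of `X` around `c`. -/
def dChartInv (c : X) (y : EuclideanSpace ℝ (Fin n)) :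
    EuclideanSpace ℝ (Fin n) →L[ℝ] TangentSpace (𝓡 n) ((extChartAt (𝓡 n) c).symm y) :=
  (mfderiv 𝓘(ℝ, EuclideanSpace ℝ (Fin n)) (𝓡 n) (extChartAt (𝓡 n) c).symm y).comp
    (NormedSpace.fromTangentSpace (𝕜 := ℝ) y).symm.toContinuousLinearMap

/-- The expression of a form in the chart around `c`. -/
def formInChart (c : X) (α : DForm n k X) (y : EuclideanSpace ℝ (Fin n)) :
    EuclideanSpace ℝ (Fin n) [⋀^Fin k]→L[ℝ] ℝ :=
  (α ((extChartAt (𝓡 n) c).symm y)).compContinuousLinearMap (dChartInv c y)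

def IsSmoothForm (α : DForm n k X) : Prop :=
  ∀ c : X, ContDiffOn ℝ ∞ (formInChart c α) (extChartAt (𝓡 n) c).target

def IsClosedForm (α : DForm n k X) : Prop :=
  ∀ c : X, ∀ y ∈ (extChartAt (𝓡 n) c).target, extDeriv (formInChart c α) y = 0

lemma formInChart_add (c : X) (α β : DForm n k X) :
    formInChart c (α + β) = formInChart c α + formInChart c β := by
  ext y v; rfl

lemma formInChart_smul (c : X) (a : ℝ) (α : DForm n k X) :
    formInChart c (a • α) = a • formInChart c α := by
  ext y v; rfl

variable (n k X) in
/-- The space `Ω^k(X)` of smooth `k`-forms. -/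
def SmoothForms : Submodule ℝ (DForm n k X) where
  carrier := {α | IsSmoothForm α}
  add_mem' := fun {α β} hα hβ c => by
    rw [formInChart_add]; exact (hα c).add (hβ c)
  zero_mem' := fun c => by
    have h : formInChart c (0 : DForm n k X) = fun _ => 0 := by
      ext y v; rfl
    rw [h]; exact contDiffOn_const
  smul_mem' := fun a α hα c => by
    rw [formInChart_smul]; exact (hα c).const_smul a

end Forms

/-! ### Linear algebra: wedge products, the standard `G₂`-forms, Hitchin duals -/

section LinearAlgebra

variable {V : Type*} [AddCommGroup V] [Module ℝ V] {k : ℕ}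

/-- The wedge product `a ∧ β` of a `1`-form and a `k`-form. -/
def wedge1 (a : V →ₗ[ℝ] ℝ) (β : V [⋀^Fin k]→ₗ[ℝ] ℝ) : V [⋀^Fin (k + 1)]→ₗ[ℝ] ℝ :=
  AlternatingMap.alternatizeUncurryFin (a.smulRight β)

lemma wedge1_apply (a : V →ₗ[ℝ] ℝ) (β : V [⋀^Fin k]→ₗ[ℝ] ℝ) (v : Fin (k + 1) → V) :
    wedge1 a β v = ∑ i : Fin (k + 1), (-1 : ℝ) ^ (i : ℕ) * (a (v i) * β (i.removeNth v)) := by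
  simp [wedge1, AlternatingMap.alternatizeUncurryFin_apply, zsmul_eq_mul]

/-- The `i`-th coordinate `1`-form on `ℝ⁷`. -/
def coord7 (i : Fin 7) : EuclideanSpace ℝ (Fin 7) →ₗ[ℝ] ℝ :=
  (EuclideanSpace.proj i : EuclideanSpace ℝ (Fin 7) →L[ℝ] ℝ).toLinearMap

/-- `dx_i ∧ dx_j ∧ dx_k` on `ℝ⁷`, coordinates being numbered from `0`. -/
def dx3 (i j k : Fin 7) : EuclideanSpace ℝ (Fin 7) [⋀^Fin 3]→ₗ[ℝ] ℝ :=
  wedge1 (coord7 i) (wedge1 (coord7 j) (wedge1 (coord7 k)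
    (AlternatingMap.constOfIsEmpty ℝ (EuclideanSpace ℝ (Fin 7)) (Fin 0) (1 : ℝ))))

/-- `dx_i ∧ dx_j ∧ dx_k ∧ dx_l` on `ℝ⁷`. -/
def dx4 (i j k l : Fin 7) : EuclideanSpace ℝ (Fin 7) [⋀^Fin 4]→ₗ[ℝ] ℝ :=
  wedge1 (coord7 i) (dx3 j k l)

/-- The standard `G₂` `3`-form on `ℝ⁷`. -/
def phi0 : EuclideanSpace ℝ (Fin 7) [⋀^Fin 3]→ₗ[ℝ] ℝ :=
  dx3 0 1 2 + dx3 0 3 4 + dx3 0 5 6 + dx3 1 3 5 - dx3 1 4 6 - dx3 2 3 6 - dx3 2 4 5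

/-- The Hodge dual `ψ₀ = *φ₀` of the standard `3`-form. -/
def psi0 : EuclideanSpace ℝ (Fin 7) [⋀^Fin 4]→ₗ[ℝ] ℝ :=
  dx4 3 4 5 6 + dx4 1 2 5 6 + dx4 1 2 3 4 + dx4 0 2 4 6 - dx4 0 2 3 5 - dx4 0 1 4 5 - dx4 0 1 3 6

/-- The form `α + dt ∧ β` on `ℝ × V`. -/
def cylForm (α : V [⋀^Fin (k + 1)]→ₗ[ℝ] ℝ) (β : V [⋀^Fin k]→ₗ[ℝ] ℝ) :
    (ℝ × V) [⋀^Fin (k + 1)]→ₗ[ℝ] ℝ :=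
  α.compLinearMap (LinearMap.snd ℝ ℝ V) +
    wedge1 (LinearMap.fst ℝ ℝ V) (β.compLinearMap (LinearMap.snd ℝ ℝ V))

/-- `A` identifies the `3`-form `φ` with `φ₀`. -/
def IsFrame3 (φ : V [⋀^Fin 3]→ₗ[ℝ] ℝ) (A : V ≃ₗ[ℝ] EuclideanSpace ℝ (Fin 7)) : Prop :=
  φ = phi0.compLinearMap A.toLinearMap

/-- `A` identifies the `4`-form `ψ` with `ψ₀ = *φ₀`. -/
def IsFrame4 (ψ : V [⋀^Fin 4]→ₗ[ℝ] ℝ) (A : V ≃ₗ[ℝ] EuclideanSpace ℝ (Fin 7)) : Prop :=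
  ψ = psi0.compLinearMap A.toLinearMap

/-- `ρ` is positive (stabilizer `SL(3, ℂ)`) and `ρ + i ρ̂` is a complex volume form for a complex
structure determined by `ρ`, i.e. `ρ + i ρ̂ = dz₁ ∧ dz₂ ∧ dz₃` in suitable complex coordinates. -/
def IsHitchinDual (ρ ρhat : V [⋀^Fin 3]→ₗ[ℝ] ℝ) : Prop :=
  ∃ B : V ≃ₗ[ℝ] (Fin 3 → ℂ), ∀ v : Fin 3 → V,
    ((ρ v : ℂ) + Complex.I * (ρhat v : ℂ)) = (Matrix.of fun i => B (v i)).det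

/-- The `3`-dimensional volume of the parallelepiped spanned by `v` in Euclidean `ℝ⁷`. -/
def vol3 (v : Fin 3 → EuclideanSpace ℝ (Fin 7)) : ℝ :=
  Real.sqrt (Matrix.of fun i j => inner ℝ (v i) (v j)).det

/-- The `3`-form `φ'` tames the `4`-form `ψ`: there is a frame `A` of `ψ`, hence
a `3`-form `φ = A^* φ₀` with `*φ = ψ`, such that `vol_V ≤ K φ'|_V`, for some `K > 0`, on each
`3`-plane `V` that is `ψ`-associative (the associator vanishes on `V`, i.e.
`ψ(u, v, w, ·) = 0`) and oriented by `φ|_V > 0`. -/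
def Tames (φ' : V [⋀^Fin 3]→ₗ[ℝ] ℝ) (ψ : V [⋀^Fin 4]→ₗ[ℝ] ℝ) : Prop :=
  ∃ A : V ≃ₗ[ℝ] EuclideanSpace ℝ (Fin 7), IsFrame4 ψ A ∧
    ∀ v : Fin 3 → V, LinearIndependent ℝ v → (∀ z : V, ψ (Fin.snoc v z) = 0) →
      0 < phi0 (fun i => A (v i)) → ∃ K : ℝ, 0 < K ∧ vol3 (fun i => A (v i)) ≤ K * φ' v

end LinearAlgebra

/-! ### `G₂`-pairs on a `6`-manifold -/

section Pairs

variable {M : Type*} [TopologicalSpace M] [ChartedSpace (EuclideanSpace ℝ (Fin 6)) M]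

/-- `φ = ρ + dt ∧ ω` on `T_{(t,x)}(ℝ × M) = ℝ × T_x M`. -/
def cyl3 (ρ : DForm 6 3 M) (om : DForm 6 2 M) (x : M) :
    (ℝ × TangentSpace (𝓡 6) x) [⋀^Fin 3]→ₗ[ℝ] ℝ :=
  cylForm (ρ x).toAlternatingMap (om x).toAlternatingMap

/-- `ψ = τ + dt ∧ ρ` on `T_{(t,x)}(ℝ × M) = ℝ × T_x M`. -/
def cyl4 (ρ : DForm 6 3 M) (τ : DForm 6 4 M) (x : M) :
    (ℝ × TangentSpace (𝓡 6) x) [⋀^Fin 4]→ₗ[ℝ] ℝ :=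
  cylForm (τ x).toAlternatingMap (ρ x).toAlternatingMap

/-- `(ρ, ω)` is a smooth closed `G₂`-pair consisting of a `3`-form and a `2`-form. -/
structure IsClosedG2Pair32 (ρ : DForm 6 3 M) (om : DForm 6 2 M) : Prop where
  smooth_left : IsSmoothForm ρ
  smooth_right : IsSmoothForm om
  closed_left : IsClosedForm ρ
  closed_right : IsClosedForm om
  stable : ∀ x, ∃ A, IsFrame3 (cyl3 ρ om x) A

/-- `(ρ, τ)` is a smooth closed `G₂`-pair consisting of a `3`-form and a `4`-form. -/
structure IsClosedG2Pair34 (ρ : DForm 6 3 M) (τ : DForm 6 4 M) : Prop where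
  smooth_left : IsSmoothForm ρ
  smooth_right : IsSmoothForm τ
  closed_left : IsClosedForm ρ
  closed_right : IsClosedForm τ
  stable : ∀ x, ∃ A, IsFrame4 (cyl4 ρ τ x) A

/-- Smooth Riemannian metrics on `M`. -/
abbrev RMetric (M : Type*) [TopologicalSpace M] [ChartedSpace (EuclideanSpace ℝ (Fin 6)) M]
    [IsManifold (𝓡 6) ∞ M] : Type _ :=
  ContMDiffRiemannianMetric (𝓡 6) ∞ (EuclideanSpace ℝ (Fin 6))
    (fun x : M => TangentSpace (𝓡 6) x)

/-- `g` is the restriction to `{0} × M` of the metric of the `G₂`-structure `ρ + dt ∧ ω`. -/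
def IsInducedMetric [IsManifold (𝓡 6) ∞ M] (g : RMetric M) (ρ : DForm 6 3 M)
    (om : DForm 6 2 M) : Prop :=
  ∀ x : M, ∃ A, IsFrame3 (cyl3 ρ om x) A ∧
    ∀ u v : TangentSpace (𝓡 6) x, g.inner x u v = inner ℝ (A (0, u)) (A (0, v))

end Pairs

/-! ### Integration of `3`-forms over an oriented closed `3`-manifold -/

section Integral

variable {P : Type*} [TopologicalSpace P] [ChartedSpace (EuclideanSpace ℝ (Fin 3)) P]

/-- An orientation of `P`, represented by a nowhere vanishing smooth `3`-form. -/
structure IsOrientationForm (θ : DForm 3 3 P) : Prop where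
  smooth : IsSmoothForm θ
  ne_zero : ∀ p, θ p ≠ 0

/-- `μ > 0` with respect to the orientation given by `θ`. -/
def IsPositive (θ μ : DForm 3 3 P) : Prop := ∀ p v, 0 < θ p v → 0 < μ p v

/-- The coefficient of a `3`-form in the chart around `c`. -/
def coeff (c : P) (μ : DForm 3 3 P) (y : EuclideanSpace ℝ (Fin 3)) : ℝ :=
  formInChart c μ y (fun i => EuclideanSpace.single i 1)

variable (P) in
/-- A smooth partition of unity on `P` subordinate to the chart domains. -/
def chartPartition [IsManifold (𝓡 3) ∞ P] [CompactSpace P] [T2Space P] :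
    SmoothPartitionOfUnity P (𝓡 3) P univ :=
  (SmoothPartitionOfUnity.exists_isSubordinate_chartAt_source (𝓡 3) P).choose

/-- The integral of a `3`-form over `P`, with the orientation given by `θ`. -/
def integral [IsManifold (𝓡 3) ∞ P] [CompactSpace P] [T2Space P] (θ μ : DForm 3 3 P) : ℝ :=
  ∑ᶠ c : P, ∫ y in (extChartAt (𝓡 3) c).target,
    chartPartition P c ((extChartAt (𝓡 3) c).symm y) * (Real.sign (coeff c θ y) * coeff c μ y)

end Integral

/-! ### The perturbed special Lagrangian section -/

section Section

variable {M : Type*} [TopologicalSpace M] [ChartedSpace (EuclideanSpace ℝ (Fin 6)) M]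
  {P : Type*} [TopologicalSpace P] [ChartedSpace (EuclideanSpace ℝ (Fin 3)) P]

/-- Smooth real functions on `P`. -/
abbrev SFun (P : Type*) [TopologicalSpace P] [ChartedSpace (EuclideanSpace ℝ (Fin 3)) P] : Type _ :=
  C^∞⟮𝓡 3, P; 𝓘(ℝ, ℝ), ℝ⟯

/-- The differential of a function at `p`. -/
def dFun (f : P → ℝ) (p : P) : TangentSpace (𝓡 3) p →L[ℝ] ℝ :=
  (NormedSpace.fromTangentSpace (𝕜 := ℝ) (f p)).toContinuousLinearMap.comp
    (mfderiv (𝓡 3) 𝓘(ℝ, ℝ) f p)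

/-- The pullback `ι^* α`. -/
def pullback {k : ℕ} (ι : P → M) (α : DForm 6 k M) : DForm 3 k P := fun p =>
  (α (ι p)).compContinuousLinearMap (mfderiv (𝓡 3) (𝓡 6) ι p)

/-- `α_N (v₁, …, v_k) (m) = α (ι_* v₁, …, ι_* v_k, m)`; see `normalPart_apply`. -/
def normalPart {k : ℕ} (ι : P → M) (α : DForm 6 (k + 1) M) (p : P)
    (m : TangentSpace (𝓡 6) (ι p)) : TangentSpace (𝓡 3) p [⋀^Fin k]→ₗ[ℝ] ℝ :=
  ((-1 : ℝ) ^ k) • ((α (ι p)).toAlternatingMap.curryLeft m).compLinearMap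
    (mfderiv (𝓡 3) (𝓡 6) ι p).toLinearMap

lemma normalPart_apply {k : ℕ} (ι : P → M) (α : DForm 6 (k + 1) M) (p : P)
    (m : TangentSpace (𝓡 6) (ι p)) (v : Fin k → TangentSpace (𝓡 3) p) :
    normalPart ι α p m v =
      α (ι p) (Fin.snoc (fun i => mfderiv (𝓡 3) (𝓡 6) ι p (v i)) m) := by
  have h := (α (ι p)).toAlternatingMap.map_insertNth (Fin.last k) m
    (fun i => mfderiv (𝓡 3) (𝓡 6) ι p (v i))
  rw [Fin.insertNth_last'] at h
  simp only [Fin.val_last] at h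
  simpa [normalPart] using h.symm

/-- The first component `ι^* ρ` of the section `L`. -/
def L₁ (ρ : DForm 6 3 M) (ι : P → M) : DForm 3 3 P := pullback ι ρ

/-- The second component `τ_N + dλ ∧ ρ_N` of the section `L`, evaluated on `m ∈ T_{ι(p)} M`. -/
def L₂ (ρ : DForm 6 3 M) (τ : DForm 6 4 M) (lam : P → ℝ) (ι : P → M) (p : P)
    (m : TangentSpace (𝓡 6) (ι p)) : TangentSpace (𝓡 3) p [⋀^Fin 3]→ₗ[ℝ] ℝ :=
  normalPart ι τ p m + wedge1 (dFun lam p).toLinearMap (normalPart ι ρ p m)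

/-- `(λ, ι)` solves the perturbed special Lagrangian equations, i.e. `L(λ, ι) = 0`. -/
def IsSolution (ρ : DForm 6 3 M) (τ : DForm 6 4 M) (lam : P → ℝ) (ι : P → M) : Prop :=
  (∀ p, L₁ ρ ι p = 0) ∧ ∀ p m, L₂ ρ τ lam ι p m = 0

/-- `ι` is a smooth embedding with `ι^* ρ̂ > 0` and `ι^* ρ' > 0`. -/
structure IsAdmissible (θ : DForm 3 3 P) (ρhat ρ' : DForm 6 3 M) (ι : P → M) : Prop where
  embedding : Manifold.IsSmoothEmbedding (𝓡 3) (𝓡 6) ∞ ι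
  pos_hat : IsPositive θ (pullback ι ρhat)
  pos_prime : IsPositive θ (pullback ι ρ')

end Section

/-! ### Vector fields along `ι`, subbundles of `ι^* TM`, forms with values in the dual -/

section Fields

variable {M : Type*} [TopologicalSpace M] [ChartedSpace (EuclideanSpace ℝ (Fin 6)) M]
  {P : Type*} [TopologicalSpace P] [ChartedSpace (EuclideanSpace ℝ (Fin 3)) P]

/-- A tangent vector together with its base point. -/
abbrev tv (x : M) (v : TangentSpace (𝓡 6) x) : TangentBundle (𝓡 6) M := ⟨x, v⟩

/-- Families of subspaces `W_p ⊆ T_{ι(p)} M`. -/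
abbrev SubFamily (ι : P → M) : Type _ := ∀ p : P, Submodule ℝ (TangentSpace (𝓡 6) (ι p))

variable [IsManifold (𝓡 6) ∞ M]

def IsSmoothField (ι : P → M) (n : ∀ p, TangentSpace (𝓡 6) (ι p)) : Prop :=
  ContMDiff (𝓡 3) (𝓡 6).tangent ∞ fun p => tv (ι p) (n p)

lemma IsSmoothField.iff_coord {ι : P → M} {n : ∀ p, TangentSpace (𝓡 6) (ι p)} :
    IsSmoothField ι n ↔ ContMDiff (𝓡 3) (𝓡 6) ∞ ι ∧ ∀ p₀, ContMDiffAt (𝓡 3)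
      𝓘(ℝ, EuclideanSpace ℝ (Fin 6)) ∞ (fun p =>
        (trivializationAt (EuclideanSpace ℝ (Fin 6)) (TangentSpace (𝓡 6)) (ι p₀)
          (tv (ι p) (n p))).2) p₀ := by
  constructor
  · intro h
    exact ⟨fun p => (Bundle.contMDiffAt_totalSpace.1 (h p)).1,
      fun p => (Bundle.contMDiffAt_totalSpace.1 (h p)).2⟩
  · rintro ⟨h1, h2⟩ p
    exact Bundle.contMDiffAt_totalSpace.2 ⟨h1 p, h2 p⟩

lemma IsSmoothField.lin {ι : P → M} {n m : ∀ p, TangentSpace (𝓡 6) (ι p)}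
    (hn : IsSmoothField ι n) (hm : IsSmoothField ι m) {f h : P → ℝ}
    (hf : ContMDiff (𝓡 3) 𝓘(ℝ, ℝ) ∞ f) (hh : ContMDiff (𝓡 3) 𝓘(ℝ, ℝ) ∞ h) :
    IsSmoothField ι (fun p => f p • n p + h p • m p) := by
  rw [IsSmoothField.iff_coord] at *
  refine ⟨hn.1, fun p₀ => ?_⟩
  have key := ((hf p₀).smul (hn.2 p₀)).add ((hh p₀).smul (hm.2 p₀))
  refine key.congr_of_eventuallyEq ?_
  have hopen : ∀ᶠ p in 𝓝 p₀, ι p ∈ (trivializationAt (EuclideanSpace ℝ (Fin 6))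
      (TangentSpace (𝓡 6)) (ι p₀)).baseSet :=
    hn.1.continuous.continuousAt.eventually_mem
      ((trivializationAt _ _ _).open_baseSet.mem_nhds (mem_baseSet_trivializationAt _ _ _))
  filter_upwards [hopen] with p hp
  have hl := (trivializationAt (EuclideanSpace ℝ (Fin 6))
    (TangentSpace (𝓡 6)) (ι p₀)).linear ℝ hp
  simp [hl.map_add, hl.map_smul]

/-- The space `Γ(W)` of smooth vector fields along `ι` with values in `W`. -/
def Sections (ι : P → M) (hι : ContMDiff (𝓡 3) (𝓡 6) ∞ ι) (W : SubFamily ι) :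
    Submodule ℝ (∀ p, TangentSpace (𝓡 6) (ι p)) where
  carrier := {n | IsSmoothField ι n ∧ ∀ p, n p ∈ W p}
  add_mem' := fun {n m} hn hm => by
    refine ⟨?_, fun p => (W p).add_mem (hn.2 p) (hm.2 p)⟩
    have h := hn.1.lin hm.1 (f := fun _ => 1) (h := fun _ => 1) contMDiff_const contMDiff_const
    simp only [one_smul] at h
    exact h
  zero_mem' := ⟨(Bundle.contMDiff_zeroSection ℝ (TangentSpace (𝓡 6))).comp hι,
    fun p => (W p).zero_mem⟩
  smul_mem' := fun a n hn => by
    refine ⟨?_, fun p => (W p).smul_mem a (hn.2 p)⟩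
    have h := hn.1.lin hn.1 (f := fun _ => a) (h := fun _ => 0) contMDiff_const contMDiff_const
    simp only [zero_smul, add_zero] at h
    exact h

/-- A (not necessarily smooth) element of `Ω³(P, W^*)`: it takes `w ∈ W_p` to a `3`-form on
`T_p P`. -/
abbrev DualForm (ι : P → M) (W : SubFamily ι) : Type _ :=
  ∀ p : P, W p →ₗ[ℝ] (TangentSpace (𝓡 3) p [⋀^Fin 3]→L[ℝ] ℝ)

/-- The space `Ω³(P, W^*)`; `η` is smooth when `η(n)` is smooth for all `n ∈ Γ(W)`. -/
def DualForms (ι : P → M) (hι : ContMDiff (𝓡 3) (𝓡 6) ∞ ι) (W : SubFamily ι) :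
    Submodule ℝ (DualForm ι W) where
  carrier := {η | ∀ n : Sections ι hι W,
    (fun p => η p ⟨n.1 p, n.2.2 p⟩) ∈ SmoothForms 3 3 P}
  add_mem' := fun {_ _} hη hζ n => (SmoothForms 3 3 P).add_mem (hη n) (hζ n)
  zero_mem' := fun _ => (SmoothForms 3 3 P).zero_mem
  smul_mem' := fun a _ hη n => (SmoothForms 3 3 P).smul_mem a (hη n)

/-! ### First-order operators `C^∞(P) × Γ(W) → Ω³(P) × Ω³(P, W^*)` -/

variable {ι : P → M} {hι : ContMDiff (𝓡 3) (𝓡 6) ∞ ι} {W : SubFamily ι}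

/-- The domain `C^∞(P) × Γ(W)`: the sections of the bundle `E` with fibres `E_p = ℝ × W_p`. -/
abbrev Dom (ι : P → M) (hι : ContMDiff (𝓡 3) (𝓡 6) ∞ ι) (W : SubFamily ι) : Type _ :=
  SFun P × Sections ι hι W

/-- The codomain `Ω³(P) × Ω³(P, W^*)`: the sections of the bundle `F` with fibres
`F_p = Λ³T_p^*P × (Λ³T_p^*P ⊗ W_p^*)`. -/
abbrev Cod (ι : P → M) (hι : ContMDiff (𝓡 3) (𝓡 6) ∞ ι) (W : SubFamily ι) : Type _ :=
  SmoothForms 3 3 P × DualForms ι hι W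

abbrev FibE (ι : P → M) (W : SubFamily ι) (p : P) : Type _ := ℝ × W p

abbrev FibF (ι : P → M) (W : SubFamily ι) (p : P) : Type _ :=
  (TangentSpace (𝓡 3) p [⋀^Fin 3]→L[ℝ] ℝ) ×
    (W p →ₗ[ℝ] (TangentSpace (𝓡 3) p [⋀^Fin 3]→L[ℝ] ℝ))

def Dom.at (x : Dom ι hι W) (p : P) : FibE ι W p := (x.1 p, ⟨x.2.1 p, x.2.2.2 p⟩)

def Cod.at (y : Cod ι hι W) (p : P) : FibF ι W p := (y.1.1 p, y.2.1 p)

/-- Multiplication of a section by a smooth function. -/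
def Dom.mul (f : SFun P) (x : Dom ι hι W) : Dom ι hι W :=
  (f * x.1, ⟨fun p => f p • x.2.1 p, by
    refine ⟨?_, fun p => (W p).smul_mem _ (x.2.2.2 p)⟩
    have h := x.2.2.1.lin x.2.2.1 f.contMDiff (h := fun _ => 0) contMDiff_const
    simpa using h⟩)

/-- `D` is a differential operator of order at most one: `[[D, f], h] = 0` for all smooth
functions `f` and `h`. -/
def IsFirstOrder (D : Dom ι hι W →ₗ[ℝ] Cod ι hι W) : Prop :=
  ∀ (f h : SFun P) (x : Dom ι hι W) (p : P),
    (D (x.mul (f * h))).at p - f p • (D (x.mul h)).at p - h p • (D (x.mul f)).at p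
      + (f p * h p) • (D x).at p = 0

/-- `σ` is the (first-order) principal symbol of `D`: `σ(p, dg_p) x(p) = D((g - g(p)) x)(p)`. -/
def IsPrincipalSymbol (D : Dom ι hι W →ₗ[ℝ] Cod ι hι W)
    (σ : ∀ p : P, (TangentSpace (𝓡 3) p →L[ℝ] ℝ) → (FibE ι W p →ₗ[ℝ] FibF ι W p)) : Prop :=
  ∀ (p : P) (g : SFun P) (x : Dom ι hι W),
    (D (x.mul (g - ContMDiffMap.const (g p)))).at p = σ p (dFun g p) (x.at p)

/-- `D` is elliptic: its principal symbol is invertible at every non-zero covector. -/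
def IsElliptic (D : Dom ι hι W →ₗ[ℝ] Cod ι hι W) : Prop :=
  ∃ σ, IsPrincipalSymbol D σ ∧ ∀ p α, α ≠ 0 → Function.Bijective (σ p α)

/-- The pointwise pairing `l μ + n ⌟ η` of `(l, n) ∈ C^∞(P) × Γ(W)` with
`(μ, η) ∈ Ω³(P) × Ω³(P, W^*)`. The interior product puts `n` into the first slot, in front of the
three arguments from `TP`, whereas the covector slot of `η` is the last one; hence the sign. -/
def pairing (x : Dom ι hι W) (y : Cod ι hι W) : DForm 3 3 P := fun p =>
  x.1 p • y.1.1 p + ((-1 : ℝ) ^ 3) • y.2.1 p ⟨x.2.1 p, x.2.2.2 p⟩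

/-- `D` is (formally) self-adjoint: `∫_P ⟨x, D y⟩ = ∫_P ⟨y, D x⟩`. -/
def IsSelfAdjointOp [IsManifold (𝓡 3) ∞ P] [CompactSpace P] [T2Space P] (θ : DForm 3 3 P)
    (D : Dom ι hι W →ₗ[ℝ] Cod ι hι W) : Prop :=
  ∀ x y : Dom ι hι W, integral θ (pairing x (D y)) = integral θ (pairing y (D x))

/-! ### Linearization -/

/-- A smooth curve `s ↦ (λ_s, ι_s)`, `|s| < ε`, with `(λ_0, ι_0) = (λ, ι)`. -/
structure IsCurve (lam : P → ℝ) (ι : P → M) (ε : ℝ) (Λ : ℝ → P → ℝ) (I : ℝ → P → M) : Prop where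
  pos : 0 < ε
  init_fun : Λ 0 = lam
  init_map : I 0 = ι
  smooth_fun : ContMDiffOn (𝓘(ℝ, ℝ).prod (𝓡 3)) 𝓘(ℝ, ℝ) ∞ (fun q : ℝ × P => Λ q.1 q.2)
    (Ioo (-ε) ε ×ˢ univ)
  smooth_map : ContMDiffOn (𝓘(ℝ, ℝ).prod (𝓡 3)) (𝓡 6) ∞ (fun q : ℝ × P => I q.1 q.2)
    (Ioo (-ε) ε ×ˢ univ)

/-- The velocity of a curve `γ` in `M` at time `t`, as an element of `TM`. -/
def velocity (γ : ℝ → M) (t : ℝ) : TangentBundle (𝓡 6) M :=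
  tv (γ t) (mfderiv 𝓘(ℝ, ℝ) (𝓡 6) γ t (1 : ℝ))

/-- `D` is the linearization at the zero `(λ, ι)` of `L = (ι^* ρ, τ_N + dλ ∧ ρ_N)` in the
directions `C^∞(P) × Γ(W)`: along each smooth curve `(λ_s, ι_s)` through `(λ, ι)` with velocity
`(l, n) ∈ C^∞(P) × Γ(W)`, the derivative of `L(λ_s, ι_s)` at `s = 0` is `D(l, n)`. As the second
component at time `s` is a `3`-form with values in `ι_s^* T^*M`, it is evaluated on
vectors `m_s ∈ T_{ι_s(p)} M` that depend smoothly on `s`; as `L(λ, ι) = 0`, the derivative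
depends on `m_0 ∈ W_p` only. -/
def IsLinearization (ρ : DForm 6 3 M) (τ : DForm 6 4 M) (lam : P → ℝ)
    (D : Dom ι hι W →ₗ[ℝ] Cod ι hι W) : Prop :=
  ∀ (ε : ℝ) (Λ : ℝ → P → ℝ) (I : ℝ → P → M) (x : Dom ι hι W), IsCurve lam ι ε Λ I →
    (∀ p, HasDerivAt (fun s => Λ s p) (x.1 p) 0) →
    (∀ p, velocity (fun s => I s p) 0 = tv (ι p) (x.2.1 p)) →
    ∀ (p : P) (v : Fin 3 → TangentSpace (𝓡 3) p),
      HasDerivAt (fun s => L₁ ρ (I s) p v) ((D x).1.1 p v) 0 ∧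
      ∀ (w : W p) (m : ∀ s, TangentSpace (𝓡 6) (I s p)),
        ContMDiffAt 𝓘(ℝ, ℝ) (𝓡 6).tangent ∞ (fun s => tv (I s p) (m s)) 0 →
        tv (I 0 p) (m 0) = tv (ι p) w →
        HasDerivAt (fun s => L₂ ρ τ (Λ s) (I s) p (m s) v) ((D x).2.1 p w v) 0

/-! ### The exponential map and local slices -/

/-- The metric `g` in the chart around `c`. -/
def metricInChart (g : RMetric M) (c : M) (y u v : EuclideanSpace ℝ (Fin 6)) : ℝ :=
  g.inner ((extChartAt (𝓡 6) c).symm y) (dChartInv c y u) (dChartInv c y v)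

/-- `γ` is a `g`-geodesic on the open interval `(a, b)`: in each chart,
`g(x'', w) + (∂_{x'} g)(x', w) - ½ (∂_w g)(x', x') = 0` for all `w`. -/
def IsGeodesicOn (g : RMetric M) (γ : ℝ → M) (a b : ℝ) : Prop :=
  ContMDiffOn 𝓘(ℝ, ℝ) (𝓡 6) ∞ γ (Ioo a b) ∧
  ∀ t ∈ Ioo a b, ∀ c : M, γ t ∈ (chartAt (EuclideanSpace ℝ (Fin 6)) c).source →
    ∀ w : EuclideanSpace ℝ (Fin 6),
      let x : ℝ → EuclideanSpace ℝ (Fin 6) := fun s => extChartAt (𝓡 6) c (γ s)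
      metricInChart g c (x t) (deriv (deriv x) t) w
        + fderiv ℝ (fun y => metricInChart g c y (deriv x t) w) (x t) (deriv x t)
        - (1 / 2) * fderiv ℝ (fun y => metricInChart g c y (deriv x t) (deriv x t)) (x t) w = 0

/-- `y = exp_x(v)` for the Riemannian metric `g`. -/
def IsExp (g : RMetric M) (x : M) (v : TangentSpace (𝓡 6) x) (y : M) : Prop :=
  ∃ (γ : ℝ → M) (δ : ℝ), 0 < δ ∧ IsGeodesicOn g γ (-δ) (1 + δ) ∧
    velocity γ 0 = tv x v ∧ γ 1 = y

/-- The tangent spaces `ι_*(T_p P) ⊆ T_{ι(p)} M` of the submanifold. -/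
def tangentFamily (ι : P → M) : SubFamily ι := fun p =>
  LinearMap.range (mfderiv (𝓡 3) (𝓡 6) ι p).toLinearMap

/-- The fibres `N_p ι` of the normal bundle with respect to `g`. -/
def normalFamily (g : RMetric M) (ι : P → M) : SubFamily ι := fun p =>
  { carrier := {n | ∀ v : TangentSpace (𝓡 3) p, g.inner (ι p) n (mfderiv (𝓡 3) (𝓡 6) ι p v) = 0}
    add_mem' := fun {a b} ha hb v => by simp [ha v, hb v]
    zero_mem' := fun v => by simp
    smul_mem' := fun c n hn v => by simp [hn v] }

/-- `(λ, ι)` is the point with coordinate `ν ∈ Γ(N ι₀)` of the local slice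
`S = {(λ, exp_{ι₀}(n)) : n ∈ Γ(N ι₀)}` around an embedding `ι₀`
(there is no condition on the function `λ`). -/
structure IsSlicePoint (g : RMetric M) (ι₀ : P → M) (ν : ∀ p, TangentSpace (𝓡 6) (ι₀ p))
    (ι : P → M) : Prop where
  smooth : IsSmoothField ι₀ ν
  normal : ∀ p, ν p ∈ normalFamily g ι₀ p
  exp : ∀ p, IsExp g (ι₀ p) (ν p) (ι p)

/-- `(λ_s, ι_s)` is a smooth curve through `(λ, ι)` that runs in the slice around `ι₀`: in the
slice coordinates it is given by a smooth family `n_s ∈ Γ(N ι₀)` with `n_0 = ν`. -/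
structure IsSliceCurve (g : RMetric M) (ι₀ : P → M) (ν : ∀ p, TangentSpace (𝓡 6) (ι₀ p))
    (lam : P → ℝ) (ι : P → M) (ε : ℝ) (Λ : ℝ → P → ℝ) (I : ℝ → P → M)
    (n : ℝ → ∀ p, TangentSpace (𝓡 6) (ι₀ p)) : Prop where
  curve : IsCurve lam ι ε Λ I
  init : n 0 = ν
  smooth : ContMDiffOn (𝓘(ℝ, ℝ).prod (𝓡 3)) (𝓡 6).tangent ∞
    (fun q : ℝ × P => tv (ι₀ q.2) (n q.1 q.2)) (Ioo (-ε) ε ×ˢ univ)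
  slice : ∀ s ∈ Ioo (-ε) ε, IsSlicePoint g ι₀ (n s) (I s)

/-- The slice around `ι₀` is transverse to the orbit of the diffeomorphism group at its point
`(λ, ι)` with coordinate `ν`, with tangent directions `C^∞(P) × Γ(W)`: `W` is a smooth
subbundle of `ι^* TM` (constant rank, and each vector in it extends to a smooth section)
complementary to `ι_* TP`, and all curves in the slice have their velocity in `W`. -/
structure IsSliceTangentBundle (g : RMetric M) (ι₀ : P → M)
    (ν : ∀ p, TangentSpace (𝓡 6) (ι₀ p)) (lam : P → ℝ) (ι : P → M) (W : SubFamily ι) : Prop where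
  compl : ∀ p, IsCompl (W p) (tangentFamily ι p)
  extend : ∀ p, ∀ w ∈ W p, ∃ n : ∀ q, TangentSpace (𝓡 6) (ι q),
    IsSmoothField ι n ∧ (∀ q, n q ∈ W q) ∧ n p = w
  tangent : ∀ ε Λ I n, IsSliceCurve g ι₀ ν lam ι ε Λ I n →
    ∀ p, ∃ w ∈ W p, velocity (fun s => I s p) 0 = tv (ι p) w

end Fields

end PerturbedSL

open PerturbedSL

/-! Everything reduces to one closed form on a cylinder. Put Ψ = τ + dt ∧ ρ on ℝ × M and F = (λ, ι)
: P → ℝ × M. For a vector Y = (r, m) along F one has F^*(Y ⌟ Ψ) = r ι^*ρ − (τ_N + dλ ∧ ρ_N)(m)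
(`contractPullback_psiInChart`). So Y ↦ F^*(Y ⌟ Ψ) contains both components of L, and L(λ, ι) = 0
says that the image of each tangent space of P under the differential of F is associative for Ψ.

Linearization. Differentiating F_s^*(Y_s ⌟ Ψ) along a curve with velocity X gives terms in the 1-jet
of X and Y_0, plus the term F^*(Y_0' ⌟ Ψ), which vanishes at a solution
(`hasDerivAt_contractPullback`). Hence the derivative depends on Y_0 only and is of first order in
X; although it is computed in charts, it does not depend on them (`derivInCharts_eq`). It is unique
because each field supported in a chart is the velocity of a straight-line curve, and a partition of
unity writes every field as a sum of such fields.

Self-adjointness. Write B(X, Y) for the derivative in the direction X, evaluated on Y. Closedness of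
Ψ gives B(Y, X) − B(X, Y) = d F^*(Ψ(X, Y, ·, ·)) (`extDeriv_contractPullback₂`). The signs are
arranged so that ⟨x, Dy⟩ is the integral of B(y, x) (`pairing_linearizedOperator`), and Stokes'
theorem finishes the argument.

Ellipticity. For a covector β ≠ 0 choose a basis with β(u₀) = 1 and β(u₁) = β(u₂) = 0; the symbol
applied to X then becomes Y ↦ Ψ(Y, X, F_*u₁, F_*u₂). If this vanishes for Y in ℝ × W, it vanishes
for all Y, since vectors tangent to F contribute nothing at a solution. In G₂ geometry an
associative plane is determined by two independent vectors in it: ψ₀(a, b, x, ·) = 0 forces x into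
the span of a, b and a × b (`mem_span_of_psi0_eq_zero`). So X is tangent to F, its M-component lies
in W ∩ ι_*TP = 0, and X = 0 because ι is an immersion. Equality of ranks turns injectivity into
bijectivity.

Centre of a slice. The geodesic equation bounds acceleration by the square of the speed, so that
exp_x(v) = x + v + O(|v|²) in a chart (`IsGeodesicOn.norm_sub_le`). A slice curve n_s with n_0 = 0
therefore has velocity ∂_s n_s at s = 0, which is again normal. -/

namespace PerturbedSL

/-! ### Smoothness of pullbacks of alternating maps -/

section Pullback

variable {E F : Type*} [NormedAddCommGroup E] [NormedSpace ℝ E]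
  [NormedAddCommGroup F] [NormedSpace ℝ F] {n : ℕ}

/-- Antisymmetrization, as a continuous linear map which is a left inverse of the inclusion
of alternating maps into multilinear maps. -/
def antisymm (E : Type*) [NormedAddCommGroup E] [NormedSpace ℝ E] (n : ℕ) :
    ContinuousMultilinearMap ℝ (fun _ : Fin n => E) ℝ →L[ℝ] E [⋀^Fin n]→L[ℝ] ℝ :=
  LinearMap.mkContinuous
    { toFun := fun f => ((n.factorial : ℝ)⁻¹) • ContinuousMultilinearMap.alternatization f
      map_add' := fun f g => by simp
      map_smul' := fun c f => by
        ext v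
        simp [ContinuousMultilinearMap.alternatization_apply_apply, Finset.mul_sum,
          smul_eq_mul, Units.smul_def]
        refine Finset.sum_congr rfl fun σ _ => ?_
        ring } 1 (fun f => by
      refine ContinuousAlternatingMap.opNorm_le_bound _ (by positivity) fun v => ?_
      simp only [LinearMap.coe_mk, AddHom.coe_mk, ContinuousAlternatingMap.smul_apply,
        ContinuousMultilinearMap.alternatization_apply_apply, norm_smul, norm_inv,
        RCLike.norm_natCast, one_mul]
      rw [inv_mul_le_iff₀ (by positivity)]
      refine (norm_sum_le _ _).trans ?_
      have : ∀ σ ∈ (Finset.univ : Finset (Equiv.Perm (Fin n))),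
          ‖Equiv.Perm.sign σ • f (v ∘ σ)‖ ≤ ‖f‖ * ∏ i, ‖v i‖ := by
        intro σ _
        have h1 : ‖Equiv.Perm.sign σ • f (v ∘ σ)‖ = ‖f (v ∘ σ)‖ := by
          rcases Int.units_eq_one_or (Equiv.Perm.sign σ) with h | h <;> simp [h]
        rw [h1]
        refine (f.le_opNorm _).trans (le_of_eq ?_)
        congr 1
        exact Equiv.prod_comp σ fun i => ‖v i‖
      refine (Finset.sum_le_card_nsmul _ _ _ this).trans (le_of_eq ?_)
      simp [Finset.card_univ, Fintype.card_perm])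

lemma antisymm_apply (f : E [⋀^Fin n]→L[ℝ] ℝ) :
    antisymm E n f.toContinuousMultilinearMap = f := by
  ext v
  have : ∀ σ : Equiv.Perm (Fin n),
      Equiv.Perm.sign σ • f.toContinuousMultilinearMap (v ∘ σ) = f v := by
    intro σ
    have := f.toAlternatingMap.map_perm v σ
    simp only [ContinuousAlternatingMap.coe_toAlternatingMap] at this
    simp only [ContinuousAlternatingMap.coe_toContinuousMultilinearMap, this, smul_smul]
    rcases Int.units_eq_one_or (Equiv.Perm.sign σ) with h | h <;> simp [h]
  simp [antisymm, ContinuousMultilinearMap.alternatization_apply_apply, this, Fintype.card_perm,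
    -ContinuousAlternatingMap.coe_toContinuousMultilinearMap]
  field_simp

/-- For multilinear maps, f(A₁·, …, A_n·) is multilinear in the A_i and linear in f, hence smooth.
Alternating maps are embedded into multilinear ones, and the continuous linear left inverse
`antisymm` brings the result back. -/
lemma contDiff_compContinuousLinearMap :
    ContDiff ℝ ∞ fun q : (F [⋀^Fin n]→L[ℝ] ℝ) × (E →L[ℝ] F) =>
      q.1.compContinuousLinearMap q.2 := by
  have h : (fun q : (F [⋀^Fin n]→L[ℝ] ℝ) × (E →L[ℝ] F) => q.1.compContinuousLinearMap q.2) =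
      fun q => antisymm E n
        ((ContinuousMultilinearMap.compContinuousLinearMapContinuousMultilinear ℝ
          (fun _ : Fin n => E) (fun _ => F) ℝ) (fun _ => q.2)
            (ContinuousAlternatingMap.toContinuousMultilinearMapCLM ℝ q.1)) := by
    funext q
    exact (antisymm_apply (q.1.compContinuousLinearMap q.2)).symm
  rw [h]
  refine (antisymm E n).contDiff.comp (ContDiff.clm_apply ?_ ?_)
  · exact (ContinuousMultilinearMap.contDiff _).comp (contDiff_pi.2 fun _ => contDiff_snd)
  · exact (ContinuousLinearMap.contDiff _).comp contDiff_fst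

end Pullback

/-! ### Pullbacks of the contractions of a `4`-form, and their linearization -/

section Linearize

variable {E H : Type*} [NormedAddCommGroup E] [NormedSpace ℝ E]
  [NormedAddCommGroup H] [NormedSpace ℝ H]

/-- The map `(z, A, Y) ↦ A^* (Y ⌟ Ψ_z)`. -/
def contractPullback (Ψ : H → H [⋀^Fin 4]→L[ℝ] ℝ) (q : H × (E →L[ℝ] H) × H) :
    E [⋀^Fin 3]→L[ℝ] ℝ :=
  ((Ψ q.1).curryLeft q.2.2).compContinuousLinearMap q.2.1

lemma contractPullback_apply (Ψ : H → H [⋀^Fin 4]→L[ℝ] ℝ) (z : H) (A : E →L[ℝ] H) (Y : H)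
    (v : Fin 3 → E) :
    contractPullback Ψ (z, A, Y) v = Ψ z ![Y, A (v 0), A (v 1), A (v 2)] := by
  change Ψ z (Matrix.vecCons Y fun i => A (v i)) = _
  congr 1
  ext i
  fin_cases i <;> rfl

lemma contDiffAt_contractPullback {Ψ : H → H [⋀^Fin 4]→L[ℝ] ℝ}
    {q : H × (E →L[ℝ] H) × H} (hΨ : ContDiffAt ℝ ∞ Ψ q.1) :
    ContDiffAt ℝ ∞ (contractPullback Ψ) q := by
  have h1 : ContDiffAt ℝ ∞ (fun q : H × (E →L[ℝ] H) × H => (Ψ q.1).curryLeft q.2.2) q := by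
    have hc : ContDiff ℝ ∞ (fun f : H [⋀^Fin 4]→L[ℝ] ℝ => f.curryLeft) :=
      IsBoundedLinearMap.contDiff
        (IsLinearMap.with_bound ⟨fun _ _ => rfl, fun _ _ => rfl⟩ 1 (fun f => by simp))
    have := hc.contDiffAt.comp q (hΨ.comp q contDiffAt_fst)
    exact this.clm_apply (contDiffAt_snd.snd)
  exact contDiff_compContinuousLinearMap.contDiffAt.comp q (h1.prodMk contDiffAt_snd.fst)

/-- The linearization, in the direction of the field `X` along `F`, of `Y ↦ F^* (Y ⌟ Ψ)`. -/
def linearize (Ψ : H → H [⋀^Fin 4]→L[ℝ] ℝ) (F X : E → H) (y : E) (Y : H) :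
    E [⋀^Fin 3]→L[ℝ] ℝ :=
  fderiv ℝ (contractPullback Ψ) (F y, fderiv ℝ F y, Y) (X y, fderiv ℝ X y, 0)

lemma contDiffAt_linearize {Ψ : H → H [⋀^Fin 4]→L[ℝ] ℝ} {F X Y : E → H}
    {y : E} (hΨ : ContDiffAt ℝ ∞ Ψ (F y)) (hF : ContDiffAt ℝ ∞ F y) (hX : ContDiffAt ℝ ∞ X y)
    (hY : ContDiffAt ℝ ∞ Y y) :
    ContDiffAt ℝ ∞ (fun y => linearize Ψ F X y (Y y)) y := by
  have h1 : ContDiffAt ℝ ∞ (fderiv ℝ (contractPullback Ψ)) (F y, fderiv ℝ F y, Y y) :=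
    (contDiffAt_contractPullback (q := (F y, fderiv ℝ F y, Y y)) hΨ).fderiv_right
      (m := ∞) (by simp)
  exact (h1.comp y (hF.prodMk ((hF.fderiv_right (m := ∞) (by simp)).prodMk hY))).clm_apply
    (hX.prodMk ((hX.fderiv_right (m := ∞) (by simp)).prodMk contDiffAt_const))

/-- Leibniz rule: one term for the base point and one for each of the four slots. The term in T
isolates the dependence on the variation of Y; the terms in B are those that survive in the
principal symbol. -/
lemma fderiv_contractPullback_apply {Ψ : H → H [⋀^Fin 4]→L[ℝ] ℝ} {z : H}
    {A : E →L[ℝ] H} (hΨ : ContDiffAt ℝ ∞ Ψ z) (x : H) (B : E →L[ℝ] H) (Y T : H) (v : Fin 3 → E) :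
    fderiv ℝ (contractPullback Ψ) (z, A, Y) (x, B, T) v =
      fderiv ℝ Ψ z x ![Y, A (v 0), A (v 1), A (v 2)]
        + (Ψ z ![T, A (v 0), A (v 1), A (v 2)] + Ψ z ![Y, B (v 0), A (v 1), A (v 2)]
          + Ψ z ![Y, A (v 0), B (v 1), A (v 2)] + Ψ z ![Y, A (v 0), A (v 1), B (v 2)]) := by
  have h1 := ((contDiffAt_contractPullback (q := (z, A, Y)) hΨ).differentiableAt
    (by simp)).hasFDerivAt
  have h2 : HasFDerivAt (fun q : H × (E →L[ℝ] H) × H => contractPullback Ψ q v)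
      ((ContinuousAlternatingMap.apply ℝ E ℝ v).comp (fderiv ℝ (contractPullback Ψ) (z, A, Y)))
      (z, A, Y) :=
    (ContinuousAlternatingMap.apply ℝ E ℝ v).hasFDerivAt.comp (z, A, Y) h1
  let g : Fin 4 → H × (E →L[ℝ] H) × H → H :=
    ![fun q => q.2.2, fun q => q.2.1 (v 0), fun q => q.2.1 (v 1), fun q => q.2.1 (v 2)]
  let e : ∀ i : Fin 3, H × (E →L[ℝ] H) × H →L[ℝ] H := fun i =>
    (ContinuousLinearMap.apply ℝ H (v i)).comp ((ContinuousLinearMap.fst ℝ (E →L[ℝ] H) H).comp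
      (ContinuousLinearMap.snd ℝ H ((E →L[ℝ] H) × H)))
  let e' : H × (E →L[ℝ] H) × H →L[ℝ] H := (ContinuousLinearMap.snd ℝ (E →L[ℝ] H) H).comp
      (ContinuousLinearMap.snd ℝ H ((E →L[ℝ] H) × H))
  let g' : Fin 4 → H × (E →L[ℝ] H) × H →L[ℝ] H := ![e', e 0, e 1, e 2]
  have hg : ∀ i, HasFDerivAt (g i) (g' i) (z, A, Y) := by
    intro i
    fin_cases i
    · exact e'.hasFDerivAt
    · exact (e 0).hasFDerivAt
    · exact (e 1).hasFDerivAt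
    · exact (e 2).hasFDerivAt
  have hf : HasFDerivAt (fun q : H × (E →L[ℝ] H) × H => Ψ q.1)
      ((fderiv ℝ Ψ z).comp (ContinuousLinearMap.fst ℝ H _)) (z, A, Y) :=
    (hΨ.differentiableAt (by simp)).hasFDerivAt.comp (z, A, Y) hasFDerivAt_fst
  have h3 := hf.continuousAlternatingMap_apply hg
  have hgv : ∀ q : H × (E →L[ℝ] H) × H,
      (g · q) = ![q.2.2, q.2.1 (v 0), q.2.1 (v 1), q.2.1 (v 2)] := by
    intro q
    ext i
    fin_cases i <;> rfl
  simp only [hgv] at h3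
  have h4 := h2.unique (h3.congr_of_eventuallyEq (Filter.Eventually.of_forall fun q =>
    contractPullback_apply Ψ q.1 q.2.1 q.2.2 v))
  have h5 := congrArg (fun L => L (x, B, T)) h4
  simp only [Fin.sum_univ_four] at h5
  have e0 : Function.update ![Y, A (v 0), A (v 1), A (v 2)] 0 T =
    ![T, A (v 0), A (v 1), A (v 2)] := by ext i; fin_cases i <;> rfl
  have e1 : Function.update ![Y, A (v 0), A (v 1), A (v 2)] 1 (B (v 0)) =
    ![Y, B (v 0), A (v 1), A (v 2)] := by ext i; fin_cases i <;> rfl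
  have e2 : Function.update ![Y, A (v 0), A (v 1), A (v 2)] 2 (B (v 1)) =
    ![Y, A (v 0), B (v 1), A (v 2)] := by ext i; fin_cases i <;> rfl
  have e3 : Function.update ![Y, A (v 0), A (v 1), A (v 2)] 3 (B (v 2)) =
    ![Y, A (v 0), A (v 1), B (v 2)] := by ext i; fin_cases i <;> rfl
  rw [← e0, ← e1, ← e2, ← e3]
  refine Eq.trans ?_ (h5.trans ?_)
  · rfl
  · simp [g', e, e']

/-- Symmetry of the second derivative of G interchanges ∂_s and ∂_y, so the differentials of a
family of maps vary by the differential of its velocity field. -/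
lemma hasDerivAt_fderiv_curve {G : ℝ × E → H} {y : E} (hG : ContDiffAt ℝ ∞ G (0, y))
    {X : E → H} (hX : ∀ᶠ y' in 𝓝 y, X y' = deriv (fun s => G (s, y')) 0) :
    HasDerivAt (fun s => fderiv ℝ (fun y' => G (s, y')) y) (fderiv ℝ X y) 0 := by
  have hev : ∀ᶠ q in 𝓝 ((0 : ℝ), y), DifferentiableAt ℝ G q :=
    ((hG.of_le (m := 1) (by exact_mod_cast le_top)).eventually (by simp)).mono
      fun q hq => hq.differentiableAt (by simp)
  have hD : DifferentiableAt ℝ (fderiv ℝ G) (0, y) :=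
    (hG.fderiv_right (m := ∞) (by simp)).differentiableAt (by simp)
  have hs : ∀ᶠ s in 𝓝 (0 : ℝ), fderiv ℝ (fun y' => G (s, y')) y =
      (fderiv ℝ G (s, y)).comp (ContinuousLinearMap.inr ℝ ℝ E) := by
    have hc : ContinuousAt (fun s : ℝ => (s, y)) 0 := by fun_prop
    filter_upwards [hc.eventually hev] with s hs
    exact (hs.hasFDerivAt.comp y (hasFDerivAt_prodMk_right s y)).fderiv
  have hx : X =ᶠ[𝓝 y] fun y' => fderiv ℝ G (0, y') (1, 0) := by
    have hc : ContinuousAt (fun y' : E => ((0 : ℝ), y')) y := by fun_prop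
    filter_upwards [hc.eventually hev, hX] with y' hy' hx
    rw [hx]
    exact (hy'.hasFDerivAt.comp_hasDerivAt (0 : ℝ)
      ((hasDerivAt_id (0 : ℝ)).prodMk (hasDerivAt_const _ y'))).deriv
  have hL : HasDerivAt (fun s => (fderiv ℝ G (s, y)).comp (ContinuousLinearMap.inr ℝ ℝ E))
      ((fderiv ℝ (fderiv ℝ G) (0, y) (1, 0)).comp (ContinuousLinearMap.inr ℝ ℝ E)) 0 := by
    have h1 : HasDerivAt (fun s => fderiv ℝ G (s, y)) (fderiv ℝ (fderiv ℝ G) (0, y) (1, 0)) 0 :=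
      hD.hasFDerivAt.comp_hasDerivAt (0 : ℝ)
        ((hasDerivAt_id (0 : ℝ)).prodMk (hasDerivAt_const _ y))
    exact ((ContinuousLinearMap.compL ℝ E (ℝ × E) H).flip
      (ContinuousLinearMap.inr ℝ ℝ E)).hasFDerivAt.comp_hasDerivAt (0 : ℝ) h1
  have hR : fderiv ℝ X y =
      (fderiv ℝ (fderiv ℝ G) (0, y) (1, 0)).comp (ContinuousLinearMap.inr ℝ ℝ E) := by
    rw [hx.fderiv_eq]
    have h1 : HasFDerivAt (fun y' => fderiv ℝ G (0, y') (1, 0))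
        ((ContinuousLinearMap.apply ℝ H ((1 : ℝ), (0 : E))).comp
          ((fderiv ℝ (fderiv ℝ G) (0, y)).comp (ContinuousLinearMap.inr ℝ ℝ E))) y :=
      (ContinuousLinearMap.apply ℝ H ((1 : ℝ), (0 : E))).hasFDerivAt.comp y
        (hD.hasFDerivAt.comp y (hasFDerivAt_prodMk_right (0 : ℝ) y))
    rw [h1.fderiv]
    ext e
    have hsymm : IsSymmSndFDerivAt ℝ G (0, y) := hG.isSymmSndFDerivAt
      (by simpa using! WithTop.coe_le_coe.2 (le_top : (2 : ℕ∞) ≤ ⊤))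
    exact hsymm _ _
  rw [hR]
  exact hL.congr_of_eventuallyEq hs

/-- The derivative of `F_s^* (Y_s ⌟ Ψ)` along a curve through a solution. -/
lemma hasDerivAt_contractPullback {Ψ : H → H [⋀^Fin 4]→L[ℝ] ℝ}
    {G : ℝ × E → H} {y : E} (hG : ContDiffAt ℝ ∞ G (0, y)) {F X : E → H}
    (hF : ∀ᶠ y' in 𝓝 y, F y' = G (0, y'))
    (hX : ∀ᶠ y' in 𝓝 y, X y' = deriv (fun s => G (s, y')) 0)
    (hΨ : ContDiffAt ℝ ∞ Ψ (F y)) (hsol : ∀ Y, contractPullback Ψ (F y, fderiv ℝ F y, Y) = 0)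
    {Y : ℝ → H} (hY : DifferentiableAt ℝ Y 0) :
    HasDerivAt (fun s => contractPullback Ψ (G (s, y), fderiv ℝ (fun y' => G (s, y')) y, Y s))
      (linearize Ψ F X y (Y 0)) 0 := by
  have hFy : F y = G (0, y) := hF.self_of_nhds
  have hF' : fderiv ℝ F y = fderiv ℝ (fun y' => G (0, y')) y := Filter.EventuallyEq.fderiv_eq hF
  have h1 : HasDerivAt (fun s => G (s, y)) (X y) 0 := by
    rw [hX.self_of_nhds]
    have : DifferentiableAt ℝ (fun s => G (s, y)) 0 :=
      (hG.differentiableAt (by simp)).comp (0 : ℝ) (by fun_prop)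
    exact this.hasDerivAt
  have h2 := h1.prodMk ((hasDerivAt_fderiv_curve hG hX).prodMk hY.hasDerivAt)
  have h3 : HasFDerivAt (contractPullback Ψ)
      (fderiv ℝ (contractPullback Ψ) (F y, fderiv ℝ F y, Y 0))
      (G (0, y), fderiv ℝ (fun y' => G (0, y')) y, Y 0) := by
    rw [← hF', ← hFy]
    exact ((contDiffAt_contractPullback (q := (F y, fderiv ℝ F y, Y 0)) hΨ).differentiableAt
      (by simp)).hasFDerivAt
  have h4 := h3.comp_hasDerivAt (0 : ℝ) h2
  refine h4.congr_deriv ?_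
  ext v
  -- The contribution of the derivative of Y is F^*(Y' ⌟ Ψ), which is zero because F is a solution.
  -- Only the value of Y at 0 remains.
  have h5 := congrArg (fun α => α v) (hsol (deriv Y 0))
  simp only [contractPullback_apply] at h5
  rw [linearize, fderiv_contractPullback_apply hΨ, fderiv_contractPullback_apply hΨ, h5,
    (Ψ (F y)).map_coord_zero (m := ![0, _, _, _]) 0 rfl]
  simp

end Linearize

/-! ### Symmetry of the linearization up to an exact form -/

section Exact

variable {E H : Type*} [NormedAddCommGroup E] [NormedSpace ℝ E]
  [NormedAddCommGroup H] [NormedSpace ℝ H]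

/-- The `2`-form `F^* (Y ⌟ X ⌟ Ψ)`. -/
def contractPullback₂ (Ψ : H → H [⋀^Fin 4]→L[ℝ] ℝ) (F X Y : E → H) (y : E) :
    E [⋀^Fin 2]→L[ℝ] ℝ :=
  (((Ψ (F y)).curryLeft (X y)).curryLeft (Y y)).compContinuousLinearMap (fderiv ℝ F y)

lemma contractPullback₂_apply (Ψ : H → H [⋀^Fin 4]→L[ℝ] ℝ) (F X Y : E → H) (y : E)
    (v : Fin 2 → E) :
    contractPullback₂ Ψ F X Y y v =
      Ψ (F y) ![X y, Y y, fderiv ℝ F y (v 0), fderiv ℝ F y (v 1)] := by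
  change Ψ (F y) (Matrix.vecCons (X y) (Matrix.vecCons (Y y) fun i => fderiv ℝ F y (v i))) = _
  congr 1
  ext i
  fin_cases i <;> rfl

lemma contDiffAt_contractPullback₂ {Ψ : H → H [⋀^Fin 4]→L[ℝ] ℝ} {F X Y : E → H} {y : E}
    (hΨ : ContDiffAt ℝ ∞ Ψ (F y)) (hF : ContDiffAt ℝ ∞ F y) (hX : ContDiffAt ℝ ∞ X y)
    (hY : ContDiffAt ℝ ∞ Y y) : ContDiffAt ℝ ∞ (contractPullback₂ Ψ F X Y) y := by
  have hc : ∀ n, ContDiff ℝ ∞ (fun f : H [⋀^Fin (n + 1)]→L[ℝ] ℝ => f.curryLeft) := fun n =>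
    IsBoundedLinearMap.contDiff
      (IsLinearMap.with_bound ⟨fun _ _ => rfl, fun _ _ => rfl⟩ 1 (fun f => by simp))
  have h1 : ContDiffAt ℝ ∞ (fun y => (Ψ (F y)).curryLeft (X y)) y :=
    ((hc 3).contDiffAt.comp y (hΨ.comp y hF)).clm_apply hX
  have h2 : ContDiffAt ℝ ∞ (fun y => ((Ψ (F y)).curryLeft (X y)).curryLeft (Y y)) y :=
    ((hc 2).contDiffAt.comp y h1).clm_apply hY
  exact contDiff_compContinuousLinearMap.contDiffAt.comp y
    (h2.prodMk (hF.fderiv_right (m := ∞) (by simp)))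

/-- Leibniz rule again. Here F itself is differentiated, so the last two slots produce second
derivatives of F, which drop out after antisymmetrization. -/
lemma fderiv_contractPullback₂ {Ψ : H → H [⋀^Fin 4]→L[ℝ] ℝ} {F X Y : E → H} {y : E}
    (hΨ : ContDiffAt ℝ ∞ Ψ (F y)) (hF : ContDiffAt ℝ ∞ F y) (hX : ContDiffAt ℝ ∞ X y)
    (hY : ContDiffAt ℝ ∞ Y y) (v : Fin 2 → E) (e : E) :
    fderiv ℝ (fun y => contractPullback₂ Ψ F X Y y v) y e =
      fderiv ℝ Ψ (F y) (fderiv ℝ F y e) ![X y, Y y, fderiv ℝ F y (v 0), fderiv ℝ F y (v 1)]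
      + (Ψ (F y) ![fderiv ℝ X y e, Y y, fderiv ℝ F y (v 0), fderiv ℝ F y (v 1)]
        + Ψ (F y) ![X y, fderiv ℝ Y y e, fderiv ℝ F y (v 0), fderiv ℝ F y (v 1)]
        + Ψ (F y) ![X y, Y y, fderiv ℝ (fderiv ℝ F) y e (v 0), fderiv ℝ F y (v 1)]
        + Ψ (F y) ![X y, Y y, fderiv ℝ F y (v 0), fderiv ℝ (fderiv ℝ F) y e (v 1)]) := by
  have hD : HasFDerivAt (fderiv ℝ F) (fderiv ℝ (fderiv ℝ F) y) y :=
    ((hF.fderiv_right (m := ∞) (by simp)).differentiableAt (by simp)).hasFDerivAt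
  let g : Fin 4 → E → H :=
    ![X, Y, fun y => fderiv ℝ F y (v 0), fun y => fderiv ℝ F y (v 1)]
  let e' : Fin 2 → E →L[ℝ] H := fun i =>
    (ContinuousLinearMap.apply ℝ H (v i)).comp (fderiv ℝ (fderiv ℝ F) y)
  let g' : Fin 4 → E →L[ℝ] H := ![fderiv ℝ X y, fderiv ℝ Y y, e' 0, e' 1]
  have hg : ∀ i, HasFDerivAt (g i) (g' i) y := by
    intro i
    fin_cases i
    · exact (hX.differentiableAt (by simp)).hasFDerivAt
    · exact (hY.differentiableAt (by simp)).hasFDerivAt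
    · exact (ContinuousLinearMap.apply ℝ H (v 0)).hasFDerivAt.comp y hD
    · exact (ContinuousLinearMap.apply ℝ H (v 1)).hasFDerivAt.comp y hD
  have hf : HasFDerivAt (fun y => Ψ (F y)) ((fderiv ℝ Ψ (F y)).comp (fderiv ℝ F y)) y :=
    (hΨ.differentiableAt (by simp)).hasFDerivAt.comp y
      (hF.differentiableAt (by simp)).hasFDerivAt
  have h3 := hf.continuousAlternatingMap_apply hg
  have hgv : ∀ y, (g · y) = ![X y, Y y, fderiv ℝ F y (v 0), fderiv ℝ F y (v 1)] := by
    intro q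
    ext i
    fin_cases i <;> rfl
  simp only [hgv] at h3
  have h4 := (h3.congr_of_eventuallyEq (Filter.Eventually.of_forall fun q =>
    contractPullback₂_apply Ψ F X Y q v)).fderiv
  rw [h4]
  have e0 : ∀ T, Function.update ![X y, Y y, fderiv ℝ F y (v 0), fderiv ℝ F y (v 1)] 0 T =
    ![T, Y y, fderiv ℝ F y (v 0), fderiv ℝ F y (v 1)] := fun T => by
      ext i; fin_cases i <;> rfl
  have e1 : ∀ T, Function.update ![X y, Y y, fderiv ℝ F y (v 0), fderiv ℝ F y (v 1)] 1 T =
    ![X y, T, fderiv ℝ F y (v 0), fderiv ℝ F y (v 1)] := fun T => by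
      ext i; fin_cases i <;> rfl
  have e2 : ∀ T, Function.update ![X y, Y y, fderiv ℝ F y (v 0), fderiv ℝ F y (v 1)] 2 T =
    ![X y, Y y, T, fderiv ℝ F y (v 1)] := fun T => by
      ext i; fin_cases i <;> rfl
  have e3 : ∀ T, Function.update ![X y, Y y, fderiv ℝ F y (v 0), fderiv ℝ F y (v 1)] 3 T =
    ![X y, Y y, fderiv ℝ F y (v 0), T] := fun T => by
      ext i; fin_cases i <;> rfl
  rw [← e0 (fderiv ℝ X y e), ← e1 (fderiv ℝ Y y e), ← e2 (fderiv ℝ (fderiv ℝ F) y e (v 0)),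
    ← e3 (fderiv ℝ (fderiv ℝ F) y e (v 1))]
  simp [Fin.sum_univ_four, g', e']

lemma map_swap01 (α : H [⋀^Fin 4]→L[ℝ] ℝ) (a b c d : H) : α ![b, a, c, d] = -α ![a, b, c, d] := by
  have h := α.toAlternatingMap.map_swap ![a, b, c, d] (i := 0) (j := 1) (by decide)
  have e : ![a, b, c, d] ∘ Equiv.swap (0 : Fin 4) 1 = ![b, a, c, d] := by
    ext i; fin_cases i <;> rfl
  rwa [e] at h

lemma map_swap12 (α : H [⋀^Fin 4]→L[ℝ] ℝ) (a b c d : H) : α ![a, c, b, d] = -α ![a, b, c, d] := by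
  have h := α.toAlternatingMap.map_swap ![a, b, c, d] (i := 1) (j := 2) (by decide)
  have e : ![a, b, c, d] ∘ Equiv.swap (1 : Fin 4) 2 = ![a, c, b, d] := by
    ext i; fin_cases i <;> rfl
  rwa [e] at h

lemma map_swap23 (α : H [⋀^Fin 4]→L[ℝ] ℝ) (a b c d : H) : α ![a, b, d, c] = -α ![a, b, c, d] := by
  have h := α.toAlternatingMap.map_swap ![a, b, c, d] (i := 2) (j := 3) (by decide)
  have e : ![a, b, c, d] ∘ Equiv.swap (2 : Fin 4) 3 = ![a, b, d, c] := by
    ext i; fin_cases i <;> rfl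
  rwa [e] at h

/-- The second variation is symmetric up to an exact form. -/
lemma extDeriv_contractPullback₂ {Ψ : H → H [⋀^Fin 4]→L[ℝ] ℝ} {F X Y : E → H} {y : E}
    (hΨ : ContDiffAt ℝ ∞ Ψ (F y)) (hcl : extDeriv Ψ (F y) = 0) (hF : ContDiffAt ℝ ∞ F y)
    (hX : ContDiffAt ℝ ∞ X y) (hY : ContDiffAt ℝ ∞ Y y) :
    extDeriv (contractPullback₂ Ψ F X Y) y =
      linearize Ψ F Y y (X y) - linearize Ψ F X y (Y y) := by
  ext (v : Fin 3 → E)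
  refine (extDeriv_apply ((contDiffAt_contractPullback₂ hΨ hF hX hY).differentiableAt
    (by simp)) v).trans ((Fin.sum_univ_three _).trans ?_)
  -- Closedness on the five vectors X, Y, F_*v₀, F_*v₁, F_*v₂ trades the derivatives of Ψ along the
  -- F_*v_i, which occur in the exterior derivative, for those along X and Y, which occur in the two
  -- linearizations.
  have hc : extDeriv Ψ (F y) ![X y, Y y, fderiv ℝ F y (v 0), fderiv ℝ F y (v 1),
    fderiv ℝ F y (v 2)] = 0 := by rw [hcl]; rfl
  rw [extDeriv, ContinuousAlternatingMap.alternatizeUncurryFin_apply, Fin.sum_univ_five] at hc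
  have r0 : ∀ a b c d e : H, (0 : Fin 5).removeNth ![a, b, c, d, e] = ![b, c, d, e] := by
    intros; ext i; fin_cases i <;> rfl
  have r1 : ∀ a b c d e : H, (1 : Fin 5).removeNth ![a, b, c, d, e] = ![a, c, d, e] := by
    intros; ext i; fin_cases i <;> rfl
  have r2 : ∀ a b c d e : H, (2 : Fin 5).removeNth ![a, b, c, d, e] = ![a, b, d, e] := by
    intros; ext i; fin_cases i <;> rfl
  have r3 : ∀ a b c d e : H, (3 : Fin 5).removeNth ![a, b, c, d, e] = ![a, b, c, e] := by
    intros; ext i; fin_cases i <;> rfl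
  have r4 : ∀ a b c d e : H, (4 : Fin 5).removeNth ![a, b, c, d, e] = ![a, b, c, d] := by
    intros; ext i; fin_cases i <;> rfl
  rw [r0, r1, r2, r3, r4] at hc
  -- Symmetry of the second derivative of F, by which the terms containing it cancel in pairs.
  have s : ∀ a b, fderiv ℝ (fderiv ℝ F) y a b = fderiv ℝ (fderiv ℝ F) y b a := fun a b =>
    hF.isSymmSndFDerivAt (by simpa using! WithTop.coe_le_coe.2 (le_top : (2 : ℕ∞) ≤ ⊤)) a b
  have t00 : (0 : Fin 3).removeNth v 0 = v 1 := rfl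
  have t01 : (0 : Fin 3).removeNth v 1 = v 2 := rfl
  have t10 : (1 : Fin 3).removeNth v 0 = v 0 := rfl
  have t11 : (1 : Fin 3).removeNth v 1 = v 2 := rfl
  have t20 : (2 : Fin 3).removeNth v 0 = v 0 := rfl
  have t21 : (2 : Fin 3).removeNth v 1 = v 1 := rfl
  simp only [fderiv_contractPullback₂ hΨ hF hX hY, t00, t01, t10, t11, t20,
    t21, linearize, ContinuousAlternatingMap.sub_apply, fderiv_contractPullback_apply hΨ]
  rw [s (v 1) (v 0), s (v 2) (v 0), s (v 2) (v 1)]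
  have z : ∀ a b c, Ψ (F y) ![0, a, b, c] = 0 := fun a b c =>
    (Ψ (F y)).map_coord_zero (m := ![0, a, b, c]) 0 rfl
  simp only [z]
  simp only [Fin.val_zero, Fin.val_one, Fin.val_two, pow_zero, pow_one, one_smul, neg_smul,
    even_two, Even.neg_pow, one_pow, show ((3 : Fin 5) : ℕ) = 3 from rfl,
    show ((4 : Fin 5) : ℕ) = 4 from rfl, show (-1 : ℤ) ^ 3 = -1 by norm_num,
    show (-1 : ℤ) ^ 4 = 1 by norm_num,
    Matrix.cons_val_zero, Matrix.cons_val_one, Matrix.cons_val] at hc ⊢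
  -- The remaining terms agree up to reordering of slots: the m's move the derivatives of X and Y
  -- into place, the q's bring the second derivatives of F into a common form. What is left is
  -- linear arithmetic.
  have m1 := map_swap01 (Ψ (F y)) (fderiv ℝ X y (v 0)) (Y y) (fderiv ℝ F y (v 1))
    (fderiv ℝ F y (v 2))
  have m2 := map_swap01 (Ψ (F y)) (fderiv ℝ X y (v 1)) (Y y) (fderiv ℝ F y (v 0))
    (fderiv ℝ F y (v 2))
  have m3 := map_swap01 (Ψ (F y)) (fderiv ℝ X y (v 2)) (Y y) (fderiv ℝ F y (v 0))
    (fderiv ℝ F y (v 1))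
  have m4 := map_swap12 (Ψ (F y)) (Y y) (fderiv ℝ X y (v 1)) (fderiv ℝ F y (v 0))
    (fderiv ℝ F y (v 2))
  have m5 := map_swap12 (Ψ (F y)) (Y y) (fderiv ℝ X y (v 2)) (fderiv ℝ F y (v 0))
    (fderiv ℝ F y (v 1))
  have m6 := map_swap23 (Ψ (F y)) (Y y) (fderiv ℝ F y (v 0)) (fderiv ℝ X y (v 2))
    (fderiv ℝ F y (v 1))
  have m7 := map_swap12 (Ψ (F y)) (X y) (fderiv ℝ Y y (v 1)) (fderiv ℝ F y (v 0))
    (fderiv ℝ F y (v 2))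
  have m8 := map_swap12 (Ψ (F y)) (X y) (fderiv ℝ Y y (v 2)) (fderiv ℝ F y (v 0))
    (fderiv ℝ F y (v 1))
  have m9 := map_swap23 (Ψ (F y)) (X y) (fderiv ℝ F y (v 0)) (fderiv ℝ Y y (v 2))
    (fderiv ℝ F y (v 1))
  have q1 := map_swap23 (Ψ (F y)) (X y) (Y y) (fderiv ℝ (fderiv ℝ F) y (v 0) (v 1))
    (fderiv ℝ F y (v 2))
  have q2 := map_swap23 (Ψ (F y)) (X y) (Y y) (fderiv ℝ (fderiv ℝ F) y (v 0) (v 2))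
    (fderiv ℝ F y (v 1))
  have q3 := map_swap23 (Ψ (F y)) (X y) (Y y) (fderiv ℝ (fderiv ℝ F) y (v 1) (v 2))
    (fderiv ℝ F y (v 0))
  linarith

end Exact

/-! ### The `4`-form `τ + dt ∧ ρ` on a cylinder -/

section Cylinder

variable {V : Type*} [NormedAddCommGroup V] [NormedSpace ℝ V]

/-- The form `dt ∧ r` on `ℝ × V`. -/
def wedgeDt (r : V → V [⋀^Fin 3]→L[ℝ] ℝ) (z : ℝ × V) : (ℝ × V) [⋀^Fin 4]→L[ℝ] ℝ :=
  ContinuousAlternatingMap.alternatizeUncurryFin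
    ((ContinuousLinearMap.fst ℝ ℝ V).smulRight
      ((r z.2).compContinuousLinearMap (ContinuousLinearMap.snd ℝ ℝ V)))

/-- The form `t + dt ∧ r` on `ℝ × V`. -/
def cylinderForm (r : V → V [⋀^Fin 3]→L[ℝ] ℝ) (t : V → V [⋀^Fin 4]→L[ℝ] ℝ) (z : ℝ × V) :
    (ℝ × V) [⋀^Fin 4]→L[ℝ] ℝ :=
  (t z.2).compContinuousLinearMap (ContinuousLinearMap.snd ℝ ℝ V) + wedgeDt r z

lemma cylinderForm_apply (r : V → V [⋀^Fin 3]→L[ℝ] ℝ) (t : V → V [⋀^Fin 4]→L[ℝ] ℝ) (z : ℝ × V)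
    (w : Fin 4 → ℝ × V) :
    cylinderForm r t z w = t z.2 (fun i => (w i).2) +
      ∑ i : Fin 4, (-1 : ℝ) ^ (i : ℕ) * ((w i).1 * r z.2 (fun j => (i.removeNth w j).2)) := by
  simp only [cylinderForm, wedgeDt, ContinuousAlternatingMap.add_apply,
    ContinuousAlternatingMap.compContinuousLinearMap_apply,
    ContinuousAlternatingMap.alternatizeUncurryFin_apply]
  congr 1
  refine Finset.sum_congr rfl fun i _ => ?_
  simp [zsmul_eq_mul]
  exact Or.inl rfl

lemma contDiffAt_pullback_snd {n : ℕ} {r : V → V [⋀^Fin n]→L[ℝ] ℝ} {z : ℝ × V}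
    (hr : ContDiffAt ℝ ∞ r z.2) :
    ContDiffAt ℝ ∞ (fun z : ℝ × V =>
      (r z.2).compContinuousLinearMap (ContinuousLinearMap.snd ℝ ℝ V)) z :=
  contDiff_compContinuousLinearMap.contDiffAt.comp z
    ((hr.comp z contDiffAt_snd).prodMk contDiffAt_const)

lemma extDeriv_pullback_snd {n : ℕ} {r : V → V [⋀^Fin n]→L[ℝ] ℝ} {z : ℝ × V}
    (hr : ContDiffAt ℝ ∞ r z.2) (hcl : extDeriv r z.2 = 0) :
    extDeriv (fun z : ℝ × V =>
      (r z.2).compContinuousLinearMap (ContinuousLinearMap.snd ℝ ℝ V)) z = 0 := by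
  have h := extDeriv_pullback (x := z) (f := (Prod.snd : ℝ × V → V)) (r := ∞)
    (hr.differentiableAt (by simp)) contDiffAt_snd
    (by simpa using! WithTop.coe_le_coe.2 (le_top : (2 : ℕ∞) ≤ ⊤))
  simp only [fderiv_snd] at h
  rw [h, hcl]
  rfl

/-- Since dr = 0, the product rule gives d(t r) = dt ∧ r. Having a primitive makes both smoothness
and closedness of dt ∧ r consequences of general facts about the exterior derivative. Closedness of
r is needed on a neighbourhood, as the identity is differentiated later. -/
lemma wedgeDt_eventuallyEq {r : V → V [⋀^Fin 3]→L[ℝ] ℝ} {z : ℝ × V}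
    (hr : ∀ᶠ x in 𝓝 z.2, ContDiffAt ℝ ∞ r x) (hcl : ∀ᶠ x in 𝓝 z.2, extDeriv r x = 0) :
    wedgeDt r =ᶠ[𝓝 z] extDeriv (fun z : ℝ × V =>
      z.1 • (r z.2).compContinuousLinearMap (ContinuousLinearMap.snd ℝ ℝ V)) := by
  have hc : ContinuousAt (Prod.snd : ℝ × V → V) z := continuousAt_snd
  filter_upwards [hc.eventually hr, hc.eventually hcl] with q hq hq'
  have h1 := extDeriv_pullback_snd hq hq'
  have h2 := ((contDiffAt_pullback_snd hq).differentiableAt (by simp)).hasFDerivAt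
  have h3 : HasFDerivAt (fun z : ℝ × V => z.1) (ContinuousLinearMap.fst ℝ ℝ V) q := hasFDerivAt_fst
  rw [extDeriv, (h3.fun_smul h2).fderiv, ContinuousAlternatingMap.alternatizeUncurryFin_add,
    ContinuousAlternatingMap.alternatizeUncurryFin_smul, ← extDeriv, h1, smul_zero, zero_add]
  rfl

lemma contDiffAt_extDeriv {n : ℕ} {r : V → V [⋀^Fin n]→L[ℝ] ℝ} {z : V}
    (hr : ContDiffAt ℝ ∞ r z) : ContDiffAt ℝ ∞ (extDeriv r) z :=
  have h : ContDiff ℝ ∞ fun f : V →L[ℝ] V [⋀^Fin n]→L[ℝ] ℝ =>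
      ContinuousAlternatingMap.alternatizeUncurryFin f :=
    IsBoundedLinearMap.contDiff (IsLinearMap.with_bound
      ⟨ContinuousAlternatingMap.alternatizeUncurryFin_add, fun c f =>
        ContinuousAlternatingMap.alternatizeUncurryFin_smul c f⟩ (n + 1)
      ContinuousAlternatingMap.norm_alternatizeUncurryFin_le)
  h.contDiffAt.comp z (hr.fderiv_right (m := ∞) (by simp))

lemma contDiffAt_cylinderForm {r : V → V [⋀^Fin 3]→L[ℝ] ℝ} {t : V → V [⋀^Fin 4]→L[ℝ] ℝ}
    {z : ℝ × V} (hr : ∀ᶠ x in 𝓝 z.2, ContDiffAt ℝ ∞ r x) (hcl : ∀ᶠ x in 𝓝 z.2, extDeriv r x = 0)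
    (ht : ContDiffAt ℝ ∞ t z.2) : ContDiffAt ℝ ∞ (cylinderForm r t) z := by
  refine (contDiffAt_pullback_snd ht).add ?_
  refine (ContDiffAt.congr_of_eventuallyEq ?_ (wedgeDt_eventuallyEq hr hcl))
  exact contDiffAt_extDeriv (contDiffAt_fst.smul (contDiffAt_pullback_snd hr.self_of_nhds))

/-- The first summand is the pullback of a closed form under the projection, and the second is
locally d(t r), so d² = 0 applies. -/
lemma extDeriv_cylinderForm {r : V → V [⋀^Fin 3]→L[ℝ] ℝ} {t : V → V [⋀^Fin 4]→L[ℝ] ℝ}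
    {z : ℝ × V} (hr : ∀ᶠ x in 𝓝 z.2, ContDiffAt ℝ ∞ r x) (hcl : ∀ᶠ x in 𝓝 z.2, extDeriv r x = 0)
    (ht : ContDiffAt ℝ ∞ t z.2) (htcl : extDeriv t z.2 = 0) :
    extDeriv (cylinderForm r t) z = 0 := by
  have hw := wedgeDt_eventuallyEq hr hcl
  have h1 : ContDiffAt ℝ ∞ (fun z : ℝ × V =>
      z.1 • (r z.2).compContinuousLinearMap (ContinuousLinearMap.snd ℝ ℝ V)) z :=
    contDiffAt_fst.smul (contDiffAt_pullback_snd hr.self_of_nhds)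
  have h2 : ContDiffAt ℝ ∞ (wedgeDt r) z := (contDiffAt_extDeriv h1).congr_of_eventuallyEq hw
  have h3 : extDeriv (wedgeDt r) z = 0 := by
    rw [hw.extDeriv_eq]
    exact extDeriv_extDeriv_apply h1
      (by simpa using! WithTop.coe_le_coe.2 (le_top : (2 : ℕ∞) ≤ ⊤))
  have h4 := extDeriv_fun_add ((contDiffAt_pullback_snd ht).differentiableAt (by simp))
    (h2.differentiableAt (by simp))
  rw [extDeriv_pullback_snd ht htcl, h3, add_zero] at h4
  exact h4

end Cylinder

/-! ### The kernel of `ψ₀(a, b, ·, ·)` -/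

section G2

local notation "E7" => EuclideanSpace ℝ (Fin 7)

lemma dx4_apply (i j k l : Fin 7) (a b c d : E7) : dx4 i j k l ![a, b, c, d] =
    (a i * (b j * (c k * d l - d k * c l) - c j * (b k * d l - d k * b l)
        + d j * (b k * c l - c k * b l))
      - b i * (a j * (c k * d l - d k * c l) - c j * (a k * d l - d k * a l)
        + d j * (a k * c l - c k * a l))
      + c i * (a j * (b k * d l - d k * b l) - b j * (a k * d l - d k * a l)
        + d j * (a k * b l - b k * a l))
      - d i * (a j * (b k * c l - c k * b l) - b j * (a k * c l - c k * a l)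
        + c j * (a k * b l - b k * a l))) := by
  simp [dx4, dx3, wedge1_apply, Fin.sum_univ_succ, coord7, Fin.removeNth, Fin.succAbove]
  ring

/-- The cross product on `ℝ⁷`. -/
def cross7 (u v : E7) : E7 := WithLp.toLp 2 ![
  u 1 * v 2 - u 2 * v 1 + (u 3 * v 4 - u 4 * v 3) + (u 5 * v 6 - u 6 * v 5),
  u 2 * v 0 - u 0 * v 2 + (u 3 * v 5 - u 5 * v 3) - (u 4 * v 6 - u 6 * v 4),
  u 0 * v 1 - u 1 * v 0 - (u 3 * v 6 - u 6 * v 3) - (u 4 * v 5 - u 5 * v 4),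
  u 4 * v 0 - u 0 * v 4 + (u 5 * v 1 - u 1 * v 5) - (u 6 * v 2 - u 2 * v 6),
  u 0 * v 3 - u 3 * v 0 - (u 6 * v 1 - u 1 * v 6) - (u 5 * v 2 - u 2 * v 5),
  u 6 * v 0 - u 0 * v 6 + (u 1 * v 3 - u 3 * v 1) - (u 2 * v 4 - u 4 * v 2),
  u 0 * v 5 - u 5 * v 0 - (u 1 * v 4 - u 4 * v 1) - (u 2 * v 3 - u 3 * v 2)]

/-- The Euclidean inner product on `ℝ⁷`. -/
def dot7 (u v : E7) : ℝ :=
  u 0 * v 0 + u 1 * v 1 + u 2 * v 2 + u 3 * v 3 + u 4 * v 4 + u 5 * v 5 + u 6 * v 6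

/-- A polynomial identity in coordinates. It exhibits ψ₀ as the failure of the three-dimensional
rule for iterated cross products, which is how the vanishing of ψ₀(a, b, x, ·) becomes an equation
for x. -/
lemma dot7_cross_cross (a b x d : E7) :
    dot7 (cross7 x (cross7 a b)) d =
      dot7 x b * dot7 a d - dot7 x a * dot7 b d - psi0 ![a, b, x, d] := by
  simp only [psi0, AlternatingMap.add_apply, AlternatingMap.sub_apply, dx4_apply, dot7, cross7,
    Matrix.cons_val]
  ring

lemma ext_dot7 {u v : E7} (h : ∀ d, dot7 u d = dot7 v d) : u = v := by
  ext k
  have := h (EuclideanSpace.single k 1)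
  fin_cases k <;> simpa [dot7] using this

lemma cross7_cross7 (a c : E7) : cross7 a (cross7 a c) = dot7 a c • a - dot7 a a • c := by
  apply ext_dot7
  intro d
  simp only [dot7, cross7, Matrix.cons_val, PiLp.sub_apply, PiLp.smul_apply, smul_eq_mul]
  ring

lemma cross7_swap (a b : E7) : cross7 a b = -cross7 b a := by
  apply ext_dot7
  intro d
  simp only [dot7, cross7, Matrix.cons_val, PiLp.neg_apply]
  ring

lemma dot7_cross_self (a b : E7) : dot7 (cross7 a b) (cross7 a b) =
    dot7 a a * dot7 b b - dot7 a b ^ 2 := by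
  simp only [dot7, cross7, Matrix.cons_val]
  ring

lemma dot7_self_eq_zero {a : E7} (h : dot7 a a = 0) : a = 0 := by
  simp only [dot7] at h
  have : ∀ k, a k = 0 := by
    intro k
    fin_cases k <;> simp <;>
    nlinarith [mul_self_nonneg (a 0), mul_self_nonneg (a 1), mul_self_nonneg (a 2),
      mul_self_nonneg (a 3), mul_self_nonneg (a 4), mul_self_nonneg (a 5), mul_self_nonneg (a 6)]
  ext k
  simpa using this k

lemma cross7_add_smul (a u v : E7) (r s : ℝ) :
    cross7 a (r • u - s • v) = r • cross7 a u - s • cross7 a v := by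
  apply ext_dot7
  intro d
  simp only [dot7, cross7, Matrix.cons_val, PiLp.sub_apply, PiLp.smul_apply, smul_eq_mul]
  ring

/-- If `ψ₀(a, b, x, ·) = 0`, then `x` lies in the span of `a`, `b` and `a × b`. -/
lemma mem_span_of_psi0_eq_zero {a b x : E7} (hab : LinearIndependent ℝ ![a, b])
    (hx : ∀ d, psi0 ![a, b, x, d] = 0) :
    ∃ r s t : ℝ, x = r • a + s • b + t • cross7 a b := by
  have h1 : cross7 x (cross7 a b) = dot7 x b • a - dot7 x a • b := by
    apply ext_dot7
    intro d
    rw [dot7_cross_cross, hx]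
    simp only [dot7, PiLp.sub_apply, PiLp.smul_apply, smul_eq_mul]
    ring
  -- |a × b|² is the Gram determinant of a and b. If it were zero, |a|² b − (a·b) a would have norm
  -- zero, a linear relation contradicting independence.
  have hc : dot7 (cross7 a b) (cross7 a b) ≠ 0 := by
    intro h0
    rw [dot7_cross_self] at h0
    have hw : dot7 (dot7 a a • b - dot7 a b • a) (dot7 a a • b - dot7 a b • a) =
        dot7 a a * (dot7 a a * dot7 b b - dot7 a b ^ 2) := by
      simp only [dot7, PiLp.sub_apply, PiLp.smul_apply, smul_eq_mul]
      ring
    rw [h0, mul_zero] at hw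
    have hw' := dot7_self_eq_zero hw
    rw [LinearIndependent.pair_iff] at hab
    have h2 := hab (-dot7 a b) (dot7 a a) (by rw [← hw']; module)
    have ha : a = 0 := dot7_self_eq_zero h2.2
    have := hab 1 0 (by simp [ha])
    simp at this
  have h2 : cross7 (cross7 a b) x = dot7 x a • b - dot7 x b • a := by
    rw [cross7_swap, h1]; module
  -- With c = a × b, this reads c × (c × x) = (c·x) c − |c|² x. By `h2` the left side is a
  -- combination of c × a and c × b, hence of a and b, so the equation can be solved for x.
  have h3 := cross7_cross7 (cross7 a b) x
  have h4 : cross7 (cross7 a b) a = dot7 a a • b - dot7 a b • a := by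
    rw [cross7_swap, cross7_cross7]; module
  have h5 : cross7 (cross7 a b) b = dot7 a b • b - dot7 b b • a := by
    rw [cross7_swap (cross7 a b), cross7_swap a b]
    have : cross7 b (-cross7 b a) = -cross7 b (cross7 b a) := by
      have := cross7_add_smul b 0 (cross7 b a) 0 1
      simpa using this
    rw [this, cross7_cross7]
    have : dot7 b a = dot7 a b := by simp only [dot7]; ring
    rw [this]; module
  rw [h2, cross7_add_smul, h4, h5] at h3
  set c := cross7 a b
  have h6 : dot7 c c • x = dot7 c x • c - (dot7 x a • (dot7 a b • b - dot7 b b • a)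
      - dot7 x b • (dot7 a a • b - dot7 a b • a)) := by
    rw [h3]; module
  refine ⟨(dot7 c c)⁻¹ * (dot7 x a * dot7 b b - dot7 x b * dot7 a b),
    (dot7 c c)⁻¹ * (dot7 x b * dot7 a a - dot7 x a * dot7 a b), (dot7 c c)⁻¹ * dot7 c x, ?_⟩
  calc x = (dot7 c c)⁻¹ • (dot7 c c • x) := by rw [smul_smul, inv_mul_cancel₀ hc, one_smul]
    _ = _ := by rw [h6]; module

/-- If `v` spans an associative `3`-plane of the `4`-form `ψ` and `ψ(x, ·, v₁, v₂) = 0`, then `x`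
lies in the plane. -/
lemma mem_span_of_associative {H : Type*} [AddCommGroup H] [Module ℝ H] (A : H ≃ₗ[ℝ] E7)
    {ψ : (Fin 4 → H) → ℝ} (hψ : ∀ w, ψ w = psi0 fun i => A (w i)) {a b c x : H}
    (hv : ∀ r s t : ℝ, r • a + s • b + t • c = 0 → r = 0 ∧ s = 0 ∧ t = 0)
    (h0 : ∀ y, ψ ![b, c, a, y] = 0)
    (hx : ∀ y, ψ ![b, c, x, y] = 0) : ∃ r s t : ℝ, x = r • a + s • b + t • c := by
  have hbc : LinearIndependent ℝ ![A b, A c] := by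
    rw [LinearIndependent.pair_iff]
    intro s t h
    have h1 : A ((0 : ℝ) • a + s • b + t • c) = 0 := by
      rw [← h]; simp
    exact (hv 0 s t (A.map_eq_zero_iff.1 h1)).2
  have hA : ∀ z, (∀ y, ψ ![b, c, z, y] = 0) → ∀ d, psi0 ![A b, A c, A z, d] = 0 := by
    intro z hz d
    have h1 := hz (A.symm d)
    rw [hψ] at h1
    rw [← h1]
    congr 1
    ext i : 1
    fin_cases i <;> simp
  obtain ⟨r, s, t, h1⟩ := mem_span_of_psi0_eq_zero hbc (hA x hx)
  obtain ⟨r', s', t', h2⟩ := mem_span_of_psi0_eq_zero hbc (hA a h0)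
  -- The vector a of the plane itself satisfies the equation, so A a is a combination of A b, A c
  -- and their cross product. Independence of a, b, c makes the last coefficient nonzero; hence the
  -- cross product lies in the image of the plane.
  have ht : t' ≠ 0 := by
    rintro rfl
    have h3 : A ((1 : ℝ) • a + (-r') • b + (-s') • c) = 0 := by
      simp only [map_add, map_smul, h2]; module
    exact one_ne_zero (hv _ _ _ (A.map_eq_zero_iff.1 h3)).1
  have h4 : cross7 (A b) (A c) = t'⁻¹ • (A a - r' • A b - s' • A c) := by
    rw [h2]
    have : r' • A b + s' • A c + t' • cross7 (A b) (A c) - r' • A b - s' • A c =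
      t' • cross7 (A b) (A c) := by module
    rw [this, smul_smul, inv_mul_cancel₀ ht, one_smul]
  refine ⟨t * t'⁻¹, r - t * t'⁻¹ * r', s - t * t'⁻¹ * s', A.injective ?_⟩
  rw [h1, h4]
  simp only [map_add, map_smul]
  module

end G2

/-! ### Tangent vectors and maps in charts -/

section Charts

variable {n : ℕ} {X : Type*} [TopologicalSpace X] [ChartedSpace (EuclideanSpace ℝ (Fin n)) X]

/-- The differential at `x` of the chart of `X` around `c`. -/
def dChart (c x : X) : TangentSpace (𝓡 n) x →L[ℝ] EuclideanSpace ℝ (Fin n) :=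
  (NormedSpace.fromTangentSpace (𝕜 := ℝ) (extChartAt (𝓡 n) c x)).toContinuousLinearMap.comp
    (mfderiv (𝓡 n) 𝓘(ℝ, EuclideanSpace ℝ (Fin n)) (extChartAt (𝓡 n) c) x)

variable [IsManifold (𝓡 n) ∞ X]

lemma dChart_dChartInv {c : X} {y : EuclideanSpace ℝ (Fin n)}
    (hy : y ∈ (extChartAt (𝓡 n) c).target) (e : EuclideanSpace ℝ (Fin n)) :
    dChart c ((extChartAt (𝓡 n) c).symm y) (dChartInv c y e) = e := by
  have h := mfderiv_extChartAt_comp_mfderivWithin_extChartAt_symm (I := 𝓡 n) hy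
  simp only [ModelWithCorners.range_eq_univ, mfderivWithin_univ] at h
  exact congrArg (fun L => L ((NormedSpace.fromTangentSpace (𝕜 := ℝ) y).symm e)) h

lemma dChartInv_dChart {c : X} {y : EuclideanSpace ℝ (Fin n)}
    (hy : y ∈ (extChartAt (𝓡 n) c).target)
    (v : TangentSpace (𝓡 n) ((extChartAt (𝓡 n) c).symm y)) :
    dChartInv c y (dChart c ((extChartAt (𝓡 n) c).symm y) v) = v := by
  have h := mfderivWithin_extChartAt_symm_comp_mfderiv_extChartAt (I := 𝓡 n) hy
  simp only [ModelWithCorners.range_eq_univ, mfderivWithin_univ] at h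
  exact congrArg (fun L => L v) h

lemma formInChart_dChart {k : ℕ} (α : DForm n k X) {c x : X}
    (hx : x ∈ (extChartAt (𝓡 n) c).source) (v : Fin k → TangentSpace (𝓡 n) x) :
    formInChart c α (extChartAt (𝓡 n) c x) (fun i => dChart c x (v i)) = α x v := by
  obtain ⟨y, hy, rfl⟩ : ∃ y ∈ (extChartAt (𝓡 n) c).target, (extChartAt (𝓡 n) c).symm y = x :=
    ⟨_, (extChartAt (𝓡 n) c).map_source hx, (extChartAt (𝓡 n) c).left_inv hx⟩
  rw [(extChartAt (𝓡 n) c).right_inv hy]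
  change α _ (fun i => dChartInv c y (dChart c _ (v i))) = _
  simp only [dChartInv_dChart hy]

/-- The differential of the chart, as a linear isomorphism. -/
def dChartEquiv (c x : X) (hx : x ∈ (extChartAt (𝓡 n) c).source) :
    TangentSpace (𝓡 n) x ≃ₗ[ℝ] EuclideanSpace ℝ (Fin n) :=
  LinearEquiv.ofBijective (dChart c x).toLinearMap (by
    obtain ⟨y, hy, rfl⟩ : ∃ y ∈ (extChartAt (𝓡 n) c).target, (extChartAt (𝓡 n) c).symm y = x :=
      ⟨_, (extChartAt (𝓡 n) c).map_source hx, (extChartAt (𝓡 n) c).left_inv hx⟩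
    exact ⟨Function.LeftInverse.injective (g := dChartInv c y) (dChartInv_dChart hy),
      Function.RightInverse.surjective (g := dChartInv c y) (dChart_dChartInv hy)⟩)

lemma dChartEquiv_apply (c x : X) (hx : x ∈ (extChartAt (𝓡 n) c).source)
    (v : TangentSpace (𝓡 n) x) : dChartEquiv c x hx v = dChart c x v := rfl

/-- Links the tangent bundle trivialization, in which smoothness of fields is defined, with the
differential of the chart, in which the computations are made. -/
lemma dChart_trivialization {c x : X} (hx : x ∈ (extChartAt (𝓡 n) c).source)
    (v : TangentSpace (𝓡 n) x) :
    (trivializationAt (EuclideanSpace ℝ (Fin n)) (TangentSpace (𝓡 n)) c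
      (⟨x, v⟩ : TangentBundle (𝓡 n) X)).2 = dChart c x v := by
  rw [extChartAt_source] at hx
  have h := TangentBundle.continuousLinearMapAt_trivializationAt (I := 𝓡 n) hx
  have h2 := congrArg (fun L => L v) h
  rw [Trivialization.continuousLinearMapAt_apply, Trivialization.coe_linearMapAt_of_mem] at h2
  · exact h2
  · exact hx

variable {m : ℕ} {Z : Type*} [TopologicalSpace Z] [ChartedSpace (EuclideanSpace ℝ (Fin m)) Z]
  [IsManifold (𝓡 m) ∞ Z]

/-- The expression of a map in charts. -/
def mapInChart (a : X) (c : Z) (f : X → Z) (y : EuclideanSpace ℝ (Fin n)) :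
    EuclideanSpace ℝ (Fin m) :=
  extChartAt (𝓡 m) c (f ((extChartAt (𝓡 n) a).symm y))

lemma dChart_mfderiv {a p : X} {c : Z} {f : X → Z} (hp : p ∈ (extChartAt (𝓡 n) a).source)
    (hfp : f p ∈ (extChartAt (𝓡 m) c).source) (hf : MDifferentiableAt (𝓡 n) (𝓡 m) f p)
    (v : TangentSpace (𝓡 n) p) :
    dChart c (f p) (mfderiv (𝓡 n) (𝓡 m) f p v) =
      fderiv ℝ (mapInChart a c f) (extChartAt (𝓡 n) a p) (dChart a p v) := by
  obtain ⟨y, hy, rfl⟩ : ∃ y ∈ (extChartAt (𝓡 n) a).target, (extChartAt (𝓡 n) a).symm y = p :=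
    ⟨_, (extChartAt (𝓡 n) a).map_source hp, (extChartAt (𝓡 n) a).left_inv hp⟩
  rw [(extChartAt (𝓡 n) a).right_inv hy]
  have h1 : MDifferentiableAt 𝓘(ℝ, EuclideanSpace ℝ (Fin n)) (𝓡 n)
      (extChartAt (𝓡 n) a).symm y := by
    have := mdifferentiableWithinAt_extChartAt_symm (I := 𝓡 n) hy
    simpa only [ModelWithCorners.range_eq_univ, mdifferentiableWithinAt_univ] using this
  have h2 : MDifferentiableAt (𝓡 m) 𝓘(ℝ, EuclideanSpace ℝ (Fin m)) (extChartAt (𝓡 m) c)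
      (f ((extChartAt (𝓡 n) a).symm y)) :=
    mdifferentiableAt_extChartAt (by rwa [extChartAt_source] at hfp)
  have h3 : mfderiv 𝓘(ℝ, EuclideanSpace ℝ (Fin n)) 𝓘(ℝ, EuclideanSpace ℝ (Fin m))
      (mapInChart a c f) y = _ :=
    mfderiv_comp (f := (extChartAt (𝓡 n) a).symm) (g := extChartAt (𝓡 m) c ∘ f) y (h2.comp _ hf) h1
  rw [mfderiv_comp _ h2 hf] at h3
  rw [← mfderiv_eq_fderiv, h3]
  have h4 := dChartInv_dChart hy v
  conv_lhs => rw [← h4]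
  rfl

lemma dFun_apply {a p : X} {f : X → ℝ} (hp : p ∈ (extChartAt (𝓡 n) a).source)
    (hf : MDifferentiableAt (𝓡 n) 𝓘(ℝ, ℝ) f p) (v : TangentSpace (𝓡 n) p) :
    NormedSpace.fromTangentSpace (𝕜 := ℝ) (f p) (mfderiv (𝓡 n) 𝓘(ℝ, ℝ) f p v) =
      fderiv ℝ (fun y => f ((extChartAt (𝓡 n) a).symm y)) (extChartAt (𝓡 n) a p)
        (dChart a p v) := by
  obtain ⟨y, hy, rfl⟩ : ∃ y ∈ (extChartAt (𝓡 n) a).target, (extChartAt (𝓡 n) a).symm y = p :=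
    ⟨_, (extChartAt (𝓡 n) a).map_source hp, (extChartAt (𝓡 n) a).left_inv hp⟩
  rw [(extChartAt (𝓡 n) a).right_inv hy]
  have h1 : MDifferentiableAt 𝓘(ℝ, EuclideanSpace ℝ (Fin n)) (𝓡 n)
      (extChartAt (𝓡 n) a).symm y := by
    have := mdifferentiableWithinAt_extChartAt_symm (I := 𝓡 n) hy
    simpa only [ModelWithCorners.range_eq_univ, mdifferentiableWithinAt_univ] using this
  have h3 : mfderiv 𝓘(ℝ, EuclideanSpace ℝ (Fin n)) 𝓘(ℝ, ℝ)
      (fun y => f ((extChartAt (𝓡 n) a).symm y)) y = _ := mfderiv_comp y hf h1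
  rw [← mfderiv_eq_fderiv, h3]
  have h4 := dChartInv_dChart hy v
  conv_lhs => rw [← h4]
  rfl

lemma dChart_mfderiv_curve {c : X} {γ : ℝ → X} {t : ℝ}
    (h : γ t ∈ (extChartAt (𝓡 n) c).source) (hγ : MDifferentiableAt 𝓘(ℝ, ℝ) (𝓡 n) γ t) :
    dChart c (γ t) (mfderiv 𝓘(ℝ, ℝ) (𝓡 n) γ t (1 : ℝ)) =
      deriv (fun s => extChartAt (𝓡 n) c (γ s)) t := by
  have h2 : MDifferentiableAt (𝓡 n) 𝓘(ℝ, EuclideanSpace ℝ (Fin n)) (extChartAt (𝓡 n) c) (γ t) :=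
    mdifferentiableAt_extChartAt (by rwa [extChartAt_source] at h)
  have h3 : mfderiv 𝓘(ℝ, ℝ) 𝓘(ℝ, EuclideanSpace ℝ (Fin n))
      (fun s => extChartAt (𝓡 n) c (γ s)) t = _ := mfderiv_comp t h2 hγ
  rw [← fderiv_apply_one_eq_deriv, ← mfderiv_eq_fderiv, h3]
  rfl

end Charts

/-! ### Smoothness of maps, families and fields read in charts -/

section Smooth

variable {n : ℕ} {X : Type*} [TopologicalSpace X] [ChartedSpace (EuclideanSpace ℝ (Fin n)) X]
  [IsManifold (𝓡 n) ∞ X]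
  {m : ℕ} {Z : Type*} [TopologicalSpace Z] [ChartedSpace (EuclideanSpace ℝ (Fin m)) Z]
  [IsManifold (𝓡 m) ∞ Z]

lemma contMDiffAt_chart_symm {a : X} {y : EuclideanSpace ℝ (Fin n)}
    (hy : y ∈ (extChartAt (𝓡 n) a).target) :
    ContMDiffAt 𝓘(ℝ, EuclideanSpace ℝ (Fin n)) (𝓡 n) ∞ (extChartAt (𝓡 n) a).symm y :=
  (contMDiffOn_extChartAt_symm a).contMDiffAt ((isOpen_extChartAt_target a).mem_nhds hy)

lemma contDiffAt_comp_chart_symm {V : Type*} [NormedAddCommGroup V] [NormedSpace ℝ V] {a p : X}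
    {f : X → V} (hp : p ∈ (extChartAt (𝓡 n) a).source)
    (hf : ContMDiffAt (𝓡 n) 𝓘(ℝ, V) ∞ f p) :
    ContDiffAt ℝ ∞ (fun y => f ((extChartAt (𝓡 n) a).symm y)) (extChartAt (𝓡 n) a p) := by
  rw [← contMDiffAt_iff_contDiffAt]
  have h1 := contMDiffAt_chart_symm ((extChartAt (𝓡 n) a).map_source hp)
  refine ContMDiffAt.comp (I' := 𝓡 n) (g := f) _ ?_ h1
  rwa [(extChartAt (𝓡 n) a).left_inv hp]

lemma contMDiffAt_chart_comp {c : Z} {W : Type*} [TopologicalSpace W] {H' E' : Type*}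
    [TopologicalSpace H'] [NormedAddCommGroup E'] [NormedSpace ℝ E'] {J : ModelWithCorners ℝ E' H'}
    [ChartedSpace H' W] {f : W → Z} {w : W}
    (hfw : f w ∈ (extChartAt (𝓡 m) c).source) (hf : ContMDiffAt J (𝓡 m) ∞ f w) :
    ContMDiffAt J 𝓘(ℝ, EuclideanSpace ℝ (Fin m)) ∞ (fun w => extChartAt (𝓡 m) c (f w)) w := by
  rw [extChartAt_source] at hfw
  exact ContMDiffAt.comp (I' := 𝓡 m) (g := extChartAt (𝓡 m) c) w (contMDiffAt_extChartAt' hfw) hf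

lemma contDiffAt_mapInChart {a p : X} {c : Z} {f : X → Z} (hp : p ∈ (extChartAt (𝓡 n) a).source)
    (hfp : f p ∈ (extChartAt (𝓡 m) c).source) (hf : ContMDiffAt (𝓡 n) (𝓡 m) ∞ f p) :
    ContDiffAt ℝ ∞ (mapInChart (n := n) (m := m) a c f) (extChartAt (𝓡 n) a p) :=
  contDiffAt_comp_chart_symm hp (contMDiffAt_chart_comp (m := m) hfp hf)

/-- Smoothness in charts of a family of maps. -/
lemma contDiffAt_family_comp_chart_symm {V : Type*} [NormedAddCommGroup V] [NormedSpace ℝ V]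
    {a p : X} {f : ℝ × X → V} {s : ℝ} (hp : p ∈ (extChartAt (𝓡 n) a).source)
    (hf : ContMDiffAt (𝓘(ℝ, ℝ).prod (𝓡 n)) 𝓘(ℝ, V) ∞ f (s, p)) :
    ContDiffAt ℝ ∞ (fun q : ℝ × EuclideanSpace ℝ (Fin n) =>
      f (q.1, (extChartAt (𝓡 n) a).symm q.2)) (s, extChartAt (𝓡 n) a p) := by
  rw [← contMDiffAt_iff_contDiffAt]
  have h1 := contMDiffAt_chart_symm ((extChartAt (𝓡 n) a).map_source hp)
  have h2 : ContMDiffAt 𝓘(ℝ, ℝ × EuclideanSpace ℝ (Fin n)) (𝓘(ℝ, ℝ).prod (𝓡 n)) ∞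
      (fun q : ℝ × EuclideanSpace ℝ (Fin n) => (q.1, (extChartAt (𝓡 n) a).symm q.2))
      (s, extChartAt (𝓡 n) a p) :=
    ContMDiffAt.prodMk contDiff_fst.contMDiff.contMDiffAt
      (ContMDiffAt.comp (I' := 𝓘(ℝ, EuclideanSpace ℝ (Fin n)))
        (g := (extChartAt (𝓡 n) a).symm) (f := Prod.snd) (s, extChartAt (𝓡 n) a p) h1
        contDiff_snd.contMDiff.contMDiffAt)
  refine ContMDiffAt.comp (I' := 𝓘(ℝ, ℝ).prod (𝓡 n)) (g := f) _ ?_ h2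
  rwa [(extChartAt (𝓡 n) a).left_inv hp]

/-- The coordinates of a vector field along a map are smooth if the field is. -/
lemma contMDiffAt_dChart {c : Z} {W : Type*} [TopologicalSpace W] {H' E' : Type*}
    [TopologicalSpace H'] [NormedAddCommGroup E'] [NormedSpace ℝ E'] {J : ModelWithCorners ℝ E' H'}
    [ChartedSpace H' W] {f : W → Z} {w : W} {u : ∀ w, TangentSpace (𝓡 m) (f w)} :
    f w ∈ (extChartAt (𝓡 m) c).source →
    (ContMDiffAt J (𝓡 m).tangent ∞ (fun w => (⟨f w, u w⟩ : TangentBundle (𝓡 m) Z)) w ↔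
      ContMDiffAt J (𝓡 m) ∞ f w ∧
      ContMDiffAt J 𝓘(ℝ, EuclideanSpace ℝ (Fin m)) ∞ (fun w => dChart c (f w) (u w)) w) := by
  intro hfw
  have he : (⟨f w, u w⟩ : TangentBundle (𝓡 m) Z) ∈
      (trivializationAt (EuclideanSpace ℝ (Fin m)) (TangentSpace (𝓡 m)) c).source := by
    rw [Trivialization.mem_source]
    rwa [extChartAt_source] at hfw
  refine (Trivialization.contMDiffAt_iff (IM := J) (n := ∞)
    (f := fun w => (⟨f w, u w⟩ : TangentBundle (𝓡 m) Z)) he).trans ?_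
  refine and_congr_right fun hf => ?_
  have hev : ∀ᶠ w' in 𝓝 w, f w' ∈ (extChartAt (𝓡 m) c).source :=
    hf.continuousAt.eventually_mem ((isOpen_extChartAt_source c).mem_nhds hfw)
  have heq : (fun w' => (trivializationAt (EuclideanSpace ℝ (Fin m)) (TangentSpace (𝓡 m)) c
      (⟨f w', u w'⟩ : TangentBundle (𝓡 m) Z)).2) =ᶠ[𝓝 w] fun w' => dChart c (f w') (u w') := by
    filter_upwards [hev] with w' hw'
    exact dChart_trivialization hw' (u w')
  exact ⟨fun h => h.congr_of_eventuallyEq heq.symm, fun h => h.congr_of_eventuallyEq heq⟩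

end Smooth

/-! ### The section `L` in charts -/

section Local

variable {M : Type*} [TopologicalSpace M] [ChartedSpace (EuclideanSpace ℝ (Fin 6)) M]
  {P : Type*} [TopologicalSpace P] [ChartedSpace (EuclideanSpace ℝ (Fin 3)) P]

/-- The form `τ + dt ∧ ρ` on `ℝ × M` in a chart of `M`. -/
def psiInChart (ρ : DForm 6 3 M) (τ : DForm 6 4 M) (c : M) :
    ℝ × EuclideanSpace ℝ (Fin 6) → (ℝ × EuclideanSpace ℝ (Fin 6)) [⋀^Fin 4]→L[ℝ] ℝ :=
  cylinderForm (formInChart c ρ) (formInChart c τ)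

/-- The map `(λ, ι)` in charts. -/
def graphInChart (a : P) (c : M) (lam : P → ℝ) (ι : P → M) (y : EuclideanSpace ℝ (Fin 3)) :
    ℝ × EuclideanSpace ℝ (Fin 6) :=
  (lam ((extChartAt (𝓡 3) a).symm y), mapInChart a c ι y)

/-- A field `(l, n)` along `(λ, ι)` in charts. -/
def fieldInChart (a : P) (c : M) {ι : P → M} (l : P → ℝ) (n : ∀ p, TangentSpace (𝓡 6) (ι p))
    (y : EuclideanSpace ℝ (Fin 3)) : ℝ × EuclideanSpace ℝ (Fin 6) :=
  (l ((extChartAt (𝓡 3) a).symm y),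
    dChart c (ι ((extChartAt (𝓡 3) a).symm y)) (n ((extChartAt (𝓡 3) a).symm y)))

/-- The charts around `a` and `c` are charts around `p` and `ι p`. -/
def Fits (a : P) (c : M) (ι : P → M) (p : P) : Prop :=
  p ∈ (extChartAt (𝓡 3) a).source ∧ ι p ∈ (extChartAt (𝓡 6) c).source

lemma Fits.self (ι : P → M) (p : P) : Fits p (ι p) ι p :=
  ⟨mem_extChartAt_source p, mem_extChartAt_source (ι p)⟩

lemma Fits.eventually {a : P} {c : M} {ι : P → M} {p : P} (h : Fits a c ι p)
    (hι : ContinuousAt ι p) : ∀ᶠ q in 𝓝 p, Fits a c ι q := by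
  filter_upwards [(isOpen_extChartAt_source (I := 𝓡 3) a).mem_nhds h.1,
    hι.eventually_mem ((isOpen_extChartAt_source (I := 𝓡 6) c).mem_nhds h.2)] with q h1 h2
  exact ⟨h1, h2⟩

lemma tendsto_chart_symm {a p : P} (h : p ∈ (extChartAt (𝓡 3) a).source) :
    Filter.Tendsto (extChartAt (𝓡 3) a).symm (𝓝 (extChartAt (𝓡 3) a p)) (𝓝 p) := by
  have := continuousAt_extChartAt_symm'' ((extChartAt (𝓡 3) a).map_source h)
  rwa [ContinuousAt, (extChartAt (𝓡 3) a).left_inv h] at this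

lemma graphInChart_chart {a p : P} {c : M} (lam : P → ℝ) (ι : P → M)
    (hp : p ∈ (extChartAt (𝓡 3) a).source) :
    graphInChart a c lam ι (extChartAt (𝓡 3) a p) = (lam p, extChartAt (𝓡 6) c (ι p)) := by
  simp only [graphInChart, mapInChart, (extChartAt (𝓡 3) a).left_inv hp]

lemma fieldInChart_chart {a p : P} {c : M} {ι : P → M} (l : P → ℝ)
    (n : ∀ p, TangentSpace (𝓡 6) (ι p)) (hp : p ∈ (extChartAt (𝓡 3) a).source) :
    fieldInChart a c l n (extChartAt (𝓡 3) a p) = (l p, dChart c (ι p) (n p)) := by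
  obtain ⟨y, hy, rfl⟩ : ∃ y ∈ (extChartAt (𝓡 3) a).target, (extChartAt (𝓡 3) a).symm y = p :=
    ⟨_, (extChartAt (𝓡 3) a).map_source hp, (extChartAt (𝓡 3) a).left_inv hp⟩
  rw [(extChartAt (𝓡 3) a).right_inv hy]
  rfl

lemma contDiffAt_formInChart {k : ℕ} {α : DForm 6 k M} (hα : IsSmoothForm α) {c : M}
    {x : EuclideanSpace ℝ (Fin 6)} (hx : x ∈ (extChartAt (𝓡 6) c).target) :
    ContDiffAt ℝ ∞ (formInChart c α) x :=
  (hα c).contDiffAt ((isOpen_extChartAt_target c).mem_nhds hx)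

lemma contDiffAt_psiInChart {ρ : DForm 6 3 M} {τ : DForm 6 4 M} (h : IsClosedG2Pair34 ρ τ) {c : M}
    {z : ℝ × EuclideanSpace ℝ (Fin 6)} (hz : z.2 ∈ (extChartAt (𝓡 6) c).target) :
    ContDiffAt ℝ ∞ (psiInChart ρ τ c) z := by
  have hev := (isOpen_extChartAt_target (I := 𝓡 6) c).mem_nhds hz
  exact contDiffAt_cylinderForm
    (Filter.mem_of_superset hev fun x hx => contDiffAt_formInChart h.smooth_left hx)
    (Filter.mem_of_superset hev fun x hx => h.closed_left c x hx)
    (contDiffAt_formInChart h.smooth_right hz)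

lemma extDeriv_psiInChart {ρ : DForm 6 3 M} {τ : DForm 6 4 M} (h : IsClosedG2Pair34 ρ τ) {c : M}
    {z : ℝ × EuclideanSpace ℝ (Fin 6)} (hz : z.2 ∈ (extChartAt (𝓡 6) c).target) :
    extDeriv (psiInChart ρ τ c) z = 0 := by
  have hev := (isOpen_extChartAt_target (I := 𝓡 6) c).mem_nhds hz
  exact extDeriv_cylinderForm
    (Filter.mem_of_superset hev fun x hx => contDiffAt_formInChart h.smooth_left hx)
    (Filter.mem_of_superset hev fun x hx => h.closed_left c x hx)
    (contDiffAt_formInChart h.smooth_right hz) (h.closed_right c _ hz)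

variable [IsManifold (𝓡 6) ∞ M] [IsManifold (𝓡 3) ∞ P]

lemma contDiffAt_graphInChart {a p : P} {c : M} {lam : P → ℝ} {ι : P → M} (h : Fits a c ι p)
    (hlam : ContMDiffAt (𝓡 3) 𝓘(ℝ, ℝ) ∞ lam p) (hι : ContMDiffAt (𝓡 3) (𝓡 6) ∞ ι p) :
    ContDiffAt ℝ ∞ (graphInChart a c lam ι) (extChartAt (𝓡 3) a p) :=
  (contDiffAt_comp_chart_symm h.1 hlam).prodMk (contDiffAt_mapInChart h.1 h.2 hι)

lemma contDiffAt_fieldInChart {a p : P} {c : M} {ι : P → M} {l : P → ℝ}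
    {n : ∀ p, TangentSpace (𝓡 6) (ι p)} (h : Fits a c ι p)
    (hl : ContMDiffAt (𝓡 3) 𝓘(ℝ, ℝ) ∞ l p)
    (hn : ContMDiffAt (𝓡 3) (𝓡 6).tangent ∞ (fun p => tv (ι p) (n p)) p) :
    ContDiffAt ℝ ∞ (fieldInChart a c l n) (extChartAt (𝓡 3) a p) :=
  (contDiffAt_comp_chart_symm h.1 hl).prodMk
    (contDiffAt_comp_chart_symm (f := fun p => dChart c (ι p) (n p)) h.1
      ((contMDiffAt_dChart h.2).1 hn).2)

/-- The chart of ℝ × M is the identity on ℝ and a chart of M on the second factor, so τ and ρ can be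
transported separately. This also carries the pointwise G₂-structure over to coordinates. -/
lemma psiInChart_apply {ρ : DForm 6 3 M} {τ : DForm 6 4 M} {c x : M}
    (hx : x ∈ (extChartAt (𝓡 6) c).source) (t : ℝ) (w : Fin 4 → ℝ × TangentSpace (𝓡 6) x) :
    psiInChart ρ τ c (t, extChartAt (𝓡 6) c x) (fun i => ((w i).1, dChart c x (w i).2)) =
      cyl4 ρ τ x w := by
  rw [psiInChart, cylinderForm_apply, cyl4, cylForm]
  simp only [AlternatingMap.add_apply, wedge1_apply]
  congr 1
  · exact formInChart_dChart τ hx fun i => (w i).2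
  · refine Finset.sum_congr rfl fun i _ => ?_
    congr 2
    exact formInChart_dChart ρ hx fun j => (i.removeNth w j).2

/-- The differential of `(λ, ι)` in charts. -/
lemma fderiv_graphInChart_dChart {a p : P} {c : M} {lam : P → ℝ} {ι : P → M} (h : Fits a c ι p)
    (hlam : ContMDiffAt (𝓡 3) 𝓘(ℝ, ℝ) ∞ lam p) (hι : ContMDiffAt (𝓡 3) (𝓡 6) ∞ ι p)
    (v : TangentSpace (𝓡 3) p) :
    fderiv ℝ (graphInChart a c lam ι) (extChartAt (𝓡 3) a p) (dChart a p v) =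
      (dFun lam p v, dChart c (ι p) (mfderiv (𝓡 3) (𝓡 6) ι p v)) := by
  have h1 : HasFDerivAt (graphInChart a c lam ι) _ (extChartAt (𝓡 3) a p) :=
    ((contDiffAt_comp_chart_symm h.1 hlam).differentiableAt (by simp)).hasFDerivAt.prodMk
      ((contDiffAt_mapInChart h.1 h.2 hι).differentiableAt (by simp)).hasFDerivAt
  rw [h1.fderiv, dChart_mfderiv h.1 h.2 (hι.mdifferentiableAt (by simp))]
  refine Prod.ext ?_ rfl
  exact (dFun_apply h.1 (hlam.mdifferentiableAt (by simp)) v).symm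

/-- The section `L` in charts. -/
lemma contractPullback_psiInChart {ρ : DForm 6 3 M} {τ : DForm 6 4 M} {a p : P} {c : M}
    {lam : P → ℝ} {ι : P → M} (h : Fits a c ι p)
    (hlam : ContMDiffAt (𝓡 3) 𝓘(ℝ, ℝ) ∞ lam p) (hι : ContMDiffAt (𝓡 3) (𝓡 6) ∞ ι p)
    (r : ℝ) (m : TangentSpace (𝓡 6) (ι p)) (v : Fin 3 → TangentSpace (𝓡 3) p) :
    contractPullback (psiInChart ρ τ c) (graphInChart a c lam ι (extChartAt (𝓡 3) a p),
        fderiv ℝ (graphInChart a c lam ι) (extChartAt (𝓡 3) a p), (r, dChart c (ι p) m))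
        (fun i => dChart a p (v i)) =
      r * L₁ ρ ι p v - L₂ ρ τ lam ι p m v := by
  have hF := fderiv_graphInChart_dChart (c := c) h hlam hι
  rw [contractPullback_apply, hF, hF, hF, graphInChart_chart _ _ h.1]
  let w : Fin 4 → ℝ × TangentSpace (𝓡 6) (ι p) :=
    ![(r, m), (dFun lam p (v 0), mfderiv (𝓡 3) (𝓡 6) ι p (v 0)),
      (dFun lam p (v 1), mfderiv (𝓡 3) (𝓡 6) ι p (v 1)),
      (dFun lam p (v 2), mfderiv (𝓡 3) (𝓡 6) ι p (v 2))]
  have hw : (![(r, dChart c (ι p) m),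
      (dFun lam p (v 0), dChart c (ι p) (mfderiv (𝓡 3) (𝓡 6) ι p (v 0))),
      (dFun lam p (v 1), dChart c (ι p) (mfderiv (𝓡 3) (𝓡 6) ι p (v 1))),
      (dFun lam p (v 2), dChart c (ι p) (mfderiv (𝓡 3) (𝓡 6) ι p (v 2)))] :
        Fin 4 → ℝ × EuclideanSpace ℝ (Fin 6)) = fun i => ((w i).1, dChart c (ι p) (w i).2) := by
    funext i
    fin_cases i <;> rfl
  -- Source of the signs: contraction puts (r, m) into the first slot, while the covector slot of L₂
  -- is the last. For τ this costs (−1)³. For ρ_N it costs (−1)², but in dt ∧ ρ the arguments of dλ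
  -- now sit one place further right, which gives the other minus sign.
  rw [hw, psiInChart_apply h.2, cyl4, cylForm, L₂]
  simp only [AlternatingMap.add_apply, wedge1_apply, normalPart, AlternatingMap.smul_apply,
    AlternatingMap.compLinearMap_apply, Fin.sum_univ_succ (n := 3), smul_eq_mul]
  have e1 : (τ (ι p)).toAlternatingMap (fun i => (LinearMap.snd ℝ ℝ (TangentSpace (𝓡 6) (ι p))) (w i))
      = (((τ (ι p)).toAlternatingMap.curryLeft m) fun i => mfderiv (𝓡 3) (𝓡 6) ι p (v i)) := by
    rw [AlternatingMap.curryLeft_apply_apply]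
    congr 1
    funext i
    fin_cases i <;> rfl
  have e2 : (ρ (ι p)).toAlternatingMap (fun i => (LinearMap.snd ℝ ℝ (TangentSpace (𝓡 6) (ι p)))
      ((0 : Fin 4).removeNth w i)) = L₁ ρ ι p v := by
    change _ = (ρ (ι p)).toAlternatingMap (fun i => mfderiv (𝓡 3) (𝓡 6) ι p (v i))
    congr 1
    funext i
    fin_cases i <;> rfl
  have e3 : ∀ i : Fin 3, (ρ (ι p)).toAlternatingMap (fun j =>
      (LinearMap.snd ℝ ℝ (TangentSpace (𝓡 6) (ι p))) (i.succ.removeNth w j)) =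
      (((ρ (ι p)).toAlternatingMap.curryLeft m) fun j =>
        mfderiv (𝓡 3) (𝓡 6) ι p (i.removeNth v j)) := by
    intro i
    rw [AlternatingMap.curryLeft_apply_apply]
    congr 1
    funext j
    fin_cases i <;> fin_cases j <;> rfl
  have e4 : ∀ i : Fin 3, (LinearMap.fst ℝ ℝ (TangentSpace (𝓡 6) (ι p))) (w i.succ) =
      dFun lam p (v i) := by
    intro i
    fin_cases i <;> rfl
  have e5 : (LinearMap.fst ℝ ℝ (TangentSpace (𝓡 6) (ι p))) (w 0) = r := rfl
  have e6 : ∀ f : Fin (2 + 1) → ℝ, ∑ i, f i = f 0 + f 1 + f 2 := Fin.sum_univ_three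
  simp only [e1, e2, e3, e4, e5, e6]
  simp
  ring

end Local

/-! ### The derivative of the section `L` along a curve -/

section Derivative

variable {M : Type*} [TopologicalSpace M] [ChartedSpace (EuclideanSpace ℝ (Fin 6)) M]
  {P : Type*} [TopologicalSpace P] [ChartedSpace (EuclideanSpace ℝ (Fin 3)) P]

/-- The derivative of `r L₁ - L₂(m)` at a solution in the direction of `(l, n)`, computed in charts
around `a` and `c`. -/
def derivInCharts (ρ : DForm 6 3 M) (τ : DForm 6 4 M) (a : P) (c : M) (lam : P → ℝ) (ι : P → M)
    (l : P → ℝ) (n : ∀ p, TangentSpace (𝓡 6) (ι p)) (p : P) (r : ℝ)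
    (m : TangentSpace (𝓡 6) (ι p)) : TangentSpace (𝓡 3) p [⋀^Fin 3]→L[ℝ] ℝ :=
  (linearize (psiInChart ρ τ c) (graphInChart a c lam ι) (fieldInChart a c l n)
    (extChartAt (𝓡 3) a p) (r, dChart c (ι p) m)).compContinuousLinearMap (dChart a p)

lemma dChart_congr {c x y : M} {u : TangentSpace (𝓡 6) x} {w : TangentSpace (𝓡 6) y}
    (h : tv x u = tv y w) : dChart c x u = dChart c y w := by
  cases h
  rfl

variable [IsManifold (𝓡 6) ∞ M]

/-- `(Λ, I)` is a smooth curve near `p` through `(λ, ι)` with velocity `(l, n)`. -/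
structure HasVelocityNear (lam : P → ℝ) (ι : P → M) (Λ : ℝ → P → ℝ) (I : ℝ → P → M)
    (l : P → ℝ) (n : ∀ p, TangentSpace (𝓡 6) (ι p)) (p : P) : Prop where
  init_fun : Λ 0 = lam
  init_map : I 0 = ι
  smooth_fun : ∀ᶠ q in 𝓝 ((0 : ℝ), p), ContMDiffAt (𝓘(ℝ, ℝ).prod (𝓡 3)) 𝓘(ℝ, ℝ) ∞
    (fun q : ℝ × P => Λ q.1 q.2) q
  smooth_map : ∀ᶠ q in 𝓝 ((0 : ℝ), p), ContMDiffAt (𝓘(ℝ, ℝ).prod (𝓡 3)) (𝓡 6) ∞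
    (fun q : ℝ × P => I q.1 q.2) q
  deriv_fun : ∀ᶠ q in 𝓝 p, HasDerivAt (fun s => Λ s q) (l q) 0
  deriv_map : ∀ᶠ q in 𝓝 p, velocity (fun s => I s q) 0 = tv (ι q) (n q)

/-- The velocity of a curve in charts. -/
lemma HasVelocityNear.fieldInChart_eq {a p : P} {c : M} {lam : P → ℝ} {ι : P → M}
    (hfit : Fits a c ι p) (hι : ContinuousAt ι p) {Λ : ℝ → P → ℝ} {I : ℝ → P → M}
    {l : P → ℝ} {n : ∀ p, TangentSpace (𝓡 6) (ι p)} (hv : HasVelocityNear lam ι Λ I l n p) :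
    ∀ᶠ y' in 𝓝 (extChartAt (𝓡 3) a p), fieldInChart a c l n y' =
      deriv (fun s => graphInChart a c (Λ s) (I s) y') 0 := by
  have hc : ∀ᶠ q in 𝓝 p, MDifferentiableAt 𝓘(ℝ, ℝ) (𝓡 6) (fun s => I s q) 0 := by
    have hk : Filter.Tendsto (fun q : P => ((0 : ℝ), q)) (𝓝 p) (𝓝 (0, p)) :=
      (Continuous.prodMk_right (0 : ℝ)).tendsto p
    filter_upwards [hk.eventually hv.smooth_map] with q hq
    have hs : ContMDiffAt 𝓘(ℝ, ℝ) (𝓘(ℝ, ℝ).prod (𝓡 3)) ∞ (fun s : ℝ => (s, q)) 0 :=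
      contMDiffAt_id.prodMk contMDiffAt_const
    exact (hq.comp (x := (0 : ℝ)) hs).mdifferentiableAt (by simp)
  filter_upwards [(tendsto_chart_symm hfit.1).eventually
    ((hfit.eventually hι).and (hc.and (hv.deriv_fun.and hv.deriv_map)))]
    with y' ⟨h1, h2, h3, h4⟩
  set q := (extChartAt (𝓡 3) a).symm y' with hq
  have hI0q : I 0 q = ι q := congrFun hv.init_map q
  have h5 := dChart_mfderiv_curve (c := c) (by rw [hI0q]; exact h1.2) h2
  have h6 := dChart_congr (c := c) h4
  have h7 : DifferentiableAt ℝ (fun s => extChartAt (𝓡 6) c (I s q)) 0 :=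
    (mdifferentiableAt_iff_differentiableAt.1
      (MDifferentiableAt.comp (I' := 𝓡 6) (0 : ℝ) (g := extChartAt (𝓡 6) c)
        (mdifferentiableAt_extChartAt (by rw [hI0q, ← extChartAt_source (𝓡 6)]; exact h1.2)) h2))
  have h8 : HasDerivAt (fun s => graphInChart a c (Λ s) (I s) y') _ 0 :=
    h3.prodMk h7.hasDerivAt
  rw [h8.deriv, ← h5]
  exact Prod.ext rfl h6.symm

variable [IsManifold (𝓡 3) ∞ P]

lemma HasVelocityNear.contDiffAt {a p : P} {c : M} {lam : P → ℝ} {ι : P → M}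
    (hfit : Fits a c ι p) {Λ : ℝ → P → ℝ} {I : ℝ → P → M}
    {l : P → ℝ} {n : ∀ p, TangentSpace (𝓡 6) (ι p)} (hv : HasVelocityNear lam ι Λ I l n p) :
    ContDiffAt ℝ ∞ (fun q : ℝ × EuclideanSpace ℝ (Fin 3) =>
      graphInChart a c (Λ q.1) (I q.1) q.2) (0, extChartAt (𝓡 3) a p) := by
  have hIp : I 0 p ∈ (extChartAt (𝓡 6) c).source := congrFun hv.init_map p ▸ hfit.2
  exact (contDiffAt_family_comp_chart_symm hfit.1 hv.smooth_fun.self_of_nhds).prodMk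
    (contDiffAt_family_comp_chart_symm
      (f := fun q : ℝ × P => extChartAt (𝓡 6) c (I q.1 q.2)) hfit.1
      (contMDiffAt_chart_comp (m := 6) (f := fun q : ℝ × P => I q.1 q.2) hIp
        hv.smooth_map.self_of_nhds))

/-- The chart differentials are isomorphisms, so every coordinate vector Y and every coordinate
triple comes from tangent vectors, for which the value is r L₁ − L₂(m). -/
lemma IsSolution.contractPullback_eq_zero {ρ : DForm 6 3 M} {τ : DForm 6 4 M} {a p : P} {c : M}
    {lam : P → ℝ} {ι : P → M} (hfit : Fits a c ι p)
    (hlam : ContMDiffAt (𝓡 3) 𝓘(ℝ, ℝ) ∞ lam p) (hι : ContMDiffAt (𝓡 3) (𝓡 6) ∞ ι p)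
    (hsol : IsSolution ρ τ lam ι) (Y : ℝ × EuclideanSpace ℝ (Fin 6)) :
    contractPullback (psiInChart ρ τ c) (graphInChart a c lam ι (extChartAt (𝓡 3) a p),
      fderiv ℝ (graphInChart a c lam ι) (extChartAt (𝓡 3) a p), Y) = 0 := by
  obtain ⟨r', e⟩ := Y
  ext u
  have h1 := contractPullback_psiInChart (ρ := ρ) (τ := τ) hfit hlam hι r'
    ((dChartEquiv c (ι p) hfit.2).symm e) (fun i => (dChartEquiv a p hfit.1).symm (u i))
  simp only [← dChartEquiv_apply _ _ hfit.1, ← dChartEquiv_apply _ _ hfit.2,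
    LinearEquiv.apply_symm_apply] at h1
  rw [hsol.1, hsol.2] at h1
  simpa using h1

/-- The derivative of the section `L` along a curve through a solution. -/
lemma HasVelocityNear.hasDerivAt {ρ : DForm 6 3 M} {τ : DForm 6 4 M} (h : IsClosedG2Pair34 ρ τ)
    {a p : P} {c : M} {lam : P → ℝ} {ι : P → M} (hfit : Fits a c ι p)
    (hlam : ContMDiffAt (𝓡 3) 𝓘(ℝ, ℝ) ∞ lam p) (hι : ContMDiffAt (𝓡 3) (𝓡 6) ∞ ι p)
    (hsol : IsSolution ρ τ lam ι) {Λ : ℝ → P → ℝ} {I : ℝ → P → M}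
    {l : P → ℝ} {n : ∀ p, TangentSpace (𝓡 6) (ι p)} (hv : HasVelocityNear lam ι Λ I l n p)
    (r : ℝ) {w : TangentSpace (𝓡 6) (ι p)} {m : ∀ s, TangentSpace (𝓡 6) (I s p)}
    (hm : ContMDiffAt 𝓘(ℝ, ℝ) (𝓡 6).tangent ∞ (fun s => tv (I s p) (m s)) 0)
    (hmw : tv (I 0 p) (m 0) = tv (ι p) w) (v : Fin 3 → TangentSpace (𝓡 3) p) :
    HasDerivAt (fun s => r * L₁ ρ (I s) p v - L₂ ρ τ (Λ s) (I s) p (m s) v)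
      (derivInCharts ρ τ a c lam ι l n p r w v) 0 := by
  have hmap := hv.smooth_map.self_of_nhds
  have hI0 : I 0 p = ι p := congrFun hv.init_map p
  have hIp : I 0 p ∈ (extChartAt (𝓡 6) c).source := hI0 ▸ hfit.2
  have hY : DifferentiableAt ℝ (fun s => (r, dChart c (I s p) (m s))) 0 := by
    have h1 := ((contMDiffAt_dChart (f := fun s => I s p) (w := (0 : ℝ)) (u := m) hIp).1 hm).2
    exact (differentiableAt_const r).prodMk
      ((contMDiffAt_iff_contDiffAt.1 h1).differentiableAt (by simp))
  have hmw' : dChart c (I 0 p) (m 0) = dChart c (ι p) w :=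
    dChart_congr hmw
  have key := hasDerivAt_contractPullback (Ψ := psiInChart ρ τ c) (hv.contDiffAt hfit)
    (F := graphInChart a c lam ι) (X := fieldInChart a c l n)
    (Filter.Eventually.of_forall fun y' => by simp only [hv.init_fun, hv.init_map])
    (hv.fieldInChart_eq hfit hι.continuousAt)
    (contDiffAt_psiInChart h (by
      rw [graphInChart_chart _ _ hfit.1]; exact (extChartAt (𝓡 6) c).map_source hfit.2)) (fun Y => hsol.contractPullback_eq_zero hfit hlam hι Y) hY
  rw [hmw'] at key
  have key2 : HasDerivAt (fun s => contractPullback (psiInChart ρ τ c)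
      (graphInChart a c (Λ s) (I s) (extChartAt (𝓡 3) a p),
        fderiv ℝ (graphInChart a c (Λ s) (I s)) (extChartAt (𝓡 3) a p),
        (r, dChart c (I s p) (m s))) (fun i => dChart a p (v i)))
      (derivInCharts ρ τ a c lam ι l n p r w v) 0 :=
    (ContinuousAlternatingMap.apply ℝ (EuclideanSpace ℝ (Fin 3)) ℝ
      (fun i => dChart a p (v i))).hasFDerivAt.comp_hasDerivAt (0 : ℝ) key
  refine key2.congr_of_eventuallyEq ?_
  have hk : Filter.Tendsto (fun s : ℝ => (s, p)) (𝓝 0) (𝓝 (0, p)) :=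
    (Continuous.prodMk_left p).tendsto 0
  filter_upwards [hk.eventually hv.smooth_fun, hk.eventually hv.smooth_map,
    (hmap.continuousAt.tendsto.comp hk).eventually
      ((isOpen_extChartAt_source (I := 𝓡 6) c).mem_nhds hIp)] with s h1 h2 h3
  have hs : ContMDiffAt (𝓡 3) (𝓘(ℝ, ℝ).prod (𝓡 3)) ∞ (fun q : P => (s, q)) p :=
    contMDiffAt_const.prodMk contMDiffAt_id
  exact (contractPullback_psiInChart ⟨hfit.1, h3⟩ (h1.comp (x := p) hs) (h2.comp (x := p) hs)
    r (m s) v).symm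

end Derivative

/-! ### Straight line curves in charts -/

section StraightLine

variable {M : Type*} [TopologicalSpace M] [ChartedSpace (EuclideanSpace ℝ (Fin 6)) M]
  {P : Type*} [TopologicalSpace P] [ChartedSpace (EuclideanSpace ℝ (Fin 3)) P]

open Classical in
/-- The curve through `ι` that is a straight line with direction `n` in the chart around `c`, as
far as `ι` lies in this chart and the point in the chart around `a`. -/
def straightLine (a : P) (c : M) (ι : P → M) (n : ∀ p, TangentSpace (𝓡 6) (ι p)) (s : ℝ) (q : P) :
    M :=
  if Fits a c ι q then
    (extChartAt (𝓡 6) c).symm (extChartAt (𝓡 6) c (ι q) + s • dChart c (ι q) (n q))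
  else ι q

variable {a p : P} {c : M} {ι : P → M} {n : ∀ p, TangentSpace (𝓡 6) (ι p)}

lemma straightLine_of_eq_zero {q : P} {s : ℝ} (h : n q = 0 ∨ s = 0) :
    straightLine a c ι n s q = ι q := by
  unfold straightLine
  split_ifs with hq
  · have : s • dChart c (ι q) (n q) = 0 := by rcases h with h | h <;> simp [h]
    rw [this, add_zero, (extChartAt (𝓡 6) c).left_inv hq.2]
  · rfl

variable [IsManifold (𝓡 6) ∞ M]

lemma tv_eq_of_dChart {c x y : M} {u : TangentSpace (𝓡 6) x} {w : TangentSpace (𝓡 6) y}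
    (hx : x ∈ (extChartAt (𝓡 6) c).source) (hxy : x = y) (h : dChart c x u = dChart c y w) :
    tv x u = tv y w := by
  subst hxy
  rw [(dChartEquiv c x hx).injective h]

lemma contMDiffAt_straightLine (hι : ContMDiff (𝓡 3) (𝓡 6) ∞ ι) (hn : IsSmoothField ι n)
    {s : ℝ} {q : P} (hq : Fits a c ι q)
    (hs : extChartAt (𝓡 6) c (ι q) + s • dChart c (ι q) (n q) ∈ (extChartAt (𝓡 6) c).target) :
    ContMDiffAt (𝓘(ℝ, ℝ).prod (𝓡 3)) (𝓡 6) ∞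
      (fun q : ℝ × P => straightLine a c ι n q.1 q.2) (s, q) := by
  have h1 : ContMDiffAt (𝓘(ℝ, ℝ).prod (𝓡 3)) 𝓘(ℝ, EuclideanSpace ℝ (Fin 6)) ∞
      (fun q : ℝ × P => extChartAt (𝓡 6) c (ι q.2) + q.1 • dChart c (ι q.2) (n q.2)) (s, q) := by
    have e1 := contMDiffAt_chart_comp (m := 6) hq.2 (hι q)
    have e2 := ((contMDiffAt_dChart hq.2).1 (hn q)).2
    have e3 : ContMDiffAt (𝓘(ℝ, ℝ).prod (𝓡 3)) 𝓘(ℝ, ℝ) ∞ (Prod.fst : ℝ × P → ℝ) (s, q) :=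
      contMDiffAt_fst
    exact (e1.comp (s, q) contMDiffAt_snd).add (e3.smul (e2.comp (s, q) contMDiffAt_snd))
  have h2 := (contMDiffAt_chart_symm (n := 6) hs).comp (s, q) h1
  refine h2.congr_of_eventuallyEq ?_
  have hk : Filter.Tendsto (Prod.snd : ℝ × P → P) (𝓝 (s, q)) (𝓝 q) := continuous_snd.tendsto (s, q)
  filter_upwards [hk.eventually (hq.eventually hι.continuous.continuousAt)] with z hz
  exact if_pos hz

lemma velocity_straightLine {q : P} (hq : Fits a c ι q) :
    velocity (fun s => straightLine a c ι n s q) 0 = tv (ι q) (n q) := by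
  set e := extChartAt (𝓡 6) c with he
  have h0 : straightLine a c ι n 0 q = ι q := straightLine_of_eq_zero (Or.inr rfl)
  have hline : ∀ s, straightLine a c ι n s q = e.symm (e (ι q) + s • dChart c (ι q) (n q)) :=
    fun s => if_pos hq
  have hd : DifferentiableAt ℝ (fun s : ℝ => e (ι q) + s • dChart c (ι q) (n q)) 0 := by fun_prop
  have hmem : e (ι q) + (0 : ℝ) • dChart c (ι q) (n q) ∈ e.target := by
    simpa using e.map_source hq.2
  have hdiff : MDifferentiableAt 𝓘(ℝ, ℝ) (𝓡 6) (fun s => straightLine a c ι n s q) 0 := by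
    simp only [hline]
    exact MDifferentiableAt.comp (I' := 𝓘(ℝ, EuclideanSpace ℝ (Fin 6))) (0 : ℝ)
      ((contMDiffAt_chart_symm (n := 6) hmem).mdifferentiableAt (by simp))
      (mdifferentiableAt_iff_differentiableAt.2 hd)
  have h1 := dChart_mfderiv_curve (c := c) (γ := fun s => straightLine a c ι n s q) (t := 0)
    (by rw [h0]; exact hq.2) hdiff
  have h2 : deriv (fun s => extChartAt (𝓡 6) c (straightLine a c ι n s q)) 0 =
      dChart c (ι q) (n q) := by
    have hev : (fun s => extChartAt (𝓡 6) c (straightLine a c ι n s q)) =ᶠ[𝓝 0]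
        fun s => e (ι q) + s • dChart c (ι q) (n q) := by
      filter_upwards [hd.continuousAt.eventually_mem
        ((isOpen_extChartAt_target (I := 𝓡 6) c).mem_nhds hmem)] with s hs
      rw [hline, e.right_inv hs]
    rw [hev.deriv_eq]
    have h3 : HasDerivAt (fun s : ℝ => e (ι q) + s • dChart c (ι q) (n q))
        ((1 : ℝ) • dChart c (ι q) (n q)) 0 := ((hasDerivAt_id (0 : ℝ)).smul_const _).const_add _
    rw [h3.deriv, one_smul]
  exact tv_eq_of_dChart (x := straightLine a c ι n 0 q) (by rw [h0]; exact hq.2) h0 (h1.trans h2)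

/-- A test curve for an arbitrary smooth field. It need only be smooth near p, so neither a cut-off
nor an exponential map is needed; this suffices to compare derivatives computed in different charts.
-/
lemma hasVelocityNear_straightLine {lam l : P → ℝ} (hlam : ContMDiff (𝓡 3) 𝓘(ℝ, ℝ) ∞ lam)
    (hl : ContMDiff (𝓡 3) 𝓘(ℝ, ℝ) ∞ l) (hι : ContMDiff (𝓡 3) (𝓡 6) ∞ ι) (hn : IsSmoothField ι n)
    (hp : Fits a c ι p) :
    HasVelocityNear lam ι (fun s q => lam q + s * l q) (straightLine a c ι n) l n p where
  init_fun := by simp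
  init_map := funext fun q => straightLine_of_eq_zero (Or.inr rfl)
  smooth_fun := Filter.Eventually.of_forall fun q =>
    ((hlam _).comp q contMDiffAt_snd).add (contMDiffAt_fst.mul ((hl _).comp q contMDiffAt_snd))
  smooth_map := by
    have h1 : ContMDiffAt (𝓘(ℝ, ℝ).prod (𝓡 3)) 𝓘(ℝ, EuclideanSpace ℝ (Fin 6)) ∞
        (fun q : ℝ × P => extChartAt (𝓡 6) c (ι q.2) + q.1 • dChart c (ι q.2) (n q.2)) (0, p) := by
      have e1 := contMDiffAt_chart_comp (m := 6) hp.2 (hι p)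
      have e2 := ((contMDiffAt_dChart hp.2).1 (hn p)).2
      have e3 : ContMDiffAt (𝓘(ℝ, ℝ).prod (𝓡 3)) 𝓘(ℝ, ℝ) ∞ (Prod.fst : ℝ × P → ℝ) (0, p) :=
        contMDiffAt_fst
      exact (e1.comp ((0 : ℝ), p) contMDiffAt_snd).add
        (e3.smul (e2.comp ((0 : ℝ), p) contMDiffAt_snd))
    have h2 := h1.continuousAt.eventually_mem ((isOpen_extChartAt_target (I := 𝓡 6) c).mem_nhds
      (by simpa using (extChartAt (𝓡 6) c).map_source hp.2))
    have hk : Filter.Tendsto (Prod.snd : ℝ × P → P) (𝓝 (0, p)) (𝓝 p) :=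
      continuous_snd.tendsto ((0 : ℝ), p)
    filter_upwards [h2, hk.eventually (hp.eventually hι.continuous.continuousAt)] with q hq1 hq2
    exact contMDiffAt_straightLine hι hn hq2 hq1
  deriv_fun := Filter.Eventually.of_forall fun q => by
    simpa using ((hasDerivAt_id (0 : ℝ)).mul_const (l q)).const_add (lam q)
  deriv_map := (hp.eventually hι.continuous.continuousAt).mono fun q hq => velocity_straightLine hq

open Classical in
/-- Extension of a tangent vector to a field along a curve that is constant in a chart. -/
lemma exists_smooth_extension_along {γ : ℝ → M} {x : M} (hγ : ContMDiffAt 𝓘(ℝ, ℝ) (𝓡 6) ∞ γ 0)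
    (hx : γ 0 = x) (w : TangentSpace (𝓡 6) x) :
    ∃ m : ∀ s, TangentSpace (𝓡 6) (γ s),
      ContMDiffAt 𝓘(ℝ, ℝ) (𝓡 6).tangent ∞ (fun s => tv (γ s) (m s)) 0 ∧
        tv (γ 0) (m 0) = tv x w := by
  subst hx
  have h0 : γ 0 ∈ (extChartAt (𝓡 6) (γ 0)).source := mem_extChartAt_source _
  let m : ∀ s, TangentSpace (𝓡 6) (γ s) := fun s =>
    if h : γ s ∈ (extChartAt (𝓡 6) (γ 0)).source then
      (dChartEquiv (γ 0) (γ s) h).symm (dChart (γ 0) (γ 0) w) else 0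
  have hm : ∀ s, γ s ∈ (extChartAt (𝓡 6) (γ 0)).source →
      dChart (γ 0) (γ s) (m s) = dChart (γ 0) (γ 0) w := by
    intro s hs
    simp only [m, dif_pos hs]
    exact (dChartEquiv (γ 0) (γ s) hs).apply_symm_apply _
  refine ⟨m, (contMDiffAt_dChart (f := γ) h0).2 ⟨hγ, ?_⟩, ?_⟩
  · refine contMDiffAt_const (c := dChart (γ 0) (γ 0) w) |>.congr_of_eventuallyEq ?_
    filter_upwards [hγ.continuousAt.eventually_mem
      ((isOpen_extChartAt_source (I := 𝓡 6) (γ 0)).mem_nhds h0)] with s hs using hm s hs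
  · exact tv_eq_of_dChart h0 rfl (hm 0 h0)

variable [IsManifold (𝓡 3) ∞ P]

/-- The derivative of the section `L` at a solution does not depend on the charts. -/
lemma derivInCharts_eq {ρ : DForm 6 3 M} {τ : DForm 6 4 M} (h : IsClosedG2Pair34 ρ τ)
    {lam l : P → ℝ} (hlam : ContMDiff (𝓡 3) 𝓘(ℝ, ℝ) ∞ lam) (hι : ContMDiff (𝓡 3) (𝓡 6) ∞ ι)
    (hsol : IsSolution ρ τ lam ι) (hl : ContMDiff (𝓡 3) 𝓘(ℝ, ℝ) ∞ l) (hn : IsSmoothField ι n)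
    {a' : P} {c' : M} (hp : Fits a c ι p) (hp' : Fits a' c' ι p) (r : ℝ)
    (w : TangentSpace (𝓡 6) (ι p)) :
    derivInCharts ρ τ a c lam ι l n p r w = derivInCharts ρ τ a' c' lam ι l n p r w := by
  have hv := hasVelocityNear_straightLine hlam hl hι hn hp
  have hcurve : ContMDiffAt 𝓘(ℝ, ℝ) (𝓡 6) ∞ (fun s => straightLine a c ι n s p) 0 := by
    have hs : ContMDiffAt 𝓘(ℝ, ℝ) (𝓘(ℝ, ℝ).prod (𝓡 3)) ∞ (fun s : ℝ => (s, p)) 0 :=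
      contMDiffAt_id.prodMk contMDiffAt_const
    exact ContMDiffAt.comp (g := fun q : ℝ × P => straightLine a c ι n q.1 q.2)
      (f := fun s : ℝ => (s, p)) (0 : ℝ) hv.smooth_map.self_of_nhds hs
  obtain ⟨m, hm, hmw⟩ := exists_smooth_extension_along hcurve
    (straightLine_of_eq_zero (Or.inr rfl)) w
  ext v
  -- Both sides are the derivative at 0 of the same function of s, since L along the curve is
  -- defined without charts.
  exact (hv.hasDerivAt h hp (hlam p) (hι p) hsol r hm hmw v).unique
    (hv.hasDerivAt h hp' (hlam p) (hι p) hsol r hm hmw v)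

end StraightLine

/-! ### Fields supported in a chart -/

section Supported

variable {M : Type*} [TopologicalSpace M] [ChartedSpace (EuclideanSpace ℝ (Fin 6)) M]
  {P : Type*} [TopologicalSpace P] [ChartedSpace (EuclideanSpace ℝ (Fin 3)) P]
  {ι : P → M}

lemma IsCurve.hasVelocityNear {lam : P → ℝ} {ε : ℝ} {Λ : ℝ → P → ℝ}
    {I : ℝ → P → M} (hc : IsCurve lam ι ε Λ I) {l : P → ℝ} {n : ∀ p, TangentSpace (𝓡 6) (ι p)}
    (hl : ∀ p, HasDerivAt (fun s => Λ s p) (l p) 0)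
    (hn : ∀ p, velocity (fun s => I s p) 0 = tv (ι p) (n p)) (p : P) :
    HasVelocityNear lam ι Λ I l n p := by
  have hopen : IsOpen (Ioo (-ε) ε ×ˢ (univ : Set P)) := isOpen_Ioo.prod isOpen_univ
  have hmem : ((0 : ℝ), p) ∈ Ioo (-ε) ε ×ˢ (univ : Set P) := ⟨by simp [hc.pos], mem_univ p⟩
  exact ⟨hc.init_fun, hc.init_map,
    Filter.mem_of_superset (hopen.mem_nhds hmem)
      fun q hq => hc.smooth_fun.contMDiffAt (hopen.mem_nhds hq),
    Filter.mem_of_superset (hopen.mem_nhds hmem)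
      fun q hq => hc.smooth_map.contMDiffAt (hopen.mem_nhds hq),
    Filter.Eventually.of_forall hl, Filter.Eventually.of_forall hn⟩

variable [IsManifold (𝓡 6) ∞ M] {hι : ContMDiff (𝓡 3) (𝓡 6) ∞ ι} {W : SubFamily ι}

/-- `x` has compact support on which the charts around `a` and `c` can be used. -/
def SupportedIn (a : P) (c : M) (x : Dom ι hι W) : Prop :=
  ∃ K : Set P, IsCompact K ∧ IsClosed K ∧ (∀ q ∈ K, Fits a c ι q) ∧
    ∀ q ∉ K, x.1 q = 0 ∧ x.2.1 q = 0

lemma Dom.mul_add (x : Dom ι hι W) (f g : SFun P) : x.mul (f + g) = x.mul f + x.mul g := by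
  refine Prod.ext (add_mul f g x.1) (Subtype.ext (funext fun p => ?_))
  exact add_smul (f p) (g p) (x.2.1 p)

lemma Dom.mul_one (x : Dom ι hι W) : x.mul 1 = x := by
  refine Prod.ext (one_mul x.1) (Subtype.ext (funext fun p => ?_))
  exact one_smul ℝ (x.2.1 p)

/-- Each field is a sum of fields that are supported in charts. -/
lemma Dom.induction_supported [IsManifold (𝓡 3) ∞ P] [CompactSpace P] [T2Space P]
    (Q : Dom ι hι W → Prop) (hzero : Q 0) (hadd : ∀ x y, Q x → Q y → Q (x + y))
    (hsupp : ∀ a c x, SupportedIn a c x → Q x) (x : Dom ι hι W) : Q x := by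
  classical
  -- The cover is by the sets on which the chart around p and the chart around ι p can be used
  -- simultaneously, so each piece of the field is confined to a chart of P and a chart of M.
  obtain ⟨f, hf⟩ := SmoothPartitionOfUnity.exists_isSubordinate (𝓡 3) (isClosed_univ (X := P))
    (fun p : P => {q | Fits p (ι p) ι q})
    (fun p => isOpen_iff_mem_nhds.2 fun q hq =>
      Fits.eventually hq hι.continuous.continuousAt)
    (fun p _ => mem_iUnion.2 ⟨p, Fits.self ι p⟩)
  have hfin := f.locallyFinite.finite_nonempty_of_compact
  have hsum : ∑ i ∈ hfin.toFinset, f i = 1 := by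
    refine ContMDiffMap.ext fun q => ?_
    have h1 := f.sum_eq_one (mem_univ q)
    rw [finsum_eq_sum_of_support_subset (s := hfin.toFinset)] at h1
    · refine Eq.trans ?_ h1
      exact (congrFun (map_sum (ContMDiffMap.coeFnAddMonoidHom (I := 𝓡 3) (N := P)
        (I' := 𝓘(ℝ, ℝ)) (G := ℝ) (n := ∞)) (fun i => f i) hfin.toFinset) q).trans
        (Finset.sum_apply _ _ _)
    · intro i hi
      exact hfin.mem_toFinset.2 ⟨q, hi⟩
  have hmul : ∀ t : Finset P, Q (x.mul (∑ i ∈ t, f i)) := by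
    intro t
    induction t using Finset.induction_on with
    | empty =>
      have h0 : x.mul (0 : SFun P) = 0 :=
        Prod.ext (zero_mul x.1) (Subtype.ext (funext fun p => zero_smul ℝ (x.2.1 p)))
      rwa [Finset.sum_empty, h0]
    | insert i t hi ih =>
      rw [Finset.sum_insert hi, Dom.mul_add]
      refine hadd _ _ (hsupp i (ι i) _ ⟨tsupport (f i), (isClosed_tsupport _).isCompact,
        isClosed_tsupport _, fun q hq => hf i hq, fun q hq => ?_⟩) ih
      have h0 : f i q = 0 := image_eq_zero_of_notMem_tsupport hq
      constructor
      · change f i q * x.1 q = 0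
        rw [h0, zero_mul]
      · change f i q • x.2.1 q = 0
        rw [h0, zero_smul]
  have := hmul hfin.toFinset
  rwa [hsum, x.mul_one] at this

/-- A field supported in a chart is the velocity of a smooth curve. -/
lemma SupportedIn.exists_curve {a : P} {c : M} {x : Dom ι hι W} (hx : SupportedIn a c x)
    {lam : P → ℝ} (hlam : ContMDiff (𝓡 3) 𝓘(ℝ, ℝ) ∞ lam) :
    ∃ ε Λ I, IsCurve lam ι ε Λ I ∧ (∀ p, HasDerivAt (fun s => Λ s p) (x.1 p) 0) ∧
      ∀ p, velocity (fun s => I s p) 0 = tv (ι p) (x.2.1 p) := by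
  obtain ⟨K, hK, hKc, hfit, hzero⟩ := hx
  have hn := x.2.2.1
  -- Compactness of K provides one time interval on which all the straight lines over K stay in the
  -- chart.
  have hev : ∀ᶠ s in 𝓝 (0 : ℝ), ∀ q ∈ K, extChartAt (𝓡 6) c (ι q) +
      s • dChart c (ι q) (x.2.1 q) ∈ (extChartAt (𝓡 6) c).target := by
    refine hK.eventually_forall_of_forall_eventually fun q hq => ?_
    have hp := hfit q hq
    have e1 := contMDiffAt_chart_comp (m := 6) hp.2 (hι q)
    have e2 := ((contMDiffAt_dChart hp.2).1 (hn q)).2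
    have h1 : ContinuousAt (fun z : ℝ × P => extChartAt (𝓡 6) c (ι z.2) +
        z.1 • dChart c (ι z.2) (x.2.1 z.2)) (0, q) :=
      (e1.continuousAt.comp (x := ((0 : ℝ), q)) continuousAt_snd).add
        (continuousAt_fst.smul (e2.continuousAt.comp (x := ((0 : ℝ), q)) continuousAt_snd))
    exact h1.eventually_mem ((isOpen_extChartAt_target (I := 𝓡 6) c).mem_nhds
      (by simpa using (extChartAt (𝓡 6) c).map_source hp.2))
  obtain ⟨ε, hε, hball⟩ := Metric.eventually_nhds_iff.1 hev
  refine ⟨ε, fun s q => lam q + s * x.1 q, straightLine a c ι x.2.1,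
    ⟨hε, by simp, funext fun q => straightLine_of_eq_zero (Or.inr rfl), ?_, ?_⟩, ?_, ?_⟩
  · exact ((hlam.comp contMDiff_snd).add
      (contMDiff_fst.mul (x.1.contMDiff.comp contMDiff_snd))).contMDiffOn
  · rintro ⟨s, q⟩ ⟨hs, -⟩
    have hs' : dist s 0 < ε := by
      rw [Real.dist_eq, sub_zero]; exact abs_lt.2 hs
    refine ContMDiffAt.contMDiffWithinAt ?_
    by_cases hq : q ∈ K
    · exact contMDiffAt_straightLine hι hn (hfit q hq) (hball hs' q hq)
    -- Off the closed set K the field vanishes, so near such a point the curve is constantly ι,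
    -- whatever the chart does there.
    · refine ((hι q).comp (s, q) contMDiffAt_snd).congr_of_eventuallyEq ?_
      have hk : Filter.Tendsto (Prod.snd : ℝ × P → P) (𝓝 (s, q)) (𝓝 q) :=
        continuous_snd.tendsto (s, q)
      filter_upwards [hk.eventually (hKc.isOpen_compl.mem_nhds hq)] with z hz
      exact straightLine_of_eq_zero (Or.inl (hzero _ hz).2)
  · intro p
    simpa using ((hasDerivAt_id (0 : ℝ)).mul_const (x.1 p)).const_add (lam p)
  · intro p
    by_cases hp : Fits a c ι p
    · exact velocity_straightLine hp
    · have h0 := (hzero p fun h => hp (hfit p h)).2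
      have h1 : (fun s => straightLine a c ι x.2.1 s p) = fun _ => ι p :=
        funext fun s => straightLine_of_eq_zero (Or.inl h0)
      rw [h1, velocity, h0, mfderiv_const]
      rfl

/-- The linearization is unique. -/
lemma IsLinearization.unique [IsManifold (𝓡 3) ∞ P] [CompactSpace P] [T2Space P]
    {ρ : DForm 6 3 M} {τ : DForm 6 4 M} {lam : P → ℝ} (hlam : ContMDiff (𝓡 3) 𝓘(ℝ, ℝ) ∞ lam)
    {D D' : Dom ι hι W →ₗ[ℝ] Cod ι hι W} (h : IsLinearization ρ τ lam D)
    (h' : IsLinearization ρ τ lam D') : D' = D := by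
  refine LinearMap.ext fun x => ?_
  -- An explicit curve is at hand for fields supported in a chart; additivity of both operators
  -- covers the others.
  refine Dom.induction_supported (fun x => D' x = D x) (by simp)
    (fun x y hx hy => by rw [map_add, map_add, hx, hy]) (fun a c x hx => ?_) x
  obtain ⟨ε, Λ, I, hc, hl, hn⟩ := hx.exists_curve hlam
  refine Prod.ext (Subtype.ext (funext fun p => ?_)) (Subtype.ext (funext fun p => ?_))
  · ext v
    exact (h' ε Λ I x hc hl hn p v).1.unique (h ε Λ I x hc hl hn p v).1
  · refine LinearMap.ext fun w => ?_
    ext v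
    have hI : ContMDiffAt 𝓘(ℝ, ℝ) (𝓡 6) ∞ (fun s => I s p) 0 := by
      have hs : ContMDiffAt 𝓘(ℝ, ℝ) (𝓘(ℝ, ℝ).prod (𝓡 3)) ∞ (fun s : ℝ => (s, p)) 0 :=
        contMDiffAt_id.prodMk contMDiffAt_const
      exact ContMDiffAt.comp (g := fun q : ℝ × P => I q.1 q.2)
        (f := fun s : ℝ => (s, p)) (0 : ℝ)
        (hc.hasVelocityNear hl hn p).smooth_map.self_of_nhds hs
    obtain ⟨m, hm, hmw⟩ := exists_smooth_extension_along hI (congrFun hc.init_map p) w.1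
    exact ((h' ε Λ I x hc hl hn p v).2 w m hm hmw).unique
      ((h ε Λ I x hc hl hn p v).2 w m hm hmw)

end Supported

/-! ### The linearized operator -/

section JetMap

variable {E H : Type*} [NormedAddCommGroup E] [NormedSpace ℝ E]
  [NormedAddCommGroup H] [NormedSpace ℝ H]

/-- The linearization of `contractPullback Ψ` as a function of the `1`-jet of the variation. -/
def jetMap {Ψ : H → H [⋀^Fin 4]→L[ℝ] ℝ} {z : H} (hΨ : ContDiffAt ℝ ∞ Ψ z) (A : E →L[ℝ] H) :
    H × (E →L[ℝ] H) →ₗ[ℝ] H →ₗ[ℝ] E [⋀^Fin 3]→L[ℝ] ℝ :=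
  LinearMap.mk₂ ℝ (fun j Y => fderiv ℝ (contractPullback Ψ) (z, A, Y) (j.1, j.2, 0))
    (fun j j' Y => by
      rw [← map_add]
      congr 1
      simp)
    (fun r j Y => by
      rw [← map_smul]
      congr 1
      simp)
    (fun j Y Y' => by
      ext v
      simp only [ContinuousAlternatingMap.add_apply, fderiv_contractPullback_apply hΨ]
      have h : ∀ (α : H [⋀^Fin 4]→L[ℝ] ℝ) a b c, α ![Y + Y', a, b, c] =
          α ![Y, a, b, c] + α ![Y', a, b, c] := fun α a b c => α.vecCons_add _ _ _
      simp only [h]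
      rw [(Ψ z).map_coord_zero (m := ![0, _, _, _]) 0 rfl]
      ring)
    (fun r j Y => by
      ext v
      simp only [ContinuousAlternatingMap.smul_apply, fderiv_contractPullback_apply hΨ]
      have h : ∀ (α : H [⋀^Fin 4]→L[ℝ] ℝ) a b c, α ![r • Y, a, b, c] =
          r • α ![Y, a, b, c] := fun α a b c => α.vecCons_smul _ _ _
      simp only [h]
      rw [(Ψ z).map_coord_zero (m := ![0, _, _, _]) 0 rfl]
      simp only [smul_eq_mul]
      ring)

lemma jetMap_apply {Ψ : H → H [⋀^Fin 4]→L[ℝ] ℝ} {z : H} (hΨ : ContDiffAt ℝ ∞ Ψ z)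
    (A : E →L[ℝ] H) (j : H × (E →L[ℝ] H)) (Y : H) :
    jetMap hΨ A j Y = fderiv ℝ (contractPullback Ψ) (z, A, Y) (j.1, j.2, 0) := rfl

/-- The principal symbol in charts. -/
lemma jetMap_zero_apply {Ψ : H → H [⋀^Fin 4]→L[ℝ] ℝ} {z : H} (hΨ : ContDiffAt ℝ ∞ Ψ z)
    (A : E →L[ℝ] H) (B : E →L[ℝ] H) (Y : H) (v : Fin 3 → E) :
    jetMap hΨ A (0, B) Y v = Ψ z ![Y, B (v 0), A (v 1), A (v 2)]
      + Ψ z ![Y, A (v 0), B (v 1), A (v 2)] + Ψ z ![Y, A (v 0), A (v 1), B (v 2)] := by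
  rw [jetMap_apply, fderiv_contractPullback_apply hΨ, map_zero,
    (Ψ z).map_coord_zero (m := ![0, _, _, _]) 0 rfl, zero_add]
  change (0 : ℝ) + _ = _
  rw [zero_add]

end JetMap

/-! ### Smoothness of the derivative, and jets of fields -/

section Operator

variable {M : Type*} [TopologicalSpace M] [ChartedSpace (EuclideanSpace ℝ (Fin 6)) M]
  {P : Type*} [TopologicalSpace P] [ChartedSpace (EuclideanSpace ℝ (Fin 3)) P]
  [IsManifold (𝓡 6) ∞ M] [IsManifold (𝓡 3) ∞ P]

/-- The derivative of the section `L` at a solution, as a form in a chart. -/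
lemma formInChart_derivInCharts {ρ : DForm 6 3 M} {τ : DForm 6 4 M}
    (h : IsClosedG2Pair34 ρ τ) {ι : P → M}
    {lam l : P → ℝ} (hlam : ContMDiff (𝓡 3) 𝓘(ℝ, ℝ) ∞ lam) (hι : ContMDiff (𝓡 3) (𝓡 6) ∞ ι)
    (hsol : IsSolution ρ τ lam ι) {n : ∀ p, TangentSpace (𝓡 6) (ι p)}
    (hl : ContMDiff (𝓡 3) 𝓘(ℝ, ℝ) ∞ l) (hn : IsSmoothField ι n) {a : P} {c : M}
    {y : EuclideanSpace ℝ (Fin 3)} (hy : y ∈ (extChartAt (𝓡 3) a).target)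
    (hfit : Fits a c ι ((extChartAt (𝓡 3) a).symm y)) (r : P → ℝ)
    (m : ∀ p, TangentSpace (𝓡 6) (ι p)) :
    formInChart a (fun p => derivInCharts ρ τ p (ι p) lam ι l n p (r p) (m p)) y =
      linearize (psiInChart ρ τ c) (graphInChart a c lam ι) (fieldInChart a c l n) y
        (fieldInChart a c r m y) := by
  rw [formInChart, derivInCharts_eq h hlam hι hsol hl hn (Fits.self ι _) hfit]
  ext v
  have h1 : ∀ e, dChart a ((extChartAt (𝓡 3) a).symm y) (dChartInv a y e) = e :=
    dChart_dChartInv hy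
  change linearize _ _ _ (extChartAt (𝓡 3) a ((extChartAt (𝓡 3) a).symm y)) _
    (fun i => dChart a ((extChartAt (𝓡 3) a).symm y) (dChartInv a y (v i))) = _
  simp only [h1]
  rw [(extChartAt (𝓡 3) a).right_inv hy]
  rfl

/-- The derivative of the section `L` at a solution gives smooth forms. -/
lemma derivInCharts_mem_smoothForms {ρ : DForm 6 3 M} {τ : DForm 6 4 M}
    (h : IsClosedG2Pair34 ρ τ) {ι : P → M}
    {lam l : P → ℝ} (hlam : ContMDiff (𝓡 3) 𝓘(ℝ, ℝ) ∞ lam) (hι : ContMDiff (𝓡 3) (𝓡 6) ∞ ι)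
    (hsol : IsSolution ρ τ lam ι) {n : ∀ p, TangentSpace (𝓡 6) (ι p)}
    (hl : ContMDiff (𝓡 3) 𝓘(ℝ, ℝ) ∞ l) (hn : IsSmoothField ι n)
    {r : P → ℝ} {m : ∀ p, TangentSpace (𝓡 6) (ι p)}
    (hr : ContMDiff (𝓡 3) 𝓘(ℝ, ℝ) ∞ r) (hm : IsSmoothField ι m) :
    (fun p => derivInCharts ρ τ p (ι p) lam ι l n p (r p) (m p)) ∈ SmoothForms 3 3 P := by
  intro a y hy
  refine ContDiffAt.contDiffWithinAt ?_
  obtain ⟨p, hp, rfl⟩ : ∃ p ∈ (extChartAt (𝓡 3) a).source, extChartAt (𝓡 3) a p = y :=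
    ⟨_, (extChartAt (𝓡 3) a).map_target hy, (extChartAt (𝓡 3) a).right_inv hy⟩
  have hfit : Fits a (ι p) ι p := ⟨hp, mem_extChartAt_source _⟩
  have key := contDiffAt_linearize (Ψ := psiInChart ρ τ (ι p))
    (F := graphInChart a (ι p) lam ι) (X := fieldInChart a (ι p) l n)
    (Y := fieldInChart a (ι p) r m) (y := extChartAt (𝓡 3) a p)
    (contDiffAt_psiInChart h (by
      rw [graphInChart_chart _ _ hp]; exact (extChartAt (𝓡 6) (ι p)).map_source hfit.2))
    (contDiffAt_graphInChart hfit (hlam p) (hι p)) (contDiffAt_fieldInChart hfit (hl p) (hn p))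
    (contDiffAt_fieldInChart hfit (hr p) (hm p))
  refine key.congr_of_eventuallyEq ?_
  filter_upwards [(tendsto_chart_symm hp).eventually (hfit.eventually hι.continuous.continuousAt),
    (isOpen_extChartAt_target (I := 𝓡 3) a).mem_nhds hy] with y' hy' hyt
  exact formInChart_derivInCharts h hlam hι hsol hl hn hyt hy' r m

variable {ι : P → M} {hι : ContMDiff (𝓡 3) (𝓡 6) ∞ ι} {W : SubFamily ι}

/-- The `1`-jet of a field in charts around `p` and `ι p`. -/
def Dom.jet (x : Dom ι hι W) (p : P) : (ℝ × EuclideanSpace ℝ (Fin 6)) ×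
    (EuclideanSpace ℝ (Fin 3) →L[ℝ] ℝ × EuclideanSpace ℝ (Fin 6)) :=
  (fieldInChart p (ι p) x.1 x.2.1 (extChartAt (𝓡 3) p p),
    fderiv ℝ (fieldInChart p (ι p) x.1 x.2.1) (extChartAt (𝓡 3) p p))

lemma Dom.differentiableAt_fieldInChart (x : Dom ι hι W) (p : P) :
    DifferentiableAt ℝ (fieldInChart p (ι p) x.1 x.2.1) (extChartAt (𝓡 3) p p) :=
  (contDiffAt_fieldInChart (Fits.self ι p) (x.1.contMDiff p) (x.2.2.1 p)).differentiableAt (by simp)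

lemma Dom.jet_add (x y : Dom ι hι W) (p : P) : (x + y).jet p = x.jet p + y.jet p := by
  have h : fieldInChart p (ι p) (x + y).1 (x + y).2.1 =
      fieldInChart p (ι p) x.1 x.2.1 + fieldInChart p (ι p) y.1 y.2.1 :=
    funext fun q => Prod.ext rfl (map_add (dChart (ι p) _) _ _)
  unfold Dom.jet
  rw [h, fderiv_add (x.differentiableAt_fieldInChart p) (y.differentiableAt_fieldInChart p)]
  rfl

lemma Dom.jet_smul (r : ℝ) (x : Dom ι hι W) (p : P) : (r • x).jet p = r • x.jet p := by
  have h : fieldInChart p (ι p) (r • x).1 (r • x).2.1 = r • fieldInChart p (ι p) x.1 x.2.1 :=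
    funext fun q => Prod.ext rfl (map_smul (dChart (ι p) _) _ _)
  unfold Dom.jet
  rw [h, fderiv_const_smul (x.differentiableAt_fieldInChart p)]
  rfl

/-- A covector at `p` in the chart around `p`. -/
def covectorInChart (p : P) (α : TangentSpace (𝓡 3) p →L[ℝ] ℝ) :
    EuclideanSpace ℝ (Fin 3) →L[ℝ] ℝ :=
  LinearMap.toContinuousLinearMap
    (α.toLinearMap ∘ₗ (dChartEquiv p p (mem_extChartAt_source p)).symm.toLinearMap)

lemma covectorInChart_dFun (p : P) (f : SFun P) :
    covectorInChart p (dFun f p) =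
      fderiv ℝ (fun y => f ((extChartAt (𝓡 3) p).symm y)) (extChartAt (𝓡 3) p p) := by
  ext e
  have h := dFun_apply (mem_extChartAt_source p) (f.contMDiff.mdifferentiable (by simp) p)
    ((dChartEquiv p p (mem_extChartAt_source p)).symm e)
  rw [← dChartEquiv_apply _ _ (mem_extChartAt_source p), LinearEquiv.apply_symm_apply] at h
  exact h

/-- The product rule, and the source of both the order and the symbol: multiplication by f changes
the 1-jet by a factor f(p) and by the purely first-order part df ⊗ x. -/
lemma Dom.jet_mul (f : SFun P) (x : Dom ι hι W) (p : P) :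
    (x.mul f).jet p = f p • x.jet p + (0, (covectorInChart p (dFun f p)).smulRight (x.jet p).1) := by
  have h : fieldInChart p (ι p) (x.mul f).1 (x.mul f).2.1 =
      fun y => f ((extChartAt (𝓡 3) p).symm y) • fieldInChart p (ι p) x.1 x.2.1 y :=
    funext fun q => Prod.ext rfl (map_smul (dChart (ι p) _) _ _)
  have hf : DifferentiableAt ℝ (fun y => f ((extChartAt (𝓡 3) p).symm y)) (extChartAt (𝓡 3) p p) :=
    (contDiffAt_comp_chart_symm (mem_extChartAt_source p) (f.contMDiff p)).differentiableAt (by simp)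
  unfold Dom.jet
  rw [h, (hf.hasFDerivAt.fun_smul (x.differentiableAt_fieldInChart p).hasFDerivAt).fderiv,
    covectorInChart_dFun]
  refine Prod.ext ?_ ?_
  · simp
  · simp

end Operator

/-! ### The linearized operator -/

section LinearizedOperator

variable {M : Type*} [TopologicalSpace M] [ChartedSpace (EuclideanSpace ℝ (Fin 6)) M]
  {P : Type*} [TopologicalSpace P] [ChartedSpace (EuclideanSpace ℝ (Fin 3)) P]
  {ρ : DForm 6 3 M} {τ : DForm 6 4 M}

lemma contDiffAt_psiInChart_graph (h : IsClosedG2Pair34 ρ τ) (lam : P → ℝ) (ι : P → M) {a p : P}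
    {c : M} (hfit : Fits a c ι p) :
    ContDiffAt ℝ ∞ (psiInChart ρ τ c) (graphInChart a c lam ι (extChartAt (𝓡 3) a p)) :=
  contDiffAt_psiInChart h (by
    rw [graphInChart_chart _ _ hfit.1]; exact (extChartAt (𝓡 6) c).map_source hfit.2)

variable [IsManifold (𝓡 6) ∞ M]

/-- The linearization at `p` in charts, as a function of the `1`-jet of the variation. -/
def jetForm (h : IsClosedG2Pair34 ρ τ) (lam : P → ℝ) (ι : P → M) (p : P) :
    (ℝ × EuclideanSpace ℝ (Fin 6)) ×
      (EuclideanSpace ℝ (Fin 3) →L[ℝ] ℝ × EuclideanSpace ℝ (Fin 6)) →ₗ[ℝ]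
    (ℝ × EuclideanSpace ℝ (Fin 6)) →ₗ[ℝ] EuclideanSpace ℝ (Fin 3) [⋀^Fin 3]→L[ℝ] ℝ :=
  jetMap (contDiffAt_psiInChart_graph h lam ι (Fits.self ι p))
    (fderiv ℝ (graphInChart p (ι p) lam ι) (extChartAt (𝓡 3) p p))

variable {ι : P → M}

/-- The value at `p` of the linearized operator, as a function of the `1`-jet of the field. -/
def jetToFibF (h : IsClosedG2Pair34 ρ τ) (lam : P → ℝ) (ι : P → M) (W : SubFamily ι) (p : P) :
    (ℝ × EuclideanSpace ℝ (Fin 6)) ×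
      (EuclideanSpace ℝ (Fin 3) →L[ℝ] ℝ × EuclideanSpace ℝ (Fin 6)) →ₗ[ℝ] FibF ι W p where
  toFun j := ((jetForm h lam ι p j (1, 0)).compContinuousLinearMap (dChart p p),
    { toFun := fun w =>
        -- The minus sign undoes the one in r L₁ − L₂(m).
        -(jetForm h lam ι p j (0, dChart (ι p) (ι p) w)).compContinuousLinearMap (dChart p p)
      map_add' := fun w w' => by
        have h1 : ((0 : ℝ), dChart (ι p) (ι p) ((w + w' : W p) : TangentSpace (𝓡 6) (ι p))) =
            (0, dChart (ι p) (ι p) w) + (0, dChart (ι p) (ι p) w') := by simp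
        rw [h1, map_add]
        ext v
        exact neg_add _ _
      map_smul' := fun r w => by
        have h1 : ((0 : ℝ), dChart (ι p) (ι p) ((r • w : W p) : TangentSpace (𝓡 6) (ι p))) =
            r • ((0 : ℝ), dChart (ι p) (ι p) w) := by simp
        rw [h1, map_smul]
        ext v
        exact (mul_neg _ _).symm })
  map_add' j j' := by
    rw [map_add]
    refine Prod.ext rfl (LinearMap.ext fun w => ?_)
    ext v
    exact neg_add _ _
  map_smul' r j := by
    rw [map_smul]
    refine Prod.ext rfl (LinearMap.ext fun w => ?_)
    ext v
    exact (mul_neg _ _).symm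

variable {hι : ContMDiff (𝓡 3) (𝓡 6) ∞ ι} {W : SubFamily ι}

lemma jetToFibF_fst (h : IsClosedG2Pair34 ρ τ) (lam : P → ℝ) (x : Dom ι hι W) (p : P) :
    (jetToFibF h lam ι W p (x.jet p)).1 =
      derivInCharts ρ τ p (ι p) lam ι x.1 x.2.1 p 1 0 := by
  unfold derivInCharts
  rw [map_zero]
  rfl

lemma jetToFibF_snd (h : IsClosedG2Pair34 ρ τ) (lam : P → ℝ) (x : Dom ι hι W) (p : P) (w : W p) :
    (jetToFibF h lam ι W p (x.jet p)).2 w =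
      -derivInCharts ρ τ p (ι p) lam ι x.1 x.2.1 p 0 w := rfl

variable [IsManifold (𝓡 3) ∞ P]

/-- The linearization at a solution of the section `L`. -/
def linearizedOperator (h : IsClosedG2Pair34 ρ τ) {lam : P → ℝ}
    (hlam : ContMDiff (𝓡 3) 𝓘(ℝ, ℝ) ∞ lam) (hsol : IsSolution ρ τ lam ι)
    (hι : ContMDiff (𝓡 3) (𝓡 6) ∞ ι) (W : SubFamily ι) : Dom ι hι W →ₗ[ℝ] Cod ι hι W where
  toFun x := (⟨fun p => (jetToFibF h lam ι W p (x.jet p)).1, by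
      simp only [jetToFibF_fst]
      exact derivInCharts_mem_smoothForms h hlam hι hsol x.1.contMDiff x.2.2.1
        contMDiff_const (Sections ι hι W).zero_mem.1⟩,
    ⟨fun p => (jetToFibF h lam ι W p (x.jet p)).2, fun n => by
      simp only [jetToFibF_snd]
      exact (SmoothForms 3 3 P).neg_mem (derivInCharts_mem_smoothForms h hlam hι hsol
        x.1.contMDiff x.2.2.1 contMDiff_const n.2.1)⟩)
  map_add' x y := by
    refine Prod.ext (Subtype.ext (funext fun p => ?_)) (Subtype.ext (funext fun p => ?_))
    · exact congrArg Prod.fst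
        ((congrArg (jetToFibF h lam ι W p) (x.jet_add y p)).trans (map_add _ _ _))
    · exact congrArg Prod.snd
        ((congrArg (jetToFibF h lam ι W p) (x.jet_add y p)).trans (map_add _ _ _))
  map_smul' r x := by
    refine Prod.ext (Subtype.ext (funext fun p => ?_)) (Subtype.ext (funext fun p => ?_))
    · exact congrArg Prod.fst
        ((congrArg (jetToFibF h lam ι W p) (x.jet_smul r p)).trans (map_smul _ _ _))
    · exact congrArg Prod.snd
        ((congrArg (jetToFibF h lam ι W p) (x.jet_smul r p)).trans (map_smul _ _ _))

variable (h : IsClosedG2Pair34 ρ τ) {lam : P → ℝ}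
    (hlam : ContMDiff (𝓡 3) 𝓘(ℝ, ℝ) ∞ lam) (hsol : IsSolution ρ τ lam ι)

lemma linearizedOperator_at (x : Dom ι hι W) (p : P) :
    (linearizedOperator h hlam hsol hι W x).at p = jetToFibF h lam ι W p (x.jet p) := rfl

/-- The derivative of r L₁ − L₂(m) is known for every r and every m along the curve. Taking r = 1
with m = 0 isolates the first component; taking r = 0 and changing sign gives the second. -/
lemma isLinearization_linearizedOperator :
    IsLinearization ρ τ lam (linearizedOperator h hlam hsol hι W) := by
  intro ε Λ I x hc hl hn p v
  have hv := hc.hasVelocityNear hl hn p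
  have hI : ContMDiffAt 𝓘(ℝ, ℝ) (𝓡 6) ∞ (fun s => I s p) 0 := by
    have hs : ContMDiffAt 𝓘(ℝ, ℝ) (𝓘(ℝ, ℝ).prod (𝓡 3)) ∞ (fun s : ℝ => (s, p)) 0 :=
      contMDiffAt_id.prodMk contMDiffAt_const
    exact ContMDiffAt.comp (g := fun q : ℝ × P => I q.1 q.2)
      (f := fun s : ℝ => (s, p)) (0 : ℝ) hv.smooth_map.self_of_nhds hs
  constructor
  · have h1 := hv.hasDerivAt h (Fits.self ι p) (hlam p) (hι p) hsol 1 (w := 0) (m := fun s => 0)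
      (((Bundle.contMDiff_zeroSection ℝ (TangentSpace (𝓡 6) : M → Type _)) _).comp (0 : ℝ) hI)
      (by rw [hc.init_map]) v
    rw [← jetToFibF_fst h lam x p] at h1
    refine h1.congr_of_eventuallyEq (Filter.Eventually.of_forall fun s => ?_)
    have h2 : L₂ ρ τ (Λ s) (I s) p 0 = 0 := by
      ext u
      simp [L₂, normalPart, wedge1_apply]
    simp [h2]
  · intro w m hm hmw
    have h1 := (hv.hasDerivAt h (Fits.self ι p) (hlam p) (hι p) hsol 0 hm hmw v).neg
    refine h1.congr_of_eventuallyEq (Filter.Eventually.of_forall fun s => ?_)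
    simp

lemma covectorInChart_dFun_mul (f g : SFun P) (p : P) :
    covectorInChart p (dFun (f * g) p) =
      f p • covectorInChart p (dFun g p) + g p • covectorInChart p (dFun f p) := by
  have hd : ∀ f : SFun P, DifferentiableAt ℝ (fun y => f ((extChartAt (𝓡 3) p).symm y))
      (extChartAt (𝓡 3) p p) := fun f =>
    (contDiffAt_comp_chart_symm (mem_extChartAt_source p) (f.contMDiff p)).differentiableAt (by simp)
  rw [covectorInChart_dFun, covectorInChart_dFun, covectorInChart_dFun]
  refine ((hd f).hasFDerivAt.mul (hd g).hasFDerivAt).fderiv.trans ?_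
  simp only [extChartAt_to_inv]

lemma covectorInChart_dFun_sub_const (f : SFun P) (r : ℝ) (p : P) :
    covectorInChart p (dFun (f - ContMDiffMap.const r : SFun P) p) =
      covectorInChart p (dFun f p) := by
  rw [covectorInChart_dFun, covectorInChart_dFun]
  exact fderiv_sub_const (f := fun y => f ((extChartAt (𝓡 3) p).symm y)) r

/-- The value at p is linear in the 1-jet. In the double commutator the zeroth-order parts cancel,
and the first-order parts do so by d(fg) = f dg + g df. -/
lemma isFirstOrder_linearizedOperator :
    IsFirstOrder (linearizedOperator h hlam hsol hι W) := by
  intro f g x p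
  simp only [linearizedOperator_at, Dom.jet_mul]
  have hS : ∀ (r s : ℝ) (β γ : EuclideanSpace ℝ (Fin 3) →L[ℝ] ℝ) (X : ℝ × EuclideanSpace ℝ (Fin 6)),
      ((0 : ℝ × EuclideanSpace ℝ (Fin 6)), (r • β + s • γ).smulRight X) =
        r • (0, β.smulRight X) + s • (0, γ.smulRight X) := by
    intro r s β γ X
    refine Prod.ext (by simp) ?_
    ext1 e
    simp [add_smul, mul_smul]
  have hfg : (f * g) p = f p * g p := rfl
  have hm := covectorInChart_dFun_mul f g p
  rw [hfg, show dFun (⇑(f * g)) p = dFun (f * g : SFun P) p from rfl, hm, hS]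
  simp only [map_add, map_smul]
  module

/-- The factor f − f(p) vanishes at p, so only the part df ⊗ x of the jet is left. This is the
symbol at df. -/
lemma linearizedOperator_mul_sub (p : P) (f : SFun P) (x : Dom ι hι W) :
    (linearizedOperator h hlam hsol hι W (x.mul (f - ContMDiffMap.const (f p)))).at p =
      jetToFibF h lam ι W p (0, (covectorInChart p (dFun f p)).smulRight (x.jet p).1) := by
  have h0 : (f - ContMDiffMap.const (f p) : SFun P) p = 0 := sub_self (f p)
  rw [linearizedOperator_at, Dom.jet_mul, h0, zero_smul ℝ (x.jet p), zero_add,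
    covectorInChart_dFun_sub_const]

end LinearizedOperator

/-! ### Ellipticity -/

section Immersion

variable {n m : ℕ} {X Z : Type*} [TopologicalSpace X] [ChartedSpace (EuclideanSpace ℝ (Fin n)) X]
  [TopologicalSpace Z] [ChartedSpace (EuclideanSpace ℝ (Fin m)) Z]

/-- The differential of an immersion is injective. -/
lemma mfderiv_injective_of_isImmersion {f : X → Z} (hf : Manifold.IsImmersion (𝓡 n) (𝓡 m) ∞ f)
    (x : X) : Function.Injective (mfderiv (𝓡 n) (𝓡 m) f x) := by
  have h := hf.isImmersionOfComplement_complement x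
  set φ := h.domChart
  set ψ := h.codChart
  -- In the normal form of an immersion, f is u ↦ (u, 0). Projecting to the first factor yields a
  -- smooth local left inverse g of f, and the chain rule for g ∘ f = id gives injectivity.
  let g : Z → X := fun z => (φ.extend (𝓡 n)).symm (h.equiv.symm (ψ.extend (𝓡 m) z)).1
  have hw : ∀ q ∈ φ.source, h.equiv.symm (ψ.extend (𝓡 m) (f q)) = (φ.extend (𝓡 n) q, 0) := by
    intro q hq
    have hq' : q ∈ (φ.extend (𝓡 n)).source := by rwa [φ.extend_source]
    have h1 := h.writtenInCharts ((φ.extend (𝓡 n)).map_source hq')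
    simp only [Function.comp_apply] at h1
    rw [(φ.extend (𝓡 n)).left_inv hq'] at h1
    rw [h1, h.equiv.symm_apply_apply]
  have hgf : g ∘ f =ᶠ[𝓝 x] id := by
    filter_upwards [φ.open_source.mem_nhds h.mem_domChart_source] with q hq
    have hq' : q ∈ (φ.extend (𝓡 n)).source := by rwa [φ.extend_source]
    simp only [g, Function.comp_apply, hw q hq, id]
    exact (φ.extend (𝓡 n)).left_inv hq'
  have hg : MDifferentiableAt (𝓡 m) (𝓡 n) g (f x) := by
    have h1 : ContMDiffAt (𝓡 m) 𝓘(ℝ, EuclideanSpace ℝ (Fin m)) ∞ (ψ.extend (𝓡 m)) (f x) :=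
      ψ.contMDiffAt_extend h.codChart_mem_maximalAtlas h.mem_codChart_source
    have h2 : ContMDiffAt 𝓘(ℝ, EuclideanSpace ℝ (Fin m)) 𝓘(ℝ, EuclideanSpace ℝ (Fin n)) ∞
        (fun e => (h.equiv.symm e).1) (ψ.extend (𝓡 m) (f x)) :=
      (ContinuousLinearMap.contDiff ((ContinuousLinearMap.fst ℝ _ _).comp
        h.equiv.symm.toContinuousLinearMap)).contMDiff _
    have h3 : ContMDiffAt 𝓘(ℝ, EuclideanSpace ℝ (Fin n)) (𝓡 n) ∞ (φ.extend (𝓡 n)).symm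
        ((h.equiv.symm (ψ.extend (𝓡 m) (f x))).1) := by
      rw [hw x h.mem_domChart_source]
      refine (contMDiffOn_extend_symm h.domChart_mem_maximalAtlas).contMDiffAt ?_
      rw [← φ.extend_target']
      exact φ.isOpen_extend_target.mem_nhds ((φ.extend (𝓡 n)).map_source
        (by rw [φ.extend_source]; exact h.mem_domChart_source))
    exact (h3.comp (f x) (h2.comp (f x) h1)).mdifferentiableAt (by simp)
  have hfd : MDifferentiableAt (𝓡 n) (𝓡 m) f x := hf.contMDiff.mdifferentiableAt (by simp)
  have hc := mfderiv_comp x hg hfd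
  rw [hgf.mfderiv_eq, mfderiv_id] at hc
  intro u v huv
  have h1 := congrArg (fun L => L u) hc
  have h2 := congrArg (fun L => L v) hc
  exact h1.trans ((congrArg (mfderiv (𝓡 m) (𝓡 n) g (f x)) huv).trans h2.symm)

end Immersion

/-! ### Injectivity and bijectivity of the principal symbol -/

section Elliptic

/-- Rank and nullity: the kernel of β is a plane, and a vector outside it, normalized to β = 1,
completes a basis of the plane. On such a basis the covector enters the symbol only through its
first vector. -/
lemma exists_adapted_triple {β : EuclideanSpace ℝ (Fin 3) →L[ℝ] ℝ} (hβ : β ≠ 0) :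
    ∃ u₀ u₁ u₂ : EuclideanSpace ℝ (Fin 3), β u₀ = 1 ∧ β u₁ = 0 ∧ β u₂ = 0 ∧
      ∀ r s t : ℝ, r • u₀ + s • u₁ + t • u₂ = 0 → r = 0 ∧ s = 0 ∧ t = 0 := by
  obtain ⟨v, hv⟩ : ∃ v, β v ≠ 0 := by
    by_contra! hcon
    exact hβ (ContinuousLinearMap.ext hcon)
  have hker : Module.finrank ℝ (LinearMap.ker β.toLinearMap) = 2 := by
    have h1 := LinearMap.finrank_range_add_finrank_ker β.toLinearMap
    have h2 : LinearMap.range β.toLinearMap = ⊤ := LinearMap.range_eq_top.2 fun r =>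
      ⟨(r / β v) • v, by simp [hv]⟩
    rw [h2, finrank_top, Module.finrank_self, finrank_euclideanSpace, Fintype.card_fin] at h1
    omega
  have hb := (Module.finBasisOfFinrankEq ℝ _ hker).linearIndependent
  set b := Module.finBasisOfFinrankEq ℝ _ hker
  have hb0 : β (b 0) = 0 := (b 0).2
  have hb1 : β (b 1) = 0 := (b 1).2
  refine ⟨(β v)⁻¹ • v, b 0, b 1, by simp [hv], hb0, hb1, fun r s t h => ?_⟩
  have h1 : r = 0 := by
    have := congrArg β h
    simpa [hb0, hb1, hv] using this
  subst h1
  rw [zero_smul, zero_add] at h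
  have h2 : s • b 0 + t • b 1 = 0 := Subtype.ext h
  have h3 := (LinearIndependent.pair_iff.1 (by
    convert hb using 1
    ext i; fin_cases i <;> rfl : LinearIndependent ℝ ![b 0, b 1])) s t h2
  exact ⟨rfl, h3⟩

/-- A nonzero `3`-form on a `3`-dimensional space does not vanish on a frame. -/
lemma eq_zero_of_apply_frame_eq_zero {V : Type*} [AddCommGroup V] [Module ℝ V]
    (hV : Module.finrank ℝ V = 3) (f : V [⋀^Fin 3]→ₗ[ℝ] ℝ) {b : Fin 3 → V}
    (hb : LinearIndependent ℝ b) (h : f b = 0) : f = 0 := by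
  let B := basisOfLinearIndependentOfCardEqFinrank hb (by simp [hV])
  have hB : ⇑B = b := coe_basisOfLinearIndependentOfCardEqFinrank _ _
  rw [f.eq_smul_basis_det B, hB, h, zero_smul]

variable {M : Type*} [TopologicalSpace M] [ChartedSpace (EuclideanSpace ℝ (Fin 6)) M]
  {P : Type*} [TopologicalSpace P] [ChartedSpace (EuclideanSpace ℝ (Fin 3)) P]
  {ρ : DForm 6 3 M} {τ : DForm 6 4 M} [IsManifold (𝓡 6) ∞ M] [IsManifold (𝓡 3) ∞ P]
  {ι : P → M} {W : SubFamily ι}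

/-- An element of `ℝ × W_p` in charts. -/
def FibE.inChart (p : P) : FibE ι W p →ₗ[ℝ] ℝ × EuclideanSpace ℝ (Fin 6) :=
  LinearMap.prodMap LinearMap.id ((dChart (ι p) (ι p)).toLinearMap ∘ₗ (W p).subtype)

/-- The principal symbol of the linearized operator. -/
def linearizedSymbol (h : IsClosedG2Pair34 ρ τ) (lam : P → ℝ) (W : SubFamily ι) (p : P)
    (α : TangentSpace (𝓡 3) p →L[ℝ] ℝ) : FibE ι W p →ₗ[ℝ] FibF ι W p where
  toFun e := jetToFibF h lam ι W p (0, (covectorInChart p α).smulRight (FibE.inChart p e))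
  map_add' e e' := by
    rw [← map_add]
    congr 1
    refine Prod.ext (by simp) ?_
    ext1 v
    simp
  map_smul' r e := by
    rw [← map_smul]
    congr 1
    refine Prod.ext (by simp) ?_
    ext1 v
    rw [map_smul]
    exact smul_comm (covectorInChart p α v) r (FibE.inChart p e)

lemma isPrincipalSymbol_linearizedSymbol (h : IsClosedG2Pair34 ρ τ) {lam : P → ℝ}
    (hlam : ContMDiff (𝓡 3) 𝓘(ℝ, ℝ) ∞ lam) (hsol : IsSolution ρ τ lam ι)
    {hι : ContMDiff (𝓡 3) (𝓡 6) ∞ ι} :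
    IsPrincipalSymbol (linearizedOperator h hlam hsol hι W) (linearizedSymbol h lam W) := by
  intro p f x
  rw [linearizedOperator_mul_sub]
  have h1 : (x.jet p).1 = FibE.inChart p (x.at p) := fieldInChart_chart _ _ (mem_extChartAt_source p)
  rw [h1]
  rfl

/-- The symbol is injective, since an associative plane is determined by two vectors in it. -/
lemma linearizedSymbol_injective (h : IsClosedG2Pair34 ρ τ) {lam : P → ℝ}
    (hlam : ContMDiff (𝓡 3) 𝓘(ℝ, ℝ) ∞ lam) (hsol : IsSolution ρ τ lam ι)
    (hι : ContMDiff (𝓡 3) (𝓡 6) ∞ ι) {p : P}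
    (hinj : Function.Injective (mfderiv (𝓡 3) (𝓡 6) ι p)) (hW : IsCompl (W p) (tangentFamily ι p))
    {α : TangentSpace (𝓡 3) p →L[ℝ] ℝ} (hα : α ≠ 0) :
    Function.Injective (linearizedSymbol h lam W p α) := by
  refine (injective_iff_map_eq_zero _).2 fun e he => ?_
  have hfit := Fits.self ι p
  set β := covectorInChart p α with hβdef
  have hβ : β ≠ 0 := by
    intro h0
    refine hα (ContinuousLinearMap.ext fun v => ?_)
    have h1 := congrArg (fun L => L (dChartEquiv p p (mem_extChartAt_source p) v)) h0
    change α ((dChartEquiv p p _).symm (dChartEquiv p p _ v)) = 0 at h1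
    rwa [LinearEquiv.symm_apply_apply] at h1
  obtain ⟨u₀, u₁, u₂, h0, h1, h2, hind⟩ := exists_adapted_triple hβ
  set Ψ := psiInChart ρ τ (ι p) (graphInChart p (ι p) lam ι (extChartAt (𝓡 3) p p)) with hΨ
  set A := fderiv ℝ (graphInChart p (ι p) lam ι) (extChartAt (𝓡 3) p p) with hA
  set X := FibE.inChart p e with hX
  have hsolA : ∀ Y v₀ v₁ v₂, Ψ ![Y, A v₀, A v₁, A v₂] = 0 := by
    intro Y v₀ v₁ v₂
    have h3 := congrArg (fun f => f ![v₀, v₁, v₂])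
      (hsol.contractPullback_eq_zero hfit (hlam p) (hι p) Y)
    simp only [contractPullback_apply] at h3
    exact h3
  have hAd : ∀ v : TangentSpace (𝓡 3) p, A (dChart p p v) =
      (dFun lam p v, dChart (ι p) (ι p) (mfderiv (𝓡 3) (𝓡 6) ι p v)) := fun v =>
    fderiv_graphInChart_dChart hfit (hlam p) (hι p) v
  -- Of the three terms of the symbol, those that put β(u₁) X or β(u₂) X into a slot vanish.
  have hform : ∀ Y, jetForm h lam ι p (0, β.smulRight X) Y ![u₀, u₁, u₂] =
      Ψ ![Y, X, A u₁, A u₂] := by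
    intro Y
    have h3 := jetMap_zero_apply (contDiffAt_psiInChart_graph h lam ι (Fits.self ι p)) A
      (β.smulRight X) Y ![u₀, u₁, u₂]
    simp only [Matrix.cons_val_zero, Matrix.cons_val_one, Matrix.cons_val,
      ContinuousLinearMap.smulRight_apply, h0, h1, h2, one_smul, zero_smul] at h3
    refine h3.trans ?_
    rw [Ψ.map_coord_zero (m := ![Y, A u₀, 0, A u₂]) 2 rfl,
      Ψ.map_coord_zero (m := ![Y, A u₀, A u₁, 0]) 3 rfl, add_zero, add_zero]
  have hpull : ∀ f : EuclideanSpace ℝ (Fin 3) [⋀^Fin 3]→L[ℝ] ℝ,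
      f.compContinuousLinearMap (dChart p p) = 0 → f ![u₀, u₁, u₂] = 0 := by
    intro f hf
    have h3 := congrArg (fun f => f fun i => (dChartEquiv p p (mem_extChartAt_source p)).symm
      (![u₀, u₁, u₂] i)) hf
    change f (fun i => dChartEquiv p p (mem_extChartAt_source p)
      ((dChartEquiv p p (mem_extChartAt_source p)).symm (![u₀, u₁, u₂] i))) = 0 at h3
    simpa only [LinearEquiv.apply_symm_apply] using h3
  have hT : Ψ ![(1, 0), X, A u₁, A u₂] = 0 := by
    rw [← hform]
    exact hpull _ (congrArg Prod.fst he)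
  have hN : ∀ w : W p, Ψ ![(0, dChart (ι p) (ι p) w), X, A u₁, A u₂] = 0 := by
    intro w
    rw [← hform]
    refine hpull _ (neg_eq_zero.1 ?_)
    exact LinearMap.congr_fun (congrArg Prod.snd he) w
  -- After an exchange of the first two slots, three arguments are tangent to F, and F is a
  -- solution.
  have hAv : ∀ v, Ψ ![A v, X, A u₁, A u₂] = 0 := fun v => by
    rw [map_swap01, hsolA, neg_zero]
  have hadd : ∀ Y Y', Ψ ![Y + Y', X, A u₁, A u₂] = Ψ ![Y, X, A u₁, A u₂] + Ψ ![Y', X, A u₁, A u₂] :=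
    fun Y Y' => Ψ.vecCons_add _ _ _
  have hsmul : ∀ (r : ℝ) Y, Ψ ![r • Y, X, A u₁, A u₂] = r • Ψ ![Y, X, A u₁, A u₂] :=
    fun r Y => Ψ.vecCons_smul _ _ _
  -- The line ℝ × 0, the space 0 × W and the image of A together span, because W is a complement of
  -- ι_*TP. The A-summand may have a t-component dλ(v), which is compensated in the coefficient of
  -- (1, 0).
  have hall : ∀ Y, Ψ ![Y, X, A u₁, A u₂] = 0 := by
    rintro ⟨t, y⟩
    have hm := (Submodule.mem_sup.1 (hW.sup_eq_top ▸ Submodule.mem_top :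
      (dChartEquiv (ι p) (ι p) hfit.2).symm y ∈ W p ⊔ tangentFamily ι p))
    obtain ⟨w, hw, _, ⟨v, rfl⟩, hwv⟩ := hm
    have hy : y = dChart (ι p) (ι p) w +
        dChart (ι p) (ι p) (mfderiv (𝓡 3) (𝓡 6) ι p v) := by
      rw [← map_add]
      exact ((LinearEquiv.eq_symm_apply _).1 hwv).symm
    have hty : ((t, y) : ℝ × EuclideanSpace ℝ (Fin 6)) =
        (t - dFun lam p v) • (1, 0) + (0, dChart (ι p) (ι p) w) + A (dChart p p v) := by
      rw [hAd, hy]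
      refine Prod.ext (by simp) (by simp)
    rw [hty, hadd, hadd, hsmul, hT, hN ⟨w, hw⟩, hAv]
    simp
  obtain ⟨F, hF⟩ := h.stable (ι p)
  let G : (ℝ × EuclideanSpace ℝ (Fin 6)) ≃ₗ[ℝ] EuclideanSpace ℝ (Fin 7) :=
    ((LinearEquiv.refl ℝ ℝ).prodCongr (dChartEquiv (ι p) (ι p) hfit.2).symm).trans F
  have hG : ∀ w, Ψ w = psi0 fun i => G (w i) := by
    intro w
    have h3 := psiInChart_apply (ρ := ρ) (τ := τ) hfit.2 (lam p)
      (fun i => ((w i).1, (dChartEquiv (ι p) (ι p) hfit.2).symm (w i).2))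
    rw [hF] at h3
    simp only [← dChartEquiv_apply _ _ hfit.2, LinearEquiv.apply_symm_apply] at h3
    rw [hΨ, graphInChart_chart _ _ hfit.1]
    exact h3
  have hAinj : ∀ u, A u = 0 → u = 0 := by
    intro u hu
    have h3 := hAd ((dChartEquiv p p hfit.1).symm u)
    rw [← dChartEquiv_apply _ _ hfit.1, LinearEquiv.apply_symm_apply, hu] at h3
    have h4 : dChartEquiv (ι p) (ι p) hfit.2 (mfderiv (𝓡 3) (𝓡 6) ι p
      ((dChartEquiv p p hfit.1).symm u)) = 0 := (congrArg Prod.snd h3).symm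
    rw [LinearEquiv.map_eq_zero_iff] at h4
    have h5 := hinj (h4.trans (map_zero _).symm)
    rwa [LinearEquiv.map_eq_zero_iff] at h5
  have hperm : ∀ a b c y, Ψ ![b, c, a, y] = -Ψ ![y, a, b, c] := by
    intro a b c y
    rw [map_swap23, map_swap12, map_swap01, map_swap23, map_swap12]
    simp
  -- Here the G₂-structure enters: the image of A is an associative plane and X annihilates two of
  -- its vectors in Ψ, so X lies in that plane.
  obtain ⟨r, s, t, hrst⟩ := mem_span_of_associative G hG (a := A u₀) (b := A u₁) (c := A u₂)
    (x := X) (fun r s t hrst => hind r s t (hAinj _ (by simpa using hrst)))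
    (fun y => by rw [hperm, hsolA, neg_zero]) (fun y => by rw [hperm, hall, neg_zero])
  have hXA : X = A (r • u₀ + s • u₁ + t • u₂) := by simp [hrst]
  set v := (dChartEquiv p p hfit.1).symm (r • u₀ + s • u₁ + t • u₂) with hv
  have hXv : X = (dFun lam p v, dChart (ι p) (ι p) (mfderiv (𝓡 3) (𝓡 6) ι p v)) := by
    rw [← hAd, hXA, hv, ← dChartEquiv_apply _ _ hfit.1, LinearEquiv.apply_symm_apply]
  -- X is now tangent to F, say X = (dλ(v), ι_*v). Its second component lies in W and in ι_*TP, so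
  -- ι_*v = 0, then v = 0 by injectivity, and finally the first component dλ(v) vanishes.
  have hev : (e.2 : TangentSpace (𝓡 6) (ι p)) = mfderiv (𝓡 3) (𝓡 6) ι p v :=
    (dChartEquiv (ι p) (ι p) hfit.2).injective (congrArg Prod.snd hXv)
  have he2 : (e.2 : TangentSpace (𝓡 6) (ι p)) = 0 :=
    Submodule.disjoint_def.1 hW.disjoint _ e.2.2 ⟨v, hev.symm⟩
  have hv0 : v = 0 := hinj ((hev.symm.trans he2).trans (map_zero _).symm)
  have he1 : e.1 = 0 := by
    have := congrArg Prod.fst hXv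
    rw [hv0, map_zero] at this
    exact this
  exact Prod.ext he1 (Subtype.ext he2)

lemma isElliptic_linearizedOperator (h : IsClosedG2Pair34 ρ τ) {lam : P → ℝ}
    (hlam : ContMDiff (𝓡 3) 𝓘(ℝ, ℝ) ∞ lam) (hsol : IsSolution ρ τ lam ι)
    (hι : ContMDiff (𝓡 3) (𝓡 6) ∞ ι) (hinj : ∀ p, Function.Injective (mfderiv (𝓡 3) (𝓡 6) ι p))
    (hW : ∀ p, IsCompl (W p) (tangentFamily ι p)) :
    IsElliptic (linearizedOperator h hlam hsol hι W) := by
  refine ⟨_, isPrincipalSymbol_linearizedSymbol h hlam hsol, fun p α hα => ?_⟩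
  have hσ := linearizedSymbol_injective h hlam hsol hι (hinj p) (hW p) hα
  refine ⟨hσ, fun f => ?_⟩
  have hT : Module.finrank ℝ (TangentSpace (𝓡 3) p) = 3 :=
    finrank_euclideanSpace.trans (Fintype.card_fin 3)
  have : FiniteDimensional ℝ (TangentSpace (𝓡 3) p) :=
    inferInstanceAs (FiniteDimensional ℝ (EuclideanSpace ℝ (Fin 3)))
  have : FiniteDimensional ℝ (TangentSpace (𝓡 6) (ι p)) :=
    inferInstanceAs (FiniteDimensional ℝ (EuclideanSpace ℝ (Fin 6)))
  let b := Module.finBasisOfFinrankEq ℝ (TangentSpace (𝓡 3) p) hT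
  let ev : (TangentSpace (𝓡 3) p [⋀^Fin 3]→L[ℝ] ℝ) →ₗ[ℝ] ℝ :=
    { toFun := fun f => f b, map_add' := fun _ _ => rfl, map_smul' := fun _ _ => rfl }
  have hev : ∀ f, ev f = 0 → f = 0 := fun f hf => by
    have := eq_zero_of_apply_frame_eq_zero hT f.toAlternatingMap b.linearIndependent hf
    ext v
    exact congrArg (fun g => g v) this
  -- Evaluation on a frame identifies 3-forms on T_pP with numbers. This embeds the target fibre
  -- into ℝ × W_p^*, which has the dimension of ℝ × W_p; so the composite with the injective symbol
  -- is onto, and injectivity of Φ makes the symbol itself onto.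
  let Φ : FibF ι W p →ₗ[ℝ] ℝ × (W p →ₗ[ℝ] ℝ) := LinearMap.prodMap ev (LinearMap.compRight ℝ ev)
  have hΦ : Function.Injective Φ := by
    refine (injective_iff_map_eq_zero _).2 fun f hf => ?_
    refine Prod.ext (hev _ (congrArg Prod.fst hf)) (LinearMap.ext fun w => hev _ ?_)
    exact LinearMap.congr_fun (congrArg Prod.snd hf) w
  have hsurj : Function.Surjective (Φ ∘ₗ linearizedSymbol h lam W p α) := by
    refine (LinearMap.injective_iff_surjective_of_finrank_eq_finrank ?_).1 (hΦ.comp hσ)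
    rw [Module.finrank_prod, Module.finrank_prod, Module.finrank_linearMap_self]
  obtain ⟨e, he⟩ := hsurj (Φ f)
  exact ⟨e, hΦ he⟩

end Elliptic

/-! ### Integration of `3`-forms -/

section Stokes

/-- Integration by parts against the constant function 1; compact support supplies the
integrability. -/
lemma integral_fderiv_apply_eq_zero {E : Type*} [NormedAddCommGroup E] [NormedSpace ℝ E]
    [FiniteDimensional ℝ E] [MeasurableSpace E] [BorelSpace E] {μ : MeasureTheory.Measure E}
    [μ.IsAddHaarMeasure] {f : E → ℝ} (hf : ContDiff ℝ 1 f) (hc : HasCompactSupport f) (v : E) :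
    ∫ x, fderiv ℝ f x v ∂μ = 0 := by
  have h := integral_mul_fderiv_eq_neg_fderiv_mul_of_integrable (μ := μ) (f := fun _ => (1 : ℝ))
    (g := f) (v := v) (by simp)
    (by
      simp only [one_mul]
      exact ((hf.continuous_fderiv (by simp)).clm_apply continuous_const).integrable_of_hasCompactSupport
        (hc.fderiv_apply ℝ v))
    (by simpa using hf.continuous.integrable_of_hasCompactSupport hc)
    (fun x _ => differentiableAt_const _) (fun x _ => (hf.differentiable (by simp)) x)
  simpa using h

/-- Stokes' theorem for compactly supported forms on a vector space. -/
lemma integral_extDeriv_eq_zero {E : Type*} [NormedAddCommGroup E] [NormedSpace ℝ E]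
    [FiniteDimensional ℝ E] [MeasurableSpace E] [BorelSpace E] {μ : MeasureTheory.Measure E}
    [μ.IsAddHaarMeasure] {n : ℕ} {γ : E → E [⋀^Fin n]→L[ℝ] ℝ} (hγ : ContDiff ℝ 1 γ)
    (hc : HasCompactSupport γ) (v : Fin (n + 1) → E) : ∫ x, extDeriv γ x v ∂μ = 0 := by
  have hd : ∀ i : Fin (n + 1), ContDiff ℝ 1 fun x => γ x (i.removeNth v) := fun i =>
    (ContinuousAlternatingMap.apply ℝ E ℝ (i.removeNth v)).contDiff.comp hγ
  have hs : ∀ i : Fin (n + 1), HasCompactSupport fun x => γ x (i.removeNth v) := fun i =>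
    hc.comp_left (g := fun f : E [⋀^Fin n]→L[ℝ] ℝ => f (i.removeNth v)) rfl
  have h1 : ∀ x, extDeriv γ x v =
      ∑ i : Fin (n + 1), (-1 : ℝ) ^ (i : ℕ) * fderiv ℝ (fun x => γ x (i.removeNth v)) x (v i) :=
    fun x => (extDeriv_apply (hγ.differentiable (by simp) x) v).trans
      (Finset.sum_congr rfl fun i _ => by simp)
  simp only [h1]
  rw [MeasureTheory.integral_finsetSum]
  · refine Finset.sum_eq_zero fun i _ => ?_
    rw [MeasureTheory.integral_const_mul, integral_fderiv_apply_eq_zero (hd i) (hs i), mul_zero]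
  · intro i _
    exact ((((hd i).continuous_fderiv (by simp)).clm_apply
      continuous_const).integrable_of_hasCompactSupport ((hs i).fderiv_apply ℝ _)).const_mul _

end Stokes

/-! ### Coefficients of 3-forms and change of charts in integrals -/

section Charts

variable {P : Type*} [TopologicalSpace P] [ChartedSpace (EuclideanSpace ℝ (Fin 3)) P]

lemma coeff_eq_zero {c : P} {μ : DForm 3 3 P} {y : EuclideanSpace ℝ (Fin 3)}
    (h : μ ((extChartAt (𝓡 3) c).symm y) = 0) : coeff c μ y = 0 := by
  rw [coeff, formInChart, h]
  rfl

lemma continuousOn_coeff {c : P} {μ : DForm 3 3 P} (h : IsSmoothForm μ) :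
    ContinuousOn (coeff c μ) (extChartAt (𝓡 3) c).target :=
  (ContinuousAlternatingMap.apply ℝ (EuclideanSpace ℝ (Fin 3)) ℝ _).continuous.comp_continuousOn
    (h c).continuousOn

/-- A continuous function on an open set with compact support is integrable. -/
lemma integrableOn_of_eq_zero_off_compact {f : EuclideanSpace ℝ (Fin 3) → ℝ}
    {U K : Set (EuclideanSpace ℝ (Fin 3))} (hU : MeasurableSet U) (hf : ContinuousOn f U)
    (hK : IsCompact K) (hKU : K ⊆ U) (h0 : ∀ y ∈ U, y ∉ K → f y = 0) :
    MeasureTheory.IntegrableOn f U := by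
  have h1 : MeasureTheory.IntegrableOn f K := (hf.mono hKU).integrableOn_compact hK
  exact h1.of_forall_sdiff_eq_zero hU fun y hy => h0 y hy.1 hy.2

variable [IsManifold (𝓡 3) ∞ P]

/-- A 3-form on a three-dimensional space is determined by its value on one frame, and the chart
differential is an isomorphism. For an orientation form this makes the sign of the coefficient
locally constant. -/
lemma coeff_ne_zero {c : P} {μ : DForm 3 3 P} {y : EuclideanSpace ℝ (Fin 3)}
    (hy : y ∈ (extChartAt (𝓡 3) c).target) (h : μ ((extChartAt (𝓡 3) c).symm y) ≠ 0) :
    coeff c μ y ≠ 0 := by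
  intro h0
  have hb := (EuclideanSpace.basisFun (Fin 3) ℝ).toBasis.linearIndependent
  have hbb : ⇑(EuclideanSpace.basisFun (Fin 3) ℝ).toBasis = fun i => EuclideanSpace.single i 1 := by
    ext i j; simp
  rw [hbb] at hb
  have h1 := eq_zero_of_apply_frame_eq_zero (finrank_euclideanSpace.trans (Fintype.card_fin 3))
    (formInChart c μ y).toAlternatingMap hb h0
  refine h ?_
  ext v
  have h2 := congrArg (fun f => f fun i => dChart c ((extChartAt (𝓡 3) c).symm y) (v i)) h1
  have h3 := formInChart_dChart μ ((extChartAt (𝓡 3) c).map_target hy) v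
  rw [(extChartAt (𝓡 3) c).right_inv hy] at h3
  rw [← h3]
  exact h2

/-- The sign of a volume form in a chart is locally constant. -/
lemma eventually_sign_coeff_eq {θ : DForm 3 3 P} (hθ : IsOrientationForm θ) {c : P}
    {y : EuclideanSpace ℝ (Fin 3)} (hy : y ∈ (extChartAt (𝓡 3) c).target) :
    ∀ᶠ y' in 𝓝 y, Real.sign (coeff c θ y') = Real.sign (coeff c θ y) := by
  have hc : ContinuousAt (coeff c θ) y :=
    (continuousOn_coeff hθ.smooth).continuousAt ((isOpen_extChartAt_target c).mem_nhds hy)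
  rcases lt_or_gt_of_ne (coeff_ne_zero hy (hθ.ne_zero _)) with h | h
  · filter_upwards [hc.eventually_lt_const h] with y' hy'
    rw [Real.sign_of_neg h, Real.sign_of_neg hy']
  · filter_upwards [hc.eventually_const_lt h] with y' hy'
    rw [Real.sign_of_pos h, Real.sign_of_pos hy']

lemma apply_linearMap_eq_det_smul (f : EuclideanSpace ℝ (Fin 3) [⋀^Fin 3]→L[ℝ] ℝ)
    (L : EuclideanSpace ℝ (Fin 3) →L[ℝ] EuclideanSpace ℝ (Fin 3)) :
    f (fun i => L (EuclideanSpace.single i 1)) = L.det * f fun i => EuclideanSpace.single i 1 := by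
  let b := (EuclideanSpace.basisFun (Fin 3) ℝ).toBasis
  have hb : ⇑b = fun i => EuclideanSpace.single i 1 := by ext i j; simp [b]
  have h1 := congrArg (fun g => g fun i => L (b i)) (f.toAlternatingMap.eq_smul_basis_det b)
  have h2 : b.det (fun i => L (b i)) = L.det := by
    have := b.det_comp L.toLinearMap b
    rw [b.det_self, mul_one] at this
    exact this
  simp only [AlternatingMap.smul_apply, h2] at h1
  rw [hb] at h1
  rw [mul_comm]
  exact h1

/-- The transformation of coefficients under a change of charts. -/
lemma coeff_change {a c p : P} (ha : p ∈ (extChartAt (𝓡 3) a).source)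
    (hc : p ∈ (extChartAt (𝓡 3) c).source) (μ : DForm 3 3 P) :
    coeff a μ (extChartAt (𝓡 3) a p) =
      (fderiv ℝ (mapInChart a c (id : P → P)) (extChartAt (𝓡 3) a p)).det *
        coeff c μ (extChartAt (𝓡 3) c p) := by
  rw [coeff, coeff, ← apply_linearMap_eq_det_smul]
  set u : Fin 3 → TangentSpace (𝓡 3) p := fun i =>
    (dChartEquiv a p ha).symm (EuclideanSpace.single i 1) with hu
  have h1 : ∀ i, dChart a p (u i) = EuclideanSpace.single i 1 := fun i =>
    (dChartEquiv a p ha).apply_symm_apply _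
  have h2 : ∀ i, fderiv ℝ (mapInChart a c (id : P → P)) (extChartAt (𝓡 3) a p)
      (EuclideanSpace.single i 1) = dChart c p (u i) := by
    intro i
    have h3 := dChart_mfderiv (f := (id : P → P)) (c := c) ha hc mdifferentiableAt_id (u i)
    rw [mfderiv_id, h1] at h3
    exact h3.symm
  simp only [h2]
  rw [formInChart_dChart μ hc, ← formInChart_dChart μ ha]
  simp only [h1]

/-- The invariance under changes of charts of the integral of a form with support in two charts. -/
lemma integral_change_chart {θ μ : DForm 3 3 P} {a c : P} {χ : P → ℝ}
    (hχ : ∀ q ∉ (extChartAt (𝓡 3) c).source, χ q = 0)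
    (hμ : ∀ q ∉ (extChartAt (𝓡 3) a).source, μ q = 0) :
    ∫ y in (extChartAt (𝓡 3) c).target,
      χ ((extChartAt (𝓡 3) c).symm y) * (Real.sign (coeff c θ y) * coeff c μ y) =
    ∫ y in (extChartAt (𝓡 3) a).target,
      χ ((extChartAt (𝓡 3) a).symm y) * (Real.sign (coeff a θ y) * coeff a μ y) := by
  set T := mapInChart (n := 3) (m := 3) a c (id : P → P) with hT
  -- The overlap of the two charts, seen in the chart around a. Both integrands vanish outside it:
  -- one side because of the support of μ, the other because of that of χ.
  set s := (extChartAt (𝓡 3) a).target ∩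
    (extChartAt (𝓡 3) a).symm ⁻¹' (extChartAt (𝓡 3) c).source with hs
  have hso : IsOpen s := (continuousOn_extChartAt_symm a).isOpen_inter_preimage
    (isOpen_extChartAt_target a) (isOpen_extChartAt_source c)
  have hTs : T '' s ⊆ (extChartAt (𝓡 3) c).target := by
    rintro _ ⟨y, hy, rfl⟩
    exact (extChartAt (𝓡 3) c).map_source hy.2
  have hTinv : ∀ y ∈ s, (extChartAt (𝓡 3) c).symm (T y) = (extChartAt (𝓡 3) a).symm y :=
    fun y hy => (extChartAt (𝓡 3) c).left_inv hy.2
  have hinj : InjOn T s := fun y hy z hz h => by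
    have h1 := congrArg (extChartAt (𝓡 3) c).symm h
    rw [hTinv y hy, hTinv z hz] at h1
    exact (extChartAt (𝓡 3) a).symm.injOn hy.1 hz.1 h1
  have hder : ∀ y ∈ s, HasFDerivWithinAt T (fderiv ℝ T y) s y := by
    intro y hy
    have h1 := contDiffAt_mapInChart (f := (id : P → P)) (c := c)
      ((extChartAt (𝓡 3) a).map_target hy.1) hy.2 contMDiffAt_id
    rw [(extChartAt (𝓡 3) a).right_inv hy.1] at h1
    exact (h1.differentiableAt (by simp)).hasFDerivAt.hasFDerivWithinAt
  have himage : ∀ y ∈ (extChartAt (𝓡 3) c).target, y ∉ T '' s →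
      (extChartAt (𝓡 3) c).symm y ∉ (extChartAt (𝓡 3) a).source := by
    intro y hy hys hq
    refine hys ⟨extChartAt (𝓡 3) a ((extChartAt (𝓡 3) c).symm y),
      ⟨(extChartAt (𝓡 3) a).map_source hq, ?_⟩, ?_⟩
    · rw [mem_preimage, (extChartAt (𝓡 3) a).left_inv hq]
      exact (extChartAt (𝓡 3) c).map_target hy
    · simp only [hT, mapInChart, id, (extChartAt (𝓡 3) a).left_inv hq,
        (extChartAt (𝓡 3) c).right_inv hy]
  rw [MeasureTheory.setIntegral_eq_of_subset_of_forall_sdiff_eq_zero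
      (isOpen_extChartAt_target c).measurableSet hTs,
    MeasureTheory.integral_image_eq_integral_abs_det_fderiv_smul _ hso.measurableSet hder hinj,
    MeasureTheory.setIntegral_eq_of_subset_of_forall_sdiff_eq_zero
      (isOpen_extChartAt_target a).measurableSet (s := s) inter_subset_left]
  · refine MeasureTheory.setIntegral_congr_fun hso.measurableSet fun y hy => ?_
    have hθc := coeff_change ((extChartAt (𝓡 3) a).map_target hy.1) hy.2 θ
    have hμc := coeff_change ((extChartAt (𝓡 3) a).map_target hy.1) hy.2 μ
    rw [(extChartAt (𝓡 3) a).right_inv hy.1] at hθc hμc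
    simp only [hTinv y hy, smul_eq_mul]
    rw [hθc, hμc]
    change _ = χ _ * (Real.sign ((fderiv ℝ T y).det * coeff c θ (T y)) *
      ((fderiv ℝ T y).det * coeff c μ (T y)))
    -- The coefficients of μ and θ are both multiplied by the Jacobian determinant d. The sign taken
    -- from θ turns d into |d|, the factor in the substitution formula, so the charts need not be
    -- oriented.
    have hsign : ∀ d e : ℝ, Real.sign (d * e) * d = |d| * Real.sign e := by
      intro d e
      rcases lt_trichotomy d 0 with hd | hd | hd
      · rcases lt_trichotomy e 0 with he | he | he
        · rw [Real.sign_of_pos (mul_pos_of_neg_of_neg hd he), Real.sign_of_neg he, abs_of_neg hd]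
          ring
        · simp [he]
        · rw [Real.sign_of_neg (mul_neg_of_neg_of_pos hd he), Real.sign_of_pos he, abs_of_neg hd]
          ring
      · simp [hd]
      · rcases lt_trichotomy e 0 with he | he | he
        · rw [Real.sign_of_neg (mul_neg_of_pos_of_neg hd he), Real.sign_of_neg he, abs_of_pos hd]
          ring
        · simp [he]
        · rw [Real.sign_of_pos (mul_pos hd he), Real.sign_of_pos he, abs_of_pos hd]
          ring
    rw [← mul_assoc (Real.sign _), hsign]
    ring
  · intro y hy
    rw [hχ _ fun hq => hy.2 ⟨hy.1, hq⟩, zero_mul]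
  · intro y hy
    rw [coeff_eq_zero (hμ _ (himage y hy.1 hy.2)), mul_zero, mul_zero]

end Charts

/-! ### The integral over P and Stokes' theorem for forms supported in a chart -/

section GlobalIntegral

variable {P : Type*} [TopologicalSpace P] [ChartedSpace (EuclideanSpace ℝ (Fin 3)) P]

lemma isCompact_chart_image {c : P} {K : Set P} (hK : IsCompact K)
    (hKc : K ⊆ (extChartAt (𝓡 3) c).source) : IsCompact (extChartAt (𝓡 3) c '' K) :=
  hK.image_of_continuousOn ((continuousOn_extChartAt c).mono hKc)

lemma notMem_of_notMem_chart_image {c : P} {K : Set P} {y : EuclideanSpace ℝ (Fin 3)}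
    (hy : y ∈ (extChartAt (𝓡 3) c).target) (h : y ∉ extChartAt (𝓡 3) c '' K) :
    (extChartAt (𝓡 3) c).symm y ∉ K :=
  fun hq => h ⟨_, hq, (extChartAt (𝓡 3) c).right_inv hy⟩

variable [IsManifold (𝓡 3) ∞ P]

lemma continuousOn_integrand {θ μ : DForm 3 3 P} (hθ : IsOrientationForm θ) (hμ : IsSmoothForm μ)
    {χ : P → ℝ} (hχ : Continuous χ) (c : P) :
    ContinuousOn (fun y => χ ((extChartAt (𝓡 3) c).symm y) *
      (Real.sign (coeff c θ y) * coeff c μ y)) (extChartAt (𝓡 3) c).target := by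
  refine (hχ.comp_continuousOn (continuousOn_extChartAt_symm c)).mul
    (ContinuousOn.mul (fun y hy => ?_) (continuousOn_coeff hμ))
  exact (continuousAt_const.congr ((eventually_sign_coeff_eq hθ hy).mono
    fun _ h => h.symm)).continuousWithinAt

lemma integrableOn_integrand {θ μ : DForm 3 3 P} (hθ : IsOrientationForm θ) (hμ : IsSmoothForm μ)
    {χ : P → ℝ} (hχ : Continuous χ) {c : P} {K : Set P} (hK : IsCompact K)
    (hKc : K ⊆ (extChartAt (𝓡 3) c).source) (h0 : ∀ q ∉ K, χ q = 0 ∨ μ q = 0) :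
    MeasureTheory.IntegrableOn (fun y => χ ((extChartAt (𝓡 3) c).symm y) *
      (Real.sign (coeff c θ y) * coeff c μ y)) (extChartAt (𝓡 3) c).target := by
  refine integrableOn_of_eq_zero_off_compact (isOpen_extChartAt_target c).measurableSet
    (continuousOn_integrand hθ hμ hχ c) (isCompact_chart_image hK hKc) ?_ fun y hy hyK => ?_
  · rintro _ ⟨q, hq, rfl⟩
    exact (extChartAt (𝓡 3) c).map_source (hKc hq)
  · rcases h0 _ (notMem_of_notMem_chart_image hy hyK) with h | h
    · rw [h, zero_mul]
    · rw [coeff_eq_zero h, mul_zero, mul_zero]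

variable [CompactSpace P] [T2Space P]

lemma tsupport_chartPartition_subset (c : P) :
    tsupport (chartPartition P c) ⊆ (extChartAt (𝓡 3) c).source := by
  rw [extChartAt_source]
  exact (SmoothPartitionOfUnity.exists_isSubordinate_chartAt_source (𝓡 3) P).choose_spec c

lemma finite_chartPartition : {c : P | (Function.support (chartPartition P c)).Nonempty}.Finite :=
  (chartPartition P).locallyFinite.finite_nonempty_of_compact

lemma sum_chartPartition (q : P) :
    ∑ c ∈ (finite_chartPartition (P := P)).toFinset, chartPartition P c q = 1 := by
  have h1 := (chartPartition P).sum_eq_one (mem_univ q)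
  rwa [finsum_eq_sum_of_support_subset (s := (finite_chartPartition (P := P)).toFinset)] at h1
  intro c hc
  exact (finite_chartPartition (P := P)).mem_toFinset.2 ⟨q, hc⟩

lemma integral_eq_sum (θ μ : DForm 3 3 P) :
    integral θ μ = ∑ c ∈ (finite_chartPartition (P := P)).toFinset,
      ∫ y in (extChartAt (𝓡 3) c).target,
        chartPartition P c ((extChartAt (𝓡 3) c).symm y) *
          (Real.sign (coeff c θ y) * coeff c μ y) := by
  refine finsum_eq_sum_of_support_subset _ fun c hc => ?_
  refine (finite_chartPartition (P := P)).mem_toFinset.2 ?_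
  by_contra hne
  refine hc ?_
  have h0 : ⇑(chartPartition P c) = 0 :=
    Function.support_eq_empty_iff.1 (not_nonempty_iff_eq_empty.1 hne)
  simp [h0]

lemma continuous_chartPartition (c : P) : Continuous (chartPartition P c) :=
  (chartPartition P c).contMDiff.continuous

lemma integral_add_forms {θ μ μ' : DForm 3 3 P} (hθ : IsOrientationForm θ) (hμ : IsSmoothForm μ)
    (hμ' : IsSmoothForm μ') : integral θ (μ + μ') = integral θ μ + integral θ μ' := by
  have hint : ∀ {μ : DForm 3 3 P}, IsSmoothForm μ → ∀ c : P, MeasureTheory.IntegrableOn (fun y =>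
      chartPartition P c ((extChartAt (𝓡 3) c).symm y) * (Real.sign (coeff c θ y) * coeff c μ y))
      (extChartAt (𝓡 3) c).target := fun hμ c =>
    integrableOn_integrand hθ hμ (continuous_chartPartition c)
      (isClosed_tsupport _).isCompact (tsupport_chartPartition_subset c)
      fun q hq => Or.inl (image_eq_zero_of_notMem_tsupport hq)
  rw [integral_eq_sum, integral_eq_sum, integral_eq_sum, ← Finset.sum_add_distrib]
  refine Finset.sum_congr rfl fun c _ => ?_
  rw [← MeasureTheory.integral_add (hint hμ c) (hint hμ' c)]
  refine MeasureTheory.integral_congr_ae (Filter.Eventually.of_forall fun y => ?_)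
  have h1 : coeff c (μ + μ') y = coeff c μ y + coeff c μ' y := by
    rw [coeff, formInChart_add]
    rfl
  simp only [h1]
  ring

lemma integral_neg_form (θ μ : DForm 3 3 P) : integral θ (-μ) = -integral θ μ := by
  rw [integral_eq_sum, integral_eq_sum, ← Finset.sum_neg_distrib]
  refine Finset.sum_congr rfl fun c _ => ?_
  rw [← MeasureTheory.integral_neg]
  refine MeasureTheory.integral_congr_ae (Filter.Eventually.of_forall fun y => ?_)
  have h1 : coeff c (-μ) y = -coeff c μ y := rfl
  simp only [h1]
  ring

/-- The integral of a form with support in a chart. -/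
lemma integral_eq_of_support_subset {θ μ : DForm 3 3 P} (hθ : IsOrientationForm θ)
    (hμ : IsSmoothForm μ) {a : P} {K : Set P} (hK : IsCompact K)
    (hKa : K ⊆ (extChartAt (𝓡 3) a).source) (h0 : ∀ q ∉ K, μ q = 0) :
    integral θ μ =
      ∫ y in (extChartAt (𝓡 3) a).target, Real.sign (coeff a θ y) * coeff a μ y := by
  -- Each summand of the partition of unity is moved into the chart around a, where the functions
  -- add up to 1.
  rw [integral_eq_sum, Finset.sum_congr rfl fun c _ => integral_change_chart (a := a)
    (χ := chartPartition P c)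
    (fun q hq => image_eq_zero_of_notMem_tsupport fun h => hq (tsupport_chartPartition_subset c h))
    (fun q hq => h0 q fun h => hq (hKa h)),
    ← MeasureTheory.integral_finsetSum _ fun c _ => integrableOn_integrand hθ hμ
      (continuous_chartPartition c) hK hKa fun q hq => Or.inr (h0 q hq)]
  refine MeasureTheory.integral_congr_ae (Filter.Eventually.of_forall fun y => ?_)
  simp only
  rw [← Finset.sum_mul, sum_chartPartition, one_mul]

/-- Stokes' theorem for a form which has its support in a chart and is exact there. -/
lemma integral_eq_zero_of_exact_in_chart {θ μ : DForm 3 3 P} (hθ : IsOrientationForm θ)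
    (hμ : IsSmoothForm μ) {a : P} {K : Set P} (hK : IsCompact K)
    (hKa : K ⊆ (extChartAt (𝓡 3) a).source) (h0 : ∀ q ∉ K, μ q = 0)
    {γ : EuclideanSpace ℝ (Fin 3) → EuclideanSpace ℝ (Fin 3) [⋀^Fin 2]→L[ℝ] ℝ}
    (hγ : ∀ q ∈ K, ContDiffAt ℝ 1 γ (extChartAt (𝓡 3) a q))
    (hγ0 : ∀ y ∈ (extChartAt (𝓡 3) a).target, (extChartAt (𝓡 3) a).symm y ∉ K → γ y = 0)
    (hd : ∀ q ∈ K, extDeriv γ (extChartAt (𝓡 3) a q) =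
      formInChart a μ (extChartAt (𝓡 3) a q)) : integral θ μ = 0 := by
  classical
  have htarget := isOpen_extChartAt_target (I := 𝓡 3) a
  have hKc := isCompact_chart_image hK hKa
  have hKt : extChartAt (𝓡 3) a '' K ⊆ (extChartAt (𝓡 3) a).target := by
    rintro _ ⟨q, hq, rfl⟩
    exact (extChartAt (𝓡 3) a).map_source (hKa hq)
  -- The orientation sign is absorbed into the primitive, which is extended by zero outside the
  -- chart. Since the sign is locally constant on the chart and γ vanishes off the compact set K, δ
  -- is C¹ with compact support on all of ℝ³ and dδ = sign · dγ.
  set δ : EuclideanSpace ℝ (Fin 3) → EuclideanSpace ℝ (Fin 3) [⋀^Fin 2]→L[ℝ] ℝ := fun y =>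
    if y ∈ (extChartAt (𝓡 3) a).target then Real.sign (coeff a θ y) • γ y else 0 with hδ
  have hδ0 : ∀ y ∉ extChartAt (𝓡 3) a '' K, δ y = 0 := by
    intro y hy
    simp only [hδ]
    split_ifs with hyt
    · rw [hγ0 y hyt (notMem_of_notMem_chart_image hyt hy), smul_zero]
    · rfl
  have hδ0' : ∀ y ∉ extChartAt (𝓡 3) a '' K, δ =ᶠ[𝓝 y] fun _ => 0 := fun y hy =>
    Filter.mem_of_superset (hKc.isClosed.isOpen_compl.mem_nhds hy) hδ0
  have hδγ : ∀ y ∈ (extChartAt (𝓡 3) a).target,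
      δ =ᶠ[𝓝 y] fun y' => Real.sign (coeff a θ y) • γ y' := by
    intro y hy
    filter_upwards [htarget.mem_nhds hy, eventually_sign_coeff_eq hθ hy] with y' h1 h2
    simp only [hδ, if_pos h1, h2]
  have hδc : ContDiff ℝ 1 δ := by
    refine contDiff_iff_contDiffAt.2 fun y => ?_
    by_cases hy : y ∈ extChartAt (𝓡 3) a '' K
    · refine ContDiffAt.congr_of_eventuallyEq ?_ (hδγ y (hKt hy))
      obtain ⟨q, hq, rfl⟩ := hy
      exact (hγ q hq).const_smul _
    · exact contDiffAt_const.congr_of_eventuallyEq (hδ0' y hy)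
  have hδs : HasCompactSupport δ := HasCompactSupport.intro hKc hδ0
  have key := integral_extDeriv_eq_zero (μ := MeasureTheory.volume) hδc hδs
    (fun i => EuclideanSpace.single i 1)
  have hzero : ∀ y ∉ extChartAt (𝓡 3) a '' K, extDeriv δ y = 0 := fun y hy => by
    rw [extDeriv, (hδ0' y hy).fderiv_eq]
    ext v
    simp [ContinuousAlternatingMap.alternatizeUncurryFin_apply]
  rw [integral_eq_of_support_subset hθ hμ hK hKa h0, ← key, eq_comm]
  rw [← MeasureTheory.setIntegral_eq_integral_of_forall_compl_eq_zero
    (s := (extChartAt (𝓡 3) a).target)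
    (fun y hy => by rw [hzero y fun h => hy (hKt h)]; rfl)]
  refine MeasureTheory.setIntegral_congr_fun htarget.measurableSet fun y hy => ?_
  by_cases hyK : y ∈ extChartAt (𝓡 3) a '' K
  · have h1 : extDeriv δ y = Real.sign (coeff a θ y) • extDeriv γ y := by
      rw [← extDeriv_fun_smul, extDeriv, extDeriv, (hδγ y hy).fderiv_eq]
      rfl
    rw [h1]
    obtain ⟨q, hq, rfl⟩ := hyK
    rw [hd q hq]
    rfl
  · rw [hzero y hyK, coeff_eq_zero (h0 _ (notMem_of_notMem_chart_image hy hyK)), mul_zero]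
    rfl

end GlobalIntegral

/-! ### Self-adjointness -/

section Pairing

variable {M : Type*} [TopologicalSpace M] [ChartedSpace (EuclideanSpace ℝ (Fin 6)) M]
  {P : Type*} [TopologicalSpace P] [ChartedSpace (EuclideanSpace ℝ (Fin 3)) P]
  [IsManifold (𝓡 6) ∞ M] {ι : P → M} {hι : ContMDiff (𝓡 3) (𝓡 6) ∞ ι} {W : SubFamily ι}

lemma pairing_zero_left (z : Cod ι hι W) : pairing (0 : Dom ι hι W) z = 0 := by
  funext p
  have h1 : z.2.1 p ⟨(0 : Dom ι hι W).2.1 p, (0 : Dom ι hι W).2.2.2 p⟩ = 0 := map_zero _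
  unfold pairing
  rw [h1]
  ext v
  simp

lemma pairing_zero_right (x : Dom ι hι W) : pairing x (0 : Cod ι hι W) = 0 := by
  funext p
  ext v
  simp [pairing]

lemma pairing_add_left (x x' : Dom ι hι W) (z : Cod ι hι W) :
    pairing (x + x') z = pairing x z + pairing x' z := by
  funext p
  have h1 : z.2.1 p ⟨(x + x').2.1 p, (x + x').2.2.2 p⟩ =
      z.2.1 p ⟨x.2.1 p, x.2.2.2 p⟩ + z.2.1 p ⟨x'.2.1 p, x'.2.2.2 p⟩ :=
    map_add (z.2.1 p) ⟨x.2.1 p, x.2.2.2 p⟩ ⟨x'.2.1 p, x'.2.2.2 p⟩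
  have h2 : (x + x').1 p = x.1 p + x'.1 p := rfl
  have h3 : ∀ (r s t : ℝ) (A B C : TangentSpace (𝓡 3) p [⋀^Fin 3]→L[ℝ] ℝ),
      (r + s) • A + t • (B + C) = (r • A + t • B) + (s • A + t • C) := fun r s t A B C => by
    rw [add_smul, smul_add]
    abel
  unfold pairing
  rw [h1, h2]
  exact h3 _ _ _ _ _ _

lemma pairing_add_right (x : Dom ι hι W) (z z' : Cod ι hι W) :
    pairing x (z + z') = pairing x z + pairing x z' := by
  funext p
  have h3 : ∀ (r t : ℝ) (A A' B B' : TangentSpace (𝓡 3) p [⋀^Fin 3]→L[ℝ] ℝ),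
      r • (A + A') + t • (B + B') = (r • A + t • B) + (r • A' + t • B') :=
    fun r t A A' B B' => by
      rw [smul_add, smul_add]
      abel
  exact h3 _ _ _ _ _ _

/-- An operator is self-adjoint if it is so on fields with support in charts. -/
lemma isSelfAdjointOp_of_supported [IsManifold (𝓡 3) ∞ P] [CompactSpace P] [T2Space P]
    {θ : DForm 3 3 P} (hθ : IsOrientationForm θ) {D : Dom ι hι W →ₗ[ℝ] Cod ι hι W}
    (hD : ∀ x y, IsSmoothForm (pairing x (D y)))
    (h : ∀ a c x, SupportedIn a c x → ∀ y,
      integral θ (pairing x (D y)) = integral θ (pairing y (D x))) : IsSelfAdjointOp θ D := by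
  intro x
  refine Dom.induction_supported
    (fun x => ∀ y, integral θ (pairing x (D y)) = integral θ (pairing y (D x))) ?_ ?_ h x
  · intro y
    rw [pairing_zero_left, map_zero, pairing_zero_right]
  · intro x x' hx hx' y
    rw [pairing_add_left, map_add, pairing_add_right, integral_add_forms hθ (hD _ _) (hD _ _),
      integral_add_forms hθ (hD _ _) (hD _ _), hx, hx']

end Pairing

/-! ### Self-adjointness of the linearized operator -/

section SelfAdjoint

variable {M : Type*} [TopologicalSpace M] [ChartedSpace (EuclideanSpace ℝ (Fin 6)) M]
  {P : Type*} [TopologicalSpace P] [ChartedSpace (EuclideanSpace ℝ (Fin 3)) P]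
  {ρ : DForm 6 3 M} {τ : DForm 6 4 M} [IsManifold (𝓡 6) ∞ M]
  {ι : P → M} {hι : ContMDiff (𝓡 3) (𝓡 6) ∞ ι} {W : SubFamily ι}
  (h : IsClosedG2Pair34 ρ τ) {lam : P → ℝ}

lemma derivInCharts_jet (x y : Dom ι hι W) (p : P) :
    derivInCharts ρ τ p (ι p) lam ι y.1 y.2.1 p (x.1 p) (x.2.1 p) =
      (jetForm h lam ι p (y.jet p) (x.1 p, dChart (ι p) (ι p) (x.2.1 p))).compContinuousLinearMap
        (dChart p p) := rfl

lemma Dom.jet_eq_zero {x : Dom ι hι W} {K : Set P} (hK : IsClosed K)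
    (hx : ∀ q ∉ K, x.1 q = 0 ∧ x.2.1 q = 0) {p : P} (hp : p ∉ K) : x.jet p = 0 := by
  have h1 : fieldInChart p (ι p) x.1 x.2.1 =ᶠ[𝓝 (extChartAt (𝓡 3) p p)] fun _ => 0 := by
    filter_upwards [(tendsto_chart_symm (mem_extChartAt_source p)).eventually
      (hK.isOpen_compl.mem_nhds hp)] with y hy
    unfold fieldInChart
    rw [(hx _ hy).1, (hx _ hy).2, map_zero]
    rfl
  unfold Dom.jet
  rw [h1.fderiv_eq, h1.self_of_nhds]
  simp

variable [IsManifold (𝓡 3) ∞ P] (hlam : ContMDiff (𝓡 3) 𝓘(ℝ, ℝ) ∞ lam) (hsol : IsSolution ρ τ lam ι)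

/-- The sign (−1)³ in the pairing cancels the minus sign in the second component of the operator.
What remains is the linearization of F^*(Y ⌟ Ψ) in the direction y, evaluated on Y = x, for which
the symmetry formula on the cylinder is available. -/
lemma pairing_linearizedOperator (x y : Dom ι hι W) :
    pairing x (linearizedOperator h hlam hsol hι W y) =
      fun p => derivInCharts ρ τ p (ι p) lam ι y.1 y.2.1 p (x.1 p) (x.2.1 p) := by
  funext p
  have h1 : ((x.1 p, dChart (ι p) (ι p) (x.2.1 p)) : ℝ × EuclideanSpace ℝ (Fin 6)) =
      x.1 p • (1, 0) + (0, dChart (ι p) (ι p) (x.2.1 p)) := Prod.ext (by simp) (by simp)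
  rw [derivInCharts_jet h, h1, map_add, map_smul]
  ext v
  change x.1 p * _ + (-1 : ℝ) ^ 3 * (-_) = x.1 p * _ + _
  have h2 : ∀ s t : ℝ, s + (-1) ^ 3 * (-t) = s + t := fun s t => by ring
  exact h2 _ _

lemma isSmoothForm_pairing (x y : Dom ι hι W) :
    IsSmoothForm (pairing x (linearizedOperator h hlam hsol hι W y)) := by
  rw [pairing_linearizedOperator]
  exact derivInCharts_mem_smoothForms h hlam hι hsol y.1.contMDiff y.2.2.1 x.1.contMDiff x.2.2.1

variable [CompactSpace P] [T2Space P]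

/-- The difference of the integrands is the exterior derivative of F^*(Ψ(X, Y, ·, ·)) in the chart.
This 2-form vanishes wherever X does, so localizing x alone suffices for Stokes' theorem and y may
be arbitrary. -/
lemma integral_pairing_eq_of_supportedIn {θ : DForm 3 3 P} (hθ : IsOrientationForm θ) {a : P} {c : M}
    {x : Dom ι hι W} (hx : SupportedIn a c x) (y : Dom ι hι W) :
    integral θ (pairing x (linearizedOperator h hlam hsol hι W y)) =
      integral θ (pairing y (linearizedOperator h hlam hsol hι W x)) := by
  obtain ⟨K, hK, hKc, hfit, hzero⟩ := hx
  have hs := isSmoothForm_pairing h hlam hsol x y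
  have hs' := isSmoothForm_pairing h hlam hsol y x
  have hneg : IsSmoothForm (-pairing y (linearizedOperator h hlam hsol hι W x)) :=
    (SmoothForms 3 3 P).neg_mem hs'
  rw [← sub_eq_zero, sub_eq_add_neg, ← integral_neg_form, ← integral_add_forms hθ hs hneg]
  rw [pairing_linearizedOperator, pairing_linearizedOperator] at *
  have hgraph : ∀ q ∈ K, ContDiffAt ℝ ∞ (graphInChart a c lam ι) (extChartAt (𝓡 3) a q) :=
    fun q hq => contDiffAt_graphInChart (hfit q hq) (hlam q) (hι q)
  have hX : ∀ q ∈ K, ContDiffAt ℝ ∞ (fieldInChart a c x.1 x.2.1) (extChartAt (𝓡 3) a q) :=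
    fun q hq => contDiffAt_fieldInChart (hfit q hq) (x.1.contMDiff q) (x.2.2.1 q)
  have hY : ∀ q ∈ K, ContDiffAt ℝ ∞ (fieldInChart a c y.1 y.2.1) (extChartAt (𝓡 3) a q) :=
    fun q hq => contDiffAt_fieldInChart (hfit q hq) (y.1.contMDiff q) (y.2.2.1 q)
  refine integral_eq_zero_of_exact_in_chart hθ ((SmoothForms 3 3 P).add_mem hs hneg) hK
    (fun q hq => (hfit q hq).1) (fun q hq => ?_)
    (γ := contractPullback₂ (psiInChart ρ τ c) (graphInChart a c lam ι)
      (fieldInChart a c x.1 x.2.1) (fieldInChart a c y.1 y.2.1))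
    (fun q hq => ?_) (fun z hz hzK => ?_) (fun q hq => ?_)
  · change derivInCharts ρ τ q (ι q) lam ι y.1 y.2.1 q (x.1 q) (x.2.1 q) +
      -derivInCharts ρ τ q (ι q) lam ι x.1 x.2.1 q (y.1 q) (y.2.1 q) = 0
    rw [derivInCharts_jet h, derivInCharts_jet h, Dom.jet_eq_zero hKc hzero hq, (hzero q hq).1,
      (hzero q hq).2, map_zero, map_zero, LinearMap.zero_apply]
    have h0 : ((0 : ℝ), (0 : EuclideanSpace ℝ (Fin 6))) = 0 := rfl
    rw [h0, map_zero]
    ext v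
    exact add_neg_cancel _
  · exact (contDiffAt_contractPullback₂ (contDiffAt_psiInChart_graph h lam ι (hfit q hq))
      (hgraph q hq) (hX q hq) (hY q hq)).of_le (by exact_mod_cast le_top)
  · have h0 : fieldInChart a c x.1 x.2.1 z = 0 := by
      unfold fieldInChart
      rw [(hzero _ hzK).1, (hzero _ hzK).2, map_zero]
      rfl
    ext v
    rw [contractPullback₂_apply, h0]
    exact (psiInChart ρ τ c _).map_coord_zero 0 rfl
  · have hq' := (extChartAt (𝓡 3) a).map_source (hfit q hq).1
    have hfit' : Fits a c ι ((extChartAt (𝓡 3) a).symm (extChartAt (𝓡 3) a q)) := by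
      rw [(extChartAt (𝓡 3) a).left_inv (hfit q hq).1]; exact hfit q hq
    rw [extDeriv_contractPullback₂ (contDiffAt_psiInChart_graph h lam ι (hfit q hq))
      (extDeriv_psiInChart h (by
        rw [graphInChart_chart _ _ (hfit q hq).1]
        exact (extChartAt (𝓡 6) c).map_source (hfit q hq).2))
      (hgraph q hq) (hX q hq) (hY q hq), formInChart_add, sub_eq_add_neg,
      ← formInChart_derivInCharts h hlam hι hsol x.1.contMDiff x.2.2.1 hq' hfit' y.1 y.2.1,
      ← formInChart_derivInCharts h hlam hι hsol y.1.contMDiff y.2.2.1 hq' hfit' x.1 x.2.1]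
    rfl

lemma isSelfAdjointOp_linearizedOperator {θ : DForm 3 3 P} (hθ : IsOrientationForm θ) :
    IsSelfAdjointOp θ (linearizedOperator h hlam hsol hι W) :=
  isSelfAdjointOp_of_supported hθ (isSmoothForm_pairing h hlam hsol)
    fun _ _ _ hx y => integral_pairing_eq_of_supportedIn h hlam hsol hθ hx y

end SelfAdjoint

/-! ### Orthogonal complements of the image of a linear map -/

section Gram

variable {E F : Type*} [NormedAddCommGroup E] [NormedSpace ℝ E] [NormedAddCommGroup F]
  [NormedSpace ℝ F]

lemma contDiff_flip : ContDiff ℝ ∞ (fun f : E →L[ℝ] F →L[ℝ] ℝ => f.flip) :=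
  IsBoundedLinearMap.contDiff (IsLinearMap.with_bound ⟨fun _ _ => rfl, fun _ _ => rfl⟩ 1
    fun f => by rw [ContinuousLinearMap.opNorm_flip, one_mul])

/-- The Gram operator of a linear map, for a bilinear form on its target. -/
def gram (G : F →L[ℝ] F →L[ℝ] ℝ) (A : E →L[ℝ] F) : E →L[ℝ] E →L[ℝ] ℝ :=
  G.bilinearComp A A

/-- The orthogonal projection of `w` to the complement of the image of `A`. -/
def normalProj (G : F →L[ℝ] F →L[ℝ] ℝ) (A : E →L[ℝ] F) (w : F) : F :=
  w - A ((gram G A).inverse ((G w).comp A))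

variable {G : F →L[ℝ] F →L[ℝ] ℝ} {A : E →L[ℝ] F} {w : F}

lemma normalProj_of_orthogonal (h : ∀ e, G w (A e) = 0) : normalProj G A w = w := by
  have h1 : (G w).comp A = 0 := ContinuousLinearMap.ext h
  simp [normalProj, h1]

variable [FiniteDimensional ℝ E]

/-- If e is in the kernel, then G(Ae, Ae) = 0, so Ae = 0 by positivity and e = 0 by injectivity.
Source and target have equal finite dimension. -/
lemma gram_isInvertible (hG : ∀ u, u ≠ 0 → 0 < G u u) (hA : Function.Injective A) :
    (gram G A).IsInvertible := by
  have hinj : Function.Injective (gram G A).toLinearMap := by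
    rw [← LinearMap.ker_eq_bot, LinearMap.ker_eq_bot']
    intro e he
    by_contra hne
    have h1 : G (A e) (A e) = 0 := DFunLike.congr_fun he e
    exact (hG (A e) fun h => hne (hA (h.trans (map_zero A).symm))).ne' h1
  have hdim : Module.finrank ℝ E = Module.finrank ℝ (E →L[ℝ] ℝ) :=
    (Subspace.dual_finrank_eq (K := ℝ) (V := E)).symm.trans
      (LinearMap.toContinuousLinearMap (𝕜 := ℝ) (E := E) (F' := ℝ)).finrank_eq
  exact ⟨(LinearEquiv.ofInjectiveOfFinrankEq _ hinj hdim).toContinuousLinearEquiv,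
    ContinuousLinearMap.ext fun _ => rfl⟩

lemma normalProj_orthogonal (hG : ∀ u, u ≠ 0 → 0 < G u u) (hA : Function.Injective A) (e : E) :
    G (normalProj G A w) (A e) = 0 := by
  have h1 := gram_isInvertible hG hA
  have h2 := (h1.inverse_apply_eq (y := (G w).comp A)).1 rfl
  have h3 := DFunLike.congr_fun h2 e
  change G w (A e) = G (A _) (A e) at h3
  rw [normalProj, map_sub, sub_apply, h3, sub_self]

/-- The projection is composed of G, A and the inverse of the Gram operator, and inversion is smooth
at invertible operators. Positivity and injectivity are needed only at the point z. -/
lemma contDiffAt_normalProj [CompleteSpace E] {Z : Type*} [NormedAddCommGroup Z]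
    [NormedSpace ℝ Z] {G : Z → F →L[ℝ] F →L[ℝ] ℝ} {A : Z → E →L[ℝ] F} {z : Z}
    (hG : ContDiffAt ℝ ∞ G z) (hA : ContDiffAt ℝ ∞ A z) (w : F)
    (hpos : ∀ u, u ≠ 0 → 0 < G z u u) (hinj : Function.Injective (A z)) :
    ContDiffAt ℝ ∞ (fun y => normalProj (G y) (A y) w) z := by
  have h1 : ContDiffAt ℝ ∞ (fun y => gram (G y) (A y)) z := by
    exact contDiff_flip.contDiffAt.comp z
      ((contDiff_flip.contDiffAt.comp z (hG.clm_comp hA)).clm_comp hA)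
  obtain ⟨S, hS⟩ := gram_isInvertible hpos hinj
  have h2 : ContDiffAt ℝ ∞ (fun y => (gram (G y) (A y)).inverse) z := by
    refine ContDiffAt.comp z (g := ContinuousLinearMap.inverse) ?_ h1
    rw [← hS]
    exact contDiffAt_map_inverse S
  exact contDiffAt_const.sub (hA.clm_apply (h2.clm_apply
    ((hG.clm_apply contDiffAt_const).clm_comp hA)))

end Gram

/-! ### The metric in charts -/

section Metric

variable {M : Type*} [TopologicalSpace M] [ChartedSpace (EuclideanSpace ℝ (Fin 6)) M]
  [IsManifold (𝓡 6) ∞ M] (g : RMetric M) (c : M)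

/-- The metric in the chart around `c`, as a continuous bilinear form. -/
def metricOp (y : EuclideanSpace ℝ (Fin 6)) :
    EuclideanSpace ℝ (Fin 6) →L[ℝ] EuclideanSpace ℝ (Fin 6) →L[ℝ] ℝ :=
  let G : EuclideanSpace ℝ (Fin 6) →L[ℝ] EuclideanSpace ℝ (Fin 6) →L[ℝ] ℝ :=
    g.inner ((extChartAt (𝓡 6) c).symm y)
  let A : EuclideanSpace ℝ (Fin 6) →L[ℝ] EuclideanSpace ℝ (Fin 6) := dChartInv c y
  G.bilinearComp A A

lemma metricOp_apply (y u v : EuclideanSpace ℝ (Fin 6)) :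
    metricOp g c y u v = metricInChart g c y u v := rfl

variable {g c}

lemma metricOp_dChart {x : M} (hx : x ∈ (extChartAt (𝓡 6) c).source)
    (u v : TangentSpace (𝓡 6) x) :
    metricOp g c (extChartAt (𝓡 6) c x) (dChart c x u) (dChart c x v) = g.inner x u v := by
  obtain ⟨y, hy, rfl⟩ : ∃ y ∈ (extChartAt (𝓡 6) c).target, (extChartAt (𝓡 6) c).symm y = x :=
    ⟨_, (extChartAt (𝓡 6) c).map_source hx, (extChartAt (𝓡 6) c).left_inv hx⟩
  rw [(extChartAt (𝓡 6) c).right_inv hy]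
  change g.inner _ (dChartInv c y (dChart c _ u)) (dChartInv c y (dChart c _ v)) = _
  rw [dChartInv_dChart hy, dChartInv_dChart hy]

lemma metricOp_pos {y : EuclideanSpace ℝ (Fin 6)} (hy : y ∈ (extChartAt (𝓡 6) c).target)
    {u : EuclideanSpace ℝ (Fin 6)} (hu : u ≠ 0) : 0 < metricOp g c y u u := by
  refine g.pos _ _ fun h => hu ?_
  exact (dChart_dChartInv hy u).symm.trans
    ((congrArg (dChart c ((extChartAt (𝓡 6) c).symm y)) h).trans (map_zero _))

/-- Smoothness may be tested on constant vectors u, v. These correspond to the coordinate vector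
fields on M, on which the smooth bundle metric takes smooth values. -/
lemma contDiffAt_metricOp {y : EuclideanSpace ℝ (Fin 6)}
    (hy : y ∈ (extChartAt (𝓡 6) c).target) : ContDiffAt ℝ ∞ (metricOp g c) y := by
  have hopen := isOpen_extChartAt_target (I := 𝓡 6) c
  suffices h : ContDiffOn ℝ ∞ (metricOp g c) (extChartAt (𝓡 6) c).target from
    h.contDiffAt (hopen.mem_nhds hy)
  refine contDiffOn_clm_apply.2 fun u => contDiffOn_clm_apply.2 fun v y hy => ?_
  refine ContDiffAt.contDiffWithinAt ?_
  have hs : (extChartAt (𝓡 6) c).symm y ∈ (extChartAt (𝓡 6) c).source :=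
    (extChartAt (𝓡 6) c).map_target hy
  have hfield : ∀ u : EuclideanSpace ℝ (Fin 6),
      ContMDiffAt 𝓘(ℝ, EuclideanSpace ℝ (Fin 6)) (𝓡 6).tangent ∞
        (fun y => (⟨(extChartAt (𝓡 6) c).symm y, dChartInv c y u⟩ : TangentBundle (𝓡 6) M)) y := by
    intro u
    refine (contMDiffAt_dChart hs).2 ⟨contMDiffAt_chart_symm hy, ?_⟩
    refine (contMDiffAt_const (c := u)).congr_of_eventuallyEq ?_
    filter_upwards [hopen.mem_nhds hy] with z hz using dChart_dChartInv hz u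
  have h1 := ContMDiffAt.comp (g := fun b => TotalSpace.mk'
    (EuclideanSpace ℝ (Fin 6) →L[ℝ] EuclideanSpace ℝ (Fin 6) →L[ℝ] ℝ) b (g.inner b)) y
    (g.contMDiff ((extChartAt (𝓡 6) c).symm y)) (contMDiffAt_chart_symm hy)
  have h2 := ContMDiffAt.clm_bundle_apply₂ (F₁ := EuclideanSpace ℝ (Fin 6))
    (F₂ := EuclideanSpace ℝ (Fin 6)) (F₃ := ℝ) (E₃ := Bundle.Trivial M ℝ) h1 (hfield u) (hfield v)
  have h3 := (Bundle.contMDiffAt_totalSpace.1 h2).2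
  exact contMDiffAt_iff_contDiffAt.1 h3

end Metric

/-! ### The normal bundle -/

section Normal

variable {M : Type*} [TopologicalSpace M] [ChartedSpace (EuclideanSpace ℝ (Fin 6)) M]
  [IsManifold (𝓡 6) ∞ M] {P : Type*} [TopologicalSpace P]
  [ChartedSpace (EuclideanSpace ℝ (Fin 3)) P] [IsManifold (𝓡 3) ∞ P]
  {g : RMetric M} {a p : P} {c : M} {ι : P → M}

lemma mem_normalFamily_iff (h : Fits a c ι p) (hι : ContMDiffAt (𝓡 3) (𝓡 6) ∞ ι p)
    {n : TangentSpace (𝓡 6) (ι p)} :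
    n ∈ normalFamily g ι p ↔ ∀ e, metricOp g c (extChartAt (𝓡 6) c (ι p)) (dChart c (ι p) n)
      (fderiv ℝ (mapInChart (n := 3) (m := 6) a c ι) (extChartAt (𝓡 3) a p) e) = 0 := by
  have h1 : ∀ v : TangentSpace (𝓡 3) p, g.inner (ι p) n (mfderiv (𝓡 3) (𝓡 6) ι p v) =
      metricOp g c (extChartAt (𝓡 6) c (ι p)) (dChart c (ι p) n)
        (fderiv ℝ (mapInChart (n := 3) (m := 6) a c ι) (extChartAt (𝓡 3) a p) (dChart a p v)) := fun v => by
    rw [← metricOp_dChart h.2, dChart_mfderiv h.1 h.2 (hι.mdifferentiableAt (by simp))]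
  constructor
  · intro hn e
    obtain ⟨v, rfl⟩ := (dChartEquiv a p h.1).surjective e
    exact (h1 v).symm.trans (hn v)
  · exact fun hn v => (h1 v).trans (hn _)

lemma fderiv_mapInChart_injective (h : Fits a c ι p) (hι : ContMDiffAt (𝓡 3) (𝓡 6) ∞ ι p)
    (hinj : Function.Injective (mfderiv (𝓡 3) (𝓡 6) ι p)) :
    Function.Injective (fderiv ℝ (mapInChart (n := 3) (m := 6) a c ι) (extChartAt (𝓡 3) a p)) := by
  intro e e' he
  obtain ⟨v, rfl⟩ := (dChartEquiv a p h.1).surjective e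
  obtain ⟨v', rfl⟩ := (dChartEquiv a p h.1).surjective e'
  have h1 := fun v => dChart_mfderiv (c := c) h.1 h.2 (hι.mdifferentiableAt (by simp)) v
  rw [dChartEquiv_apply, dChartEquiv_apply, ← h1, ← h1] at he
  rw [hinj ((dChartEquiv c (ι p) h.2).injective he)]

/-- Positivity excludes nonzero vectors that are both normal and tangent. The Gram projection splits
an arbitrary vector into a normal part and an element of the image of the differential. -/
lemma isCompl_normalFamily (hι : ContMDiff (𝓡 3) (𝓡 6) ∞ ι)
    (hinj : ∀ p, Function.Injective (mfderiv (𝓡 3) (𝓡 6) ι p)) (p : P) :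
    IsCompl (normalFamily g ι p) (tangentFamily ι p) := by
  have hfit := Fits.self ι p
  constructor
  · rw [Submodule.disjoint_def]
    rintro n hn ⟨v, rfl⟩
    by_contra hne
    exact (g.pos _ _ hne).ne' (hn v)
  · rw [codisjoint_iff, Submodule.eq_top_iff']
    intro w
    let e := dChartEquiv (ι p) (ι p) hfit.2
    let A := fderiv ℝ (mapInChart (n := 3) (m := 6) p (ι p) ι) (extChartAt (𝓡 3) p p)
    let G := metricOp g (ι p) (extChartAt (𝓡 6) (ι p) (ι p))
    refine Submodule.mem_sup.2 ⟨e.symm (normalProj G A (e w)), ?_,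
      w - e.symm (normalProj G A (e w)), ?_, by abel⟩
    · refine (mem_normalFamily_iff hfit (hι p)).2 fun u => ?_
      rw [← dChartEquiv_apply _ _ hfit.2, LinearEquiv.apply_symm_apply]
      exact normalProj_orthogonal
        (fun u hu => metricOp_pos ((extChartAt (𝓡 6) (ι p)).map_source hfit.2) hu)
        (fderiv_mapInChart_injective hfit (hι p) (hinj p)) u
    · obtain ⟨v, hv⟩ := (dChartEquiv p p hfit.1).surjective ((gram G A).inverse ((G (e w)).comp A))
      refine ⟨v, e.injective ?_⟩
      rw [map_sub, LinearEquiv.apply_symm_apply]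
      refine (dChart_mfderiv hfit.1 hfit.2 ((hι p).mdifferentiableAt (by simp)) v).trans ?_
      rw [← dChartEquiv_apply _ _ hfit.1, hv, normalProj, sub_sub_cancel]

open Classical in
-- Keep the coordinates of w fixed in a chart, project them to the normal space at each nearby
-- point, and multiply by a bump function. At p the bump function is 1 and the projection fixes w,
-- which is already normal.
lemma exists_section_normalFamily [T2Space P] (hι : ContMDiff (𝓡 3) (𝓡 6) ∞ ι)
    (hinj : ∀ p, Function.Injective (mfderiv (𝓡 3) (𝓡 6) ι p)) (p : P)
    {w : TangentSpace (𝓡 6) (ι p)} (hw : w ∈ normalFamily g ι p) :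
    ∃ n : ∀ q, TangentSpace (𝓡 6) (ι q),
      IsSmoothField ι n ∧ (∀ q, n q ∈ normalFamily g ι q) ∧ n p = w := by
  have hfit := Fits.self ι p
  obtain ⟨f, -, hf⟩ := (SmoothBumpFunction.nhds_basis_tsupport (I := 𝓡 3) p).mem_iff.1
    (hfit.eventually hι.continuous.continuousAt)
  let A := fderiv ℝ (mapInChart (n := 3) (m := 6) p (ι p) ι)
  let G := fun y => metricOp g (ι p) (mapInChart (n := 3) (m := 6) p (ι p) ι y)
  let z := fun q => normalProj (G (extChartAt (𝓡 3) p q)) (A (extChartAt (𝓡 3) p q))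
    (dChart (ι p) (ι p) w)
  have hG : ∀ q, Fits p (ι p) ι q →
      G (extChartAt (𝓡 3) p q) = metricOp g (ι p) (extChartAt (𝓡 6) (ι p) (ι q)) := fun q hq => by
    simp only [G, mapInChart, (extChartAt (𝓡 3) p).left_inv hq.1]
  have hpos : ∀ q, Fits p (ι p) ι q → ∀ u, u ≠ 0 → 0 < G (extChartAt (𝓡 3) p q) u u :=
    fun q hq u hu => by
      rw [hG q hq]
      exact metricOp_pos ((extChartAt (𝓡 6) (ι p)).map_source hq.2) hu
  have hz : ∀ q, Fits p (ι p) ι q →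
      ContMDiffAt (𝓡 3) 𝓘(ℝ, EuclideanSpace ℝ (Fin 6)) ∞ z q := fun q hq => by
    have hmap := contDiffAt_mapInChart hq.1 hq.2 (hι q)
    have h1 : ContDiffAt ℝ ∞ (fun y => normalProj (G y) (A y) (dChart (ι p) (ι p) w))
        (extChartAt (𝓡 3) p q) := by
      refine contDiffAt_normalProj ?_ (hmap.fderiv_right (by simp)) _ (hpos q hq)
        (fderiv_mapInChart_injective hq (hι q) (hinj q))
      refine ContDiffAt.comp (g := metricOp g (ι p)) _ (contDiffAt_metricOp ?_) hmap
      simp only [mapInChart, (extChartAt (𝓡 3) p).left_inv hq.1]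
      exact (extChartAt (𝓡 6) (ι p)).map_source hq.2
    exact ContMDiffAt.comp (g := fun y => normalProj (G y) (A y) (dChart (ι p) (ι p) w)) q
      h1.contMDiffAt (contMDiffAt_chart_comp (f := id) hq.1 contMDiffAt_id)
  let n : ∀ q, TangentSpace (𝓡 6) (ι q) := fun q =>
    if hq : Fits p (ι p) ι q then (dChartEquiv (ι p) (ι q) hq.2).symm (f q • z q) else 0
  have hn : ∀ q, Fits p (ι p) ι q → dChart (ι p) (ι q) (n q) = f q • z q := fun q hq => by
    rw [← dChartEquiv_apply _ _ hq.2]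
    simp only [n, dif_pos hq, LinearEquiv.apply_symm_apply]
  refine ⟨n, fun q => ?_, fun q => ?_, ?_⟩
  · by_cases hq : q ∈ tsupport f
    · refine (contMDiffAt_dChart (hf hq).2).2 ⟨hι q, ?_⟩
      refine (f.contMDiffAt.smul (hz q (hf hq))).congr_of_eventuallyEq ?_
      filter_upwards [(hf hq).eventually hι.continuous.continuousAt] with q' hq' using hn q' hq'
    · have h0 : IsSmoothField ι (fun q => (0 : TangentSpace (𝓡 6) (ι q))) :=
        (Bundle.contMDiff_zeroSection ℝ (TangentSpace (𝓡 6))).comp hι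
      refine (h0 q).congr_of_eventuallyEq ?_
      filter_upwards [(isClosed_tsupport f).isOpen_compl.mem_nhds hq] with q' hq'
      have h1 : f q' = 0 := image_eq_zero_of_notMem_tsupport hq'
      have h2 : n q' = 0 := by
        simp only [n, h1, zero_smul, map_zero, dite_eq_ite, ite_self]
      rw [h2]
  · by_cases hq : Fits p (ι p) ι q
    · refine (mem_normalFamily_iff hq (hι q)).2 fun u => ?_
      have h1 := normalProj_orthogonal (w := dChart (ι p) (ι p) w) (hpos q hq)
        (fderiv_mapInChart_injective hq (hι q) (hinj q)) u
      rw [hn q hq, map_smul, ← hG q hq]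
      exact (congrArg (f q • ·) h1).trans (smul_zero _)
    · simp only [n, dif_neg hq]
      exact zero_mem _
  · refine (dChartEquiv (ι p) (ι p) hfit.2).injective ?_
    rw [dChartEquiv_apply, hn p hfit, f.eq_one, one_smul]
    refine normalProj_of_orthogonal fun e => ?_
    rw [hG p hfit]
    exact (mem_normalFamily_iff hfit (hι p)).1 hw e

end Normal

/-! ### The centre of a slice -/

section Centre

variable {M : Type*} [TopologicalSpace M] [ChartedSpace (EuclideanSpace ℝ (Fin 6)) M]
  [IsManifold (𝓡 6) ∞ M] {P : Type*} [TopologicalSpace P]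
  [ChartedSpace (EuclideanSpace ℝ (Fin 3)) P] {ι : P → M}

lemma isExp_zero (g : RMetric M) (x : M) : IsExp g x 0 x := by
  refine ⟨fun _ => x, 1, one_pos, ⟨contMDiffOn_const, fun t _ c _ w => ?_⟩, ?_, rfl⟩
  · have h0 : ∀ y v, metricInChart g c y 0 v = 0 := fun y v => by
      rw [← metricOp_apply, map_zero]
      rfl
    simp only [deriv_const', h0, fderiv_fun_const]
    simp
  · rw [velocity, mfderiv_const]
    rfl

lemma isSlicePoint_zero (g : RMetric M) (hι : ContMDiff (𝓡 3) (𝓡 6) ∞ ι) :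
    IsSlicePoint g ι (fun _ => 0) ι where
  smooth := (Bundle.contMDiff_zeroSection ℝ (TangentSpace (𝓡 6))).comp hι
  normal := fun _ => zero_mem _
  exp := fun p => isExp_zero g (ι p)

end Centre

/-! ### Geodesics in charts -/

section Geodesic

lemma contDiffAt_deriv {F : Type*} [NormedAddCommGroup F] [NormedSpace ℝ F] {x : ℝ → F} {t : ℝ}
    (h : ContDiffAt ℝ ∞ x t) : ContDiffAt ℝ ∞ (deriv x) t := by
  have h1 : ContDiffAt ℝ ∞ (fun s => fderiv ℝ x s 1) t :=
    (h.fderiv_right (by simp)).clm_apply contDiffAt_const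
  simpa only [fderiv_apply_one_eq_deriv] using h1

set_option maxSynthPendingDepth 3 in
/-- Solutions `b` of the geodesic equation are quadratically bounded. -/
lemma exists_acceleration_bound_of_contDiffAt {F : Type*} [NormedAddCommGroup F] [NormedSpace ℝ F]
    [FiniteDimensional ℝ F] {G : F → F →L[ℝ] F →L[ℝ] ℝ} {x₀ : F} (hsm : ContDiffAt ℝ ∞ G x₀)
    (hpos : ∀ u, u ≠ 0 → 0 < G x₀ u u) {U : Set F} (hU : U ∈ 𝓝 x₀) :
    ∃ r > 0, ∃ C > 0, Metric.closedBall x₀ r ⊆ U ∧ ∀ y ∈ Metric.closedBall x₀ r, ∀ b u : F,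
      (∀ w, G y b w + fderiv ℝ G y u u w - (1 / 2) * fderiv ℝ G y w u u = 0) →
      ‖b‖ ≤ C * ‖u‖ ^ 2 := by
  have hinv : (G x₀).IsInvertible :=
    gram_isInvertible (A := ContinuousLinearMap.id ℝ F) hpos Function.injective_id
  set K := ‖(G x₀).inverse‖ + 1 with hK
  have hK0 : 0 < K := by positivity
  have hlow : ∀ b, ‖b‖ ≤ K * ‖G x₀ b‖ := fun b => by
    have h1 : (G x₀).inverse (G x₀ b) = b := hinv.inverse_apply_eq.2 rfl
    calc ‖b‖ = ‖(G x₀).inverse (G x₀ b)‖ := by rw [h1]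
      _ ≤ ‖(G x₀).inverse‖ * ‖G x₀ b‖ := ContinuousLinearMap.le_opNorm _ _
      _ ≤ K * ‖G x₀ b‖ := by gcongr; simp [hK]
  set B := ‖fderiv ℝ G x₀‖ + 1 with hB
  have hB0 : 0 < B := by positivity
  -- The tolerance 1/(2K) is such that replacing G(x₀) by G(y) costs at most ‖b‖/2, which can be
  -- absorbed.
  have e1 : ∀ᶠ y in 𝓝 x₀, ‖G y - G x₀‖ < 1 / (2 * K) := by
    have h1 : Filter.Tendsto (fun y => ‖G y - G x₀‖) (𝓝 x₀) (𝓝 ‖G x₀ - G x₀‖) :=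
      (hsm.continuousAt.sub continuousAt_const).norm
    rw [sub_self, norm_zero] at h1
    exact h1.eventually_lt_const (by positivity)
  have e2 : ∀ᶠ y in 𝓝 x₀, ‖fderiv ℝ G y‖ < B :=
    (hsm.fderiv_right (m := 0) (by simp)).continuousAt.norm.eventually_lt_const (by simp [hB])
  obtain ⟨r, hr, hball⟩ := Metric.nhds_basis_closedBall.eventually_iff.1
    ((e1.and e2).and hU)
  refine ⟨r, hr, 3 * K * B, by positivity, fun y hy => (hball hy).2, fun y hy b u h => ?_⟩
  obtain ⟨⟨h1, h2⟩, -⟩ := hball hy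
  -- The equation expresses G(y) b by the two derivative terms, with weights 1 and 1/2; hence 3/2.
  -- After the absorption of ‖b‖/2 this doubles to the constant 3 K B.
  have h4 : ‖G y b‖ ≤ 3 / 2 * B * ‖u‖ ^ 2 := by
    refine ContinuousLinearMap.opNorm_le_bound _ (by positivity) fun w => ?_
    have k1 : ∀ v v' v'' : F,
        ‖fderiv ℝ G y v v' v''‖ ≤ B * ‖v‖ * ‖v'‖ * ‖v''‖ := fun v v' v'' =>
      ((fderiv ℝ G y v v').le_opNorm v'').trans (by
        gcongr
        refine ((fderiv ℝ G y v).le_opNorm v').trans ?_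
        gcongr
        refine ((fderiv ℝ G y).le_opNorm v).trans ?_
        gcongr)
    have k2 : G y b w = (1 / 2) * fderiv ℝ G y w u u - fderiv ℝ G y u u w := by linarith [h w]
    have k3 := k1 w u u
    have k4 := k1 u u w
    rw [k2, Real.norm_eq_abs, abs_le]
    rw [Real.norm_eq_abs, abs_le] at k3 k4
    constructor <;> nlinarith
  have h5 : ‖G x₀ b‖ ≤ ‖G y b‖ + 1 / (2 * K) * ‖b‖ := by
    have k1 : G x₀ b = G y b - (G y - G x₀) b := by simp
    rw [k1]
    refine (norm_sub_le _ _).trans ?_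
    gcongr
    refine ((G y - G x₀).le_opNorm b).trans ?_
    gcongr
  have h6 := hlow b
  have h7 : K * ‖G x₀ b‖ ≤ K * (3 / 2 * B * ‖u‖ ^ 2) + ‖b‖ / 2 := by
    calc K * ‖G x₀ b‖ ≤ K * (3 / 2 * B * ‖u‖ ^ 2 + 1 / (2 * K) * ‖b‖) := by
          gcongr; exact h5.trans (by gcongr)
      _ = _ := by field_simp
  nlinarith

variable {M : Type*} [TopologicalSpace M] [ChartedSpace (EuclideanSpace ℝ (Fin 6)) M]
  [IsManifold (𝓡 6) ∞ M] {g : RMetric M} {c : M}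

lemma fderiv_metricInChart {y : EuclideanSpace ℝ (Fin 6)} (hy : y ∈ (extChartAt (𝓡 6) c).target)
    (u v w : EuclideanSpace ℝ (Fin 6)) :
    fderiv ℝ (fun y => metricInChart g c y u v) y w = fderiv ℝ (metricOp g c) y w u v := by
  have h1 := ((contDiffAt_metricOp (g := g) hy).differentiableAt (by simp)).hasFDerivAt
  have h2 := (h1.clm_apply (hasFDerivAt_const u y)).clm_apply (hasFDerivAt_const v y)
  have h3 : HasFDerivAt (fun y => metricInChart g c y u v) _ y := h2
  rw [h3.fderiv]
  simp

/-- Near each point of a chart, the acceleration of a geodesic is bounded by a multiple of the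
square of its speed. -/
lemma exists_acceleration_bound {x₀ : EuclideanSpace ℝ (Fin 6)}
    (hx₀ : x₀ ∈ (extChartAt (𝓡 6) c).target) :
    ∃ r > 0, ∃ C > 0, Metric.closedBall x₀ r ⊆ (extChartAt (𝓡 6) c).target ∧
      ∀ y ∈ Metric.closedBall x₀ r, ∀ b u : EuclideanSpace ℝ (Fin 6),
        (∀ w, metricInChart g c y b w + fderiv ℝ (fun y => metricInChart g c y u w) y u
          - (1 / 2) * fderiv ℝ (fun y => metricInChart g c y u u) y w = 0) →
        ‖b‖ ≤ C * ‖u‖ ^ 2 := by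
  obtain ⟨r, hr, C, hC, hball, h⟩ := exists_acceleration_bound_of_contDiffAt
    (contDiffAt_metricOp (g := g) hx₀) (fun _ hu => metricOp_pos hx₀ hu)
    ((isOpen_extChartAt_target (I := 𝓡 6) c).mem_nhds hx₀)
  refine ⟨r, hr, C, hC, hball, fun y hy b u hb => h y hy b u fun w => ?_⟩
  rw [← fderiv_metricInChart (hball hy), ← fderiv_metricInChart (hball hy)]
  exact hb w

/-- A geodesic with small initial velocity is close to a straight line. -/
lemma IsGeodesicOn.norm_sub_le [T2Space M] {γ : ℝ → M} {δ : ℝ} (hδ : 0 < δ)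
    (hγ : IsGeodesicOn g γ (-δ) (1 + δ)) (h0 : γ 0 ∈ (extChartAt (𝓡 6) c).source) {r C η : ℝ}
    (hr : Metric.closedBall (extChartAt (𝓡 6) c (γ 0)) r ⊆ (extChartAt (𝓡 6) c).target)
    (hC : 0 < C)
    (hacc : ∀ y ∈ Metric.closedBall (extChartAt (𝓡 6) c (γ 0)) r,
      ∀ b u : EuclideanSpace ℝ (Fin 6),
        (∀ w, metricInChart g c y b w + fderiv ℝ (fun y => metricInChart g c y u w) y u
          - (1 / 2) * fderiv ℝ (fun y => metricInChart g c y u u) y w = 0) → ‖b‖ ≤ C * ‖u‖ ^ 2)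
    (hv : ‖deriv (fun s => extChartAt (𝓡 6) c (γ s)) 0‖ < η) (hηr : 2 * η < r)
    (hηC : 4 * C * η < 1) :
    ‖extChartAt (𝓡 6) c (γ 1) - extChartAt (𝓡 6) c (γ 0) -
      deriv (fun s => extChartAt (𝓡 6) c (γ s)) 0‖ ≤ 4 * C * η ^ 2 := by
  set x := fun s => extChartAt (𝓡 6) c (γ s) with hx
  have hη : 0 < η := (norm_nonneg _).trans_lt hv
  have hIcc : ∀ t ∈ Icc (0 : ℝ) 1, t ∈ Ioo (-δ) (1 + δ) := fun t ht =>
    ⟨by linarith [ht.1], by linarith [ht.2]⟩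
  have hγt : ∀ t ∈ Icc (0 : ℝ) 1, ContMDiffAt 𝓘(ℝ, ℝ) (𝓡 6) ∞ γ t := fun t ht =>
    hγ.1.contMDiffAt (isOpen_Ioo.mem_nhds (hIcc t ht))
  have hxt : ∀ t ∈ Icc (0 : ℝ) 1, γ t ∈ (extChartAt (𝓡 6) c).source → ContDiffAt ℝ ∞ x t :=
    fun t ht hs => contMDiffAt_iff_contDiffAt.1 (contMDiffAt_chart_comp (m := 6) hs (hγt t ht))
  let K := (extChartAt (𝓡 6) c).symm '' Metric.closedBall (x 0) r
  have hK : IsCompact K := (isCompact_closedBall _ _).image_of_continuousOn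
    ((continuousOn_extChartAt_symm c).mono hr)
  have hKsource : ∀ z ∈ K, z ∈ (extChartAt (𝓡 6) c).source ∧
      extChartAt (𝓡 6) c z ∈ Metric.closedBall (x 0) r := by
    rintro _ ⟨y, hy, rfl⟩
    exact ⟨(extChartAt (𝓡 6) c).map_target (hr hy), by
      rwa [(extChartAt (𝓡 6) c).right_inv (hr hy)]⟩
  have hmemK : ∀ z ∈ (extChartAt (𝓡 6) c).source,
      extChartAt (𝓡 6) c z ∈ Metric.closedBall (x 0) r → z ∈ K :=
    fun z hz hz' => ⟨_, hz', (extChartAt (𝓡 6) c).left_inv hz⟩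
  -- The good region of a continuity argument: the geodesic is still in the closed coordinate ball
  -- and its speed is at most 2η, so its acceleration is at most C (2η)² = 4 C η².
  let S := {t : ℝ | γ t ∈ K ∧ ‖deriv x t‖ ≤ 2 * η}
  -- the estimates as long as the geodesic stays in the good region
  have hvel : ∀ t ∈ Icc (0 : ℝ) 1, Icc 0 t ⊆ S → ∀ s ∈ Icc 0 t,
      ‖deriv x s - deriv x 0‖ ≤ 4 * C * η ^ 2 := by
    intro t ht hS s hs
    have hsub : ∀ s ∈ Icc 0 t, s ∈ Icc (0 : ℝ) 1 := fun s hs => ⟨hs.1, hs.2.trans ht.2⟩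
    have h1 := norm_image_sub_le_of_norm_deriv_le_segment' (f := deriv x) (f' := deriv (deriv x))
      (a := 0) (b := t) (C := 4 * C * η ^ 2)
      (fun s hs => ((contDiffAt_deriv (hxt s (hsub s hs)
        (hKsource _ (hS hs).1).1)).differentiableAt (by simp)).hasDerivAt.hasDerivWithinAt)
      (fun s hs => by
        have hs' : s ∈ Icc 0 t := ⟨hs.1, hs.2.le⟩
        have hk := hKsource _ (hS hs').1
        have h2 := hacc (x s) hk.2 (deriv (deriv x) s) (deriv x s)
          (fun w => hγ.2 s (hIcc s (hsub s hs')) c (by rw [← extChartAt_source (𝓡 6)]; exact hk.1) w)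
        have h3 : ‖deriv x s‖ ^ 2 ≤ (2 * η) ^ 2 :=
          pow_le_pow_left₀ (norm_nonneg _) (hS hs').2 2
        nlinarith) s hs
    refine h1.trans ?_
    have h4 : s - 0 ≤ 1 := by linarith [(hsub s hs).2]
    exact mul_le_of_le_one_right (by positivity) h4
  have hfar : ∀ t ∈ Icc (0 : ℝ) 1, Icc 0 t ⊆ S → ‖x t - x 0‖ ≤ 2 * η := by
    intro t ht hS
    have h1 := norm_image_sub_le_of_norm_deriv_le_segment' (f := x) (f' := deriv x)
      (a := 0) (b := t) (C := 2 * η)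
      (fun s hs => ((hxt s ⟨hs.1, hs.2.trans ht.2⟩
        (hKsource _ (hS hs).1).1).differentiableAt (by simp)).hasDerivAt.hasDerivWithinAt)
      (fun s hs => (hS ⟨hs.1, hs.2.le⟩).2) t (right_mem_Icc.2 ht.1)
    exact h1.trans (mul_le_of_le_one_right (by positivity) (by linarith [ht.2]))
  have hclosed : IsClosed (S ∩ Icc 0 1) := by
    have h1 : IsClosed (Icc (0 : ℝ) 1 ∩ γ ⁻¹' K) :=
      ContinuousOn.preimage_isClosed_of_isClosed
        (fun t ht => (hγt t ht).continuousAt.continuousWithinAt) isClosed_Icc hK.isClosed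
    have h2 : IsClosed ((Icc (0 : ℝ) 1 ∩ γ ⁻¹' K) ∩ (fun t => ‖deriv x t‖) ⁻¹' Iic (2 * η)) :=
      ContinuousOn.preimage_isClosed_of_isClosed
        (fun t ht => (contDiffAt_deriv (hxt t ht.1
          (hKsource _ ht.2).1)).continuousAt.norm.continuousWithinAt) h1 isClosed_Iic
    convert h2 using 1
    ext t
    constructor
    · exact fun h => ⟨⟨h.2, h.1.1⟩, h.1.2⟩
    · exact fun h => ⟨⟨h.1.2, h.2⟩, h.1.1⟩
  -- The bounds defining S improve to strict ones on S: the speed is below η + 4 C η² < 2η because 4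
  -- C η < 1, and the distance is at most 2η < r. So the good region can be prolonged to the right
  -- and, being closed, contains all of [0, 1].
  have hall : Icc (0 : ℝ) 1 ⊆ S := by
    refine hclosed.Icc_subset_of_forall_mem_nhdsGT_of_Icc_subset ⟨hmemK _ h0 ?_, ?_⟩ ?_
    · exact Metric.mem_closedBall_self (by linarith)
    · linarith
    · intro t ht hS
      have ht' : t ∈ Icc (0 : ℝ) 1 := ⟨ht.1, ht.2.le⟩
      have hsrc := (hKsource _ (hS (right_mem_Icc.2 ht.1)).1).1
      have h1 := hvel t ht' hS t (right_mem_Icc.2 ht.1)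
      have h2 := hfar t ht' hS
      have h3 : ‖deriv x t‖ < 2 * η := by
        have h4 := norm_add_le (deriv x t - deriv x 0) (deriv x 0)
        rw [sub_add_cancel] at h4
        nlinarith
      refine nhdsWithin_le_nhds ?_
      filter_upwards [(hγt t ht').continuousAt.eventually_mem
          ((isOpen_extChartAt_source (I := 𝓡 6) c).mem_nhds hsrc),
        (hxt t ht' hsrc).continuousAt.eventually_mem (Metric.isOpen_ball.mem_nhds
          (show x t ∈ Metric.ball (x 0) r by rw [mem_ball_iff_norm]; linarith)),
        (contDiffAt_deriv (hxt t ht' hsrc)).continuousAt.norm.eventually_lt_const h3]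
        with s k1 k2 k3
      exact ⟨hmemK _ k1 (Metric.ball_subset_closedBall k2), k3.le⟩
  -- Integrating the bound on x' − x'(0) over [0, 1] compares the geodesic with its tangent line.
  have hfin := norm_image_sub_le_of_norm_deriv_le_segment' (f := fun s => x s - s • deriv x 0)
    (f' := fun s => deriv x s - deriv x 0) (a := 0) (b := 1) (C := 4 * C * η ^ 2)
    (fun s hs => by
      have h1 := ((hxt s hs (hKsource _ (hall hs).1).1).differentiableAt (by simp)).hasDerivAt
      have h2 := (hasDerivAt_id s).smul_const (deriv x 0)
      rw [one_smul] at h2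
      exact (h1.sub h2).hasDerivWithinAt)
    (fun s hs => hvel 1 ⟨zero_le_one, le_rfl⟩ hall s ⟨hs.1, hs.2.le⟩) 1 ⟨zero_le_one, le_rfl⟩
  have e : x 1 - x 0 - deriv x 0 = x 1 - (1 : ℝ) • deriv x 0 - (x 0 - (0 : ℝ) • deriv x 0) := by
    rw [one_smul, zero_smul, sub_zero]
    abel
  rw [e]
  simpa using hfin

end Geodesic

/-! ### Velocities of curves in a slice -/

section SliceTangent

variable {M : Type*} [TopologicalSpace M] [T2Space M] [ChartedSpace (EuclideanSpace ℝ (Fin 6)) M]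
  [IsManifold (𝓡 6) ∞ M] {g : RMetric M}

/-- The exponential map agrees with the identity to first order at zero. -/
lemma exists_exp_bound {c x : M} (hx : x ∈ (extChartAt (𝓡 6) c).source) :
    ∃ η₀ > 0, ∃ C, 0 ≤ C ∧ ∀ (η : ℝ) (v : TangentSpace (𝓡 6) x) (y : M), η < η₀ →
      ‖dChart c x v‖ < η → IsExp g x v y →
      ‖extChartAt (𝓡 6) c y - extChartAt (𝓡 6) c x - dChart c x v‖ ≤ C * η ^ 2 := by
  obtain ⟨r, hr, C, hC, hball, hacc⟩ :=
    exists_acceleration_bound (g := g) ((extChartAt (𝓡 6) c).map_source hx)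
  -- The two entries are exactly the smallness conditions 2η < r and 4 C η < 1 of the geodesic
  -- estimate.
  refine ⟨min (r / 2) (1 / (4 * C)), lt_min (by positivity) (by positivity), 4 * C, by positivity,
    ?_⟩
  rintro η v y hη hv ⟨γ, δ, hδ, hγ, hvel, rfl⟩
  have h0 : γ 0 = x := congrArg TotalSpace.proj hvel
  have h0s : γ 0 ∈ (extChartAt (𝓡 6) c).source := h0 ▸ hx
  have hd : MDifferentiableAt 𝓘(ℝ, ℝ) (𝓡 6) γ 0 :=
    (hγ.1.contMDiffAt (isOpen_Ioo.mem_nhds ⟨by linarith, by linarith⟩)).mdifferentiableAt (by simp)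
  have h1 := (dChart_mfderiv_curve (c := c) h0s hd).symm.trans (dChart_congr (c := c) hvel)
  have h2 := lt_min_iff.1 hη
  have h3 : 4 * C * η < 1 := by
    have := (lt_div_iff₀ (by positivity)).1 h2.2
    linarith
  rw [← h1] at hv ⊢
  rw [← h0] at hball hacc ⊢
  exact hγ.norm_sub_le hδ h0s hball hC hacc hv (by linarith [h2.1]) h3

variable {P : Type*} [TopologicalSpace P] [ChartedSpace (EuclideanSpace ℝ (Fin 3)) P]
  [IsManifold (𝓡 3) ∞ P] {ι : P → M}

/-- As n_0 = 0 and n_s is differentiable in s, n_s is O(s), and the exponential estimate gives I_s =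
ι + n_s + O(s²) in a chart. The velocity is therefore the derivative of s ↦ n_s(p) at 0, a curve in
the fixed linear subspace of normal vectors at p. -/
lemma exists_velocity_of_isSliceCurve (hι : ContMDiff (𝓡 3) (𝓡 6) ∞ ι) {lam : P → ℝ} {ε : ℝ}
    {Λ : ℝ → P → ℝ} {I : ℝ → P → M} {n : ℝ → ∀ p, TangentSpace (𝓡 6) (ι p)}
    (h : IsSliceCurve g ι (fun _ => 0) lam ι ε Λ I n) (p : P) :
    ∃ w ∈ normalFamily g ι p, velocity (fun s => I s p) 0 = tv (ι p) w := by
  have hfit := Fits.self ι p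
  have hε := h.curve.pos
  have hmem : Ioo (-ε) ε ∈ 𝓝 (0 : ℝ) := isOpen_Ioo.mem_nhds ⟨by linarith, hε⟩
  have hmemP : Ioo (-ε) ε ×ˢ (univ : Set P) ∈ 𝓝 ((0 : ℝ), p) :=
    prod_mem_nhds hmem Filter.univ_mem
  have hs : ContMDiffAt 𝓘(ℝ, ℝ) (𝓘(ℝ, ℝ).prod (𝓡 3)) ∞ (fun s : ℝ => (s, p)) 0 :=
    contMDiffAt_id.prodMk contMDiffAt_const
  have hI0 : I 0 p = ι p := congrFun h.curve.init_map p
  have hIs : ContMDiffAt 𝓘(ℝ, ℝ) (𝓡 6) ∞ (fun s => I s p) 0 :=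
    ContMDiffAt.comp (g := fun q : ℝ × P => I q.1 q.2) (f := fun s : ℝ => (s, p)) (0 : ℝ)
      (h.curve.smooth_map.contMDiffAt hmemP) hs
  have hns : ContMDiffAt 𝓘(ℝ, ℝ) (𝓡 6).tangent ∞ (fun s => tv (ι p) (n s p)) 0 :=
    ContMDiffAt.comp (g := fun q : ℝ × P => tv (ι q.2) (n q.1 q.2)) (f := fun s : ℝ => (s, p))
      (0 : ℝ) (h.smooth.contMDiffAt hmemP) hs
  let e := extChartAt (𝓡 6) (ι p)
  let u : ℝ → EuclideanSpace ℝ (Fin 6) := fun s => dChart (ι p) (ι p) (n s p)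
  have hu : HasDerivAt u (deriv u 0) 0 :=
    ((contMDiffAt_iff_contDiffAt.1 ((contMDiffAt_dChart (f := fun _ : ℝ => ι p) (w := (0 : ℝ))
      (u := fun s => n s p) hfit.2).1 hns).2).differentiableAt (by simp)).hasDerivAt
  have hu0 : u 0 = 0 := by
    change dChart (ι p) (ι p) (n 0 p) = 0
    rw [h.init, map_zero]
  obtain ⟨η₀, hη₀, C, hC, hexp⟩ := exists_exp_bound (g := g) hfit.2
  -- the difference of the curve and the field is of second order
  have hO : (fun s => e (I s p) - e (ι p) - u s) =O[𝓝 0] fun s : ℝ => ‖s - 0‖ ^ 2 := by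
    let K := ‖deriv u 0‖ + 1
    have hK : 0 < K := by positivity
    have hlit : ∀ᶠ s in 𝓝 (0 : ℝ), ‖u s‖ ≤ K * ‖s‖ := by
      have h1 := (hasDerivAt_iff_isLittleO.1 hu).bound (c := 1) one_pos
      filter_upwards [h1] with s hs
      rw [hu0, sub_zero, sub_zero, one_mul] at hs
      have h2 := norm_add_le (u s - s • deriv u 0) (s • deriv u 0)
      rw [sub_add_cancel, norm_smul] at h2
      calc ‖u s‖ ≤ _ := h2
        _ ≤ ‖s‖ + ‖s‖ * ‖deriv u 0‖ := by gcongr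
        _ = K * ‖s‖ := by ring
    -- K + 1 instead of K, because the exponential estimate requires a strict bound on the initial
    -- velocity. This works for s ≠ 0; the case s = 0 is treated separately.
    have hsmall : ∀ᶠ s in 𝓝 (0 : ℝ), (K + 1) * ‖s‖ < η₀ := by
      have h1 : Filter.Tendsto (fun s : ℝ => (K + 1) * ‖s‖) (𝓝 0) (𝓝 ((K + 1) * ‖(0 : ℝ)‖)) :=
        (continuous_const.mul continuous_norm).tendsto 0
      rw [norm_zero, mul_zero] at h1
      exact h1.eventually_lt_const hη₀
    refine Asymptotics.IsBigO.of_bound (C * (K + 1) ^ 2) ?_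
    filter_upwards [hlit, hsmall, hmem] with s h1 h2 h3
    rw [sub_zero, norm_pow, norm_norm]
    rcases eq_or_ne s 0 with rfl | hne
    · rw [hI0, hu0]
      simp
    · have hpos : 0 < ‖s‖ := norm_pos_iff.2 hne
      have h4 := hexp ((K + 1) * ‖s‖) (n s p) (I s p) h2 (h1.trans_lt (by nlinarith))
        ((h.slice s h3).exp p)
      refine h4.trans_eq (by ring)
  have hz : HasDerivAt (fun s => e (I s p)) (deriv u 0) 0 := by
    have h1 : HasDerivAt (fun s => e (I s p) - e (ι p) - u s) 0 0 :=
      (hO.hasFDerivAt one_lt_two).hasDerivAt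
    have h2 := (h1.add hu).add_const (e (ι p))
    rw [zero_add] at h2
    refine h2.congr_of_eventuallyEq (Filter.Eventually.of_forall fun s => ?_)
    simp only [Pi.add_apply]
    abel
  have hw := LinearEquiv.apply_symm_apply (dChartEquiv (ι p) (ι p) hfit.2) (deriv u 0)
  rw [dChartEquiv_apply] at hw
  refine ⟨(dChartEquiv (ι p) (ι p) hfit.2).symm (deriv u 0), ?_, ?_⟩
  · refine (mem_normalFamily_iff hfit (hι p)).2 fun v => ?_
    rw [hw]
    -- Pairing with a fixed tangent vector is a fixed linear functional that vanishes on every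
    -- n_s(p), so it also vanishes on the derivative.
    let l := (metricOp g (ι p) (e (ι p))).flip
      (fderiv ℝ (mapInChart (n := 3) (m := 6) p (ι p) ι) (extChartAt (𝓡 3) p p) v)
    have h1 : HasDerivAt (fun s => l (u s)) (l (deriv u 0)) 0 :=
      l.hasFDerivAt.comp_hasDerivAt (0 : ℝ) hu
    have h2 : HasDerivAt (fun s => l (u s)) 0 0 := by
      refine (hasDerivAt_const (0 : ℝ) (0 : ℝ)).congr_of_eventuallyEq ?_
      filter_upwards [hmem] with s hs
      exact (mem_normalFamily_iff hfit (hι p)).1 ((h.slice s hs).normal p) v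
    exact h1.unique h2
  · have hs0 : I 0 p ∈ (extChartAt (𝓡 6) (ι p)).source := hI0 ▸ hfit.2
    refine tv_eq_of_dChart (c := ι p) hs0 hI0 ?_
    rw [hw]
    exact (dChart_mfderiv_curve (γ := fun s => I s p) hs0
      (hIs.mdifferentiableAt (by simp))).trans hz.deriv

lemma isSliceTangentBundle_normalFamily [T2Space P] (hι : ContMDiff (𝓡 3) (𝓡 6) ∞ ι)
    (hinj : ∀ p, Function.Injective (mfderiv (𝓡 3) (𝓡 6) ι p)) (lam : P → ℝ) :
    IsSliceTangentBundle g ι (fun _ => 0) lam ι (normalFamily g ι) where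
  compl := isCompl_normalFamily hι hinj
  extend := fun p _ hw => exists_section_normalFamily hι hinj p hw
  tangent := fun _ _ _ _ h p => exists_velocity_of_isSliceCurve hι h p

end SliceTangent

end PerturbedSL

theorem mainTheorem2
    {M : Type*} [TopologicalSpace M] [T2Space M] [SecondCountableTopology M]
    [ChartedSpace (EuclideanSpace ℝ (Fin 6)) M] [IsManifold (𝓡 6) ∞ M]
    {P : Type*} [TopologicalSpace P] [T2Space P] [CompactSpace P]
    [ChartedSpace (EuclideanSpace ℝ (Fin 3)) P] [IsManifold (𝓡 3) ∞ P]
    (θ : DForm 3 3 P) (hθ : IsOrientationForm θ)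
    (ρ' : DForm 6 3 M) (om' : DForm 6 2 M) (h' : IsClosedG2Pair32 ρ' om')
    (g : RMetric M) (hg : IsInducedMetric g ρ' om')
    (ρ : DForm 6 3 M) (τ : DForm 6 4 M) (h : IsClosedG2Pair34 ρ τ)
    (htame : ∀ x, Tames (cyl3 ρ' om' x) (cyl4 ρ τ x))
    (ρhat : DForm 6 3 M) (hhat : IsSmoothForm ρhat)
    (hdual : ∀ x, IsHitchinDual (ρ x).toAlternatingMap (ρhat x).toAlternatingMap)
    (lam : P → ℝ) (hlam : ContMDiff (𝓡 3) 𝓘(ℝ, ℝ) ∞ lam)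
    (ι : P → M) (hι : IsAdmissible θ ρhat ρ' ι) (hsol : IsSolution ρ τ lam ι) :
    IsSlicePoint g ι (fun _ => 0) ι ∧
    IsSliceTangentBundle g ι (fun _ => 0) lam ι (normalFamily g ι) ∧
    ∀ (ι₀ : P → M) (ν : ∀ p, TangentSpace (𝓡 6) (ι₀ p)) (W : SubFamily ι),
      IsAdmissible θ ρhat ρ' ι₀ → IsSlicePoint g ι₀ ν ι →
      IsSliceTangentBundle g ι₀ ν lam ι W →
      ∃ D : Dom ι hι.embedding.contMDiff W →ₗ[ℝ] Cod ι hι.embedding.contMDiff W,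
        IsLinearization ρ τ lam D ∧
        (∀ D' : Dom ι hι.embedding.contMDiff W →ₗ[ℝ] Cod ι hι.embedding.contMDiff W,
          IsLinearization ρ τ lam D' → D' = D) ∧
        IsFirstOrder D ∧ IsSelfAdjointOp θ D ∧ IsElliptic D := by
  have hsm := hι.embedding.contMDiff
  have hinj := fun p => mfderiv_injective_of_isImmersion hι.embedding.isImmersion p
  refine ⟨isSlicePoint_zero g hsm, isSliceTangentBundle_normalFamily hsm hinj lam,
    fun _ _ W _ _ hW => ⟨linearizedOperator h hlam hsol hsm W, ?_, ?_, ?_, ?_, ?_⟩⟩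
  · exact isLinearization_linearizedOperator h hlam hsol
  · exact fun _ h1 => (isLinearization_linearizedOperator h hlam hsol).unique hlam h1
  · exact isFirstOrder_linearizedOperator h hlam hsol
  · exact isSelfAdjointOp_linearizedOperator h hlam hsol hθ
  · exact isElliptic_linearizedOperator h hlam hsol hsm hinj hW.compl
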